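/- Let $p$ be a prime, $q$ a power of $p$, $A=\mathbb F_q[T]$, $A_+$ the set of monic elements of $A$, $K_\infty=\mathbb F_q((1/T))$ the completion of $\mathbb F_q(T)$ at the place $\infty$, $\mathbb C_\infty$ the completion of an algebraic closure of $K_\infty$, and $\Omega=\mathbb C_\infty\setminus K_\infty$ the Drinfeld upper half plane, with $|z|_i=\inf_{x\in K_\infty}|z-x|$. Let $e(z)=\sum_{i\ge 0} z^{q^i}/D_i$, $D_i=\prod_{j<i}(T^{q^i}-T^{q^j})$, be the Carlitz exponential, $\tilde\pi$ a period of the Carlitz module (that is, $\tilde\pi\neq0$ and $\ker e=\tilde\pi A$), $t(z)=1/e(\tilde\pi z)$ and $t_a=t(az)$ for $a\in A_+$. Let $G_n(X)$ be the $n$-th Goss polynomial of the lattice $\tilde\pi A$: $G_j=0$ for $j\le 0$, $G_1=X$, and $G_n=X\left(G_{n-1}+D_1^{-1}G_{n-q}+D_2^{-1}G_{n-q^2}+\cdots\right)$ for $n\ge2$. For $k\ge 0$ and $m\in\mathbb Z$, let $S_{k,m}(\mathrm{GL}_2(A))$ be the space of cuspidal Drinfeld modular forms of weight $k$ and type $m$: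 the rigid analytic functions $f:\Omega\to\mathbb C_\infty$ with $f\left(\frac{az+b}{cz+d}\right)=(cz+d)^k(\det\gamma)^{-m}f(z)$ for all $\gamma=\begin{pmatrix}a&b\\c&d\end{pmatrix}\in\mathrm{GL}_2(A)$ which, for $|z|_i$ large, have an expansion $f(z)=\sum_{j\ge1}a_jt(z)^j$ (the $t$-expansion of $f$). Let $k,n$ be positive integers such that $k-2n$ is a positive multiple of $q-1$ and $n\le p^{v_p(k-n)}$, where $v_p$ is the $p$-adic valuation. Then the series $$f_{k,n}(z)=\sum_{a\in A_+}a^{k-n}G_n(t(az))$$ converges for every $z\in\Omega$, and $f_{k,n}\in S_{k,m}(\mathrm{GL}_2(A))$ for every integer $m\equiv n \pmod{q-1}$. Moreover $f_{k,n}=\sum_{a\in A_+}a^{k-n}G_n(t_a)$ is an $A$-expansion of $f_{k,n}$: the identity holds in $\mathbb C_\infty[[t]]$, between the $t$-expansion of $f_{k,n}$ and the sum in which $t_a$ stands for the power series $t^{q^d}/\left(\rho_a(t^{-1})\,t^{q^d}\right)$, where $d=\deg a$ and $\rho$ is the Carlitz module ($\rho_T(X)=TX+X^q$). The functions $f_{k,n}$,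 for all such pairs $(k,n)$, form an infinite set; so there are infinitely many cusp forms with $A$-expansions. -/

import Mathlib

open scoped NNReal

noncomputable section

namespace Drinfeld

open Polynomial

section Fields

variable (F : Type*) [Field F] [Fintype F]

/-! ### The fields `K_∞ = F((1/T))` and `ℂ_∞`

Throughout, `F` is the finite field with `q` elements, `A = F[T]` is `F[X]`, and `K = F(T)` is
`RatFunc F`. -/

open Classical in
/-- `K_∞`: the completion of `F(T)` at the place at infinity. -/
abbrev KInf : Type _ := RatFunc.CompletionAtInfty F

theorem one_lt_card : (1 : ℝ≥0) < (Fintype.card F : ℝ≥0) := by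
  exact_mod_cast Fintype.one_lt_card

open MonoidWithZeroHom.ValueGroup₀ in
/-- The real-valued absolute value of `K_∞` is normalized by `|T| = q`. -/
instance : Valuation.RankOne (Valued.v : Valuation (KInf F) (WithZero (Multiplicative ℤ))) where
  hom' := (WithZeroMulInt.toNNReal (one_lt_card F).ne_zero).comp embedding
  strictMono' := (WithZeroMulInt.toNNReal_strictMono (one_lt_card F)).comp embedding_strictMono
  exists_val_nontrivial := by
    classical
    let i := RatFunc.inftyValued F
    refine ⟨algebraMap (RatFunc F) (KInf F) RatFunc.X, ?_⟩
    have h : (Valued.v (algebraMap (RatFunc F) (KInf F) RatFunc.X) :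
        WithZero (Multiplicative ℤ)) = WithZero.exp 1 :=
      (Valued.extensionValuation_apply_coe _).trans (RatFunc.inftyValuation.X F)
    rw [h]
    decide

instance : NontriviallyNormedField (KInf F) := Valued.toNontriviallyNormedField (KInf F) _

instance : IsUltrametricDist (KInf F) :=
  inferInstanceAs <| @IsUltrametricDist (KInf F) (Valued.toNormedField (KInf F) _).toDist

open Classical in
instance : CompleteSpace (KInf F) :=
  inferInstanceAs <| CompleteSpace
    (@UniformSpace.Completion (RatFunc F) (RatFunc.inftyValued F).toUniformSpace)

/-- An algebraic closure of `K_∞`. -/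
abbrev KInfAlgCl : Type _ := AlgebraicClosure (KInf F)

/-- The unique extension to the algebraic closure of the absolute value of `K_∞`. -/
instance : NormedField (KInfAlgCl F) := spectralNorm.normedField (KInf F) (KInfAlgCl F)

/-- `ℂ_∞`: the completion of the algebraic closure of `K_∞`. -/
abbrev CInf : Type _ := UniformSpace.Completion (KInfAlgCl F)

/-- The inclusion of `K_∞` into `ℂ_∞`. -/
def ofKInf : KInf F →+* CInf F :=
  UniformSpace.Completion.coeRingHom.comp (algebraMap (KInf F) (KInfAlgCl F))

/-- The inclusion of `A = F[T]` into `ℂ_∞`. -/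
def ofPoly : F[X] →+* CInf F :=
  (ofKInf F).comp ((algebraMap (RatFunc F) (KInf F)).comp (algebraMap F[X] (RatFunc F)))

end Fields

section UpperHalfPlane

variable (F : Type*) [Field F] [Fintype F]

/-- The Drinfeld upper half plane `Ω = ℂ_∞ ∖ K_∞`. -/
def Omega : Type _ := {z : CInf F // z ∉ Set.range (ofKInf F)}

variable {F}

/-- The point of `ℂ_∞` underlying a point of `Ω`. -/
def Omega.val (z : Omega F) : CInf F := Subtype.val z

/-- The imaginary part `|z|_i = inf {|z - x| : x ∈ K_∞}`. -/
def imAbs (z : CInf F) : ℝ := Metric.infDist z (Set.range (ofKInf F))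

/-- The standard affinoids `{z : |z| ≤ q^N, |z|_i ≥ q^(-N)}`; they form an admissible covering
of `Ω`. -/
def affinoid (N : ℕ) : Set (Omega F) :=
  {z | ‖z.val‖ ≤ (Fintype.card F : ℝ) ^ N ∧ ((Fintype.card F : ℝ) ^ N)⁻¹ ≤ imAbs z.val}

/-- Rigid analytic functions on `Ω`: on each standard affinoid, `f` is a uniform limit of rational
functions without poles on that affinoid. -/
def IsHolomorphic (f : Omega F → CInf F) : Prop :=
  ∀ N : ℕ, ∀ ε : ℝ, 0 < ε → ∃ P Q : (CInf F)[X],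
    ∀ z ∈ affinoid N, Q.eval z.val ≠ 0 ∧ ‖f z - P.eval z.val / Q.eval z.val‖ < ε

/-- The numerator `a z + b` of `γ z = (a z + b) / (c z + d)`. -/
def num (γ : GL (Fin 2) F[X]) (z : CInf F) : CInf F :=
  ofPoly F (γ 0 0) * z + ofPoly F (γ 0 1)

/-- The denominator `c z + d`. -/
def denom (γ : GL (Fin 2) F[X]) (z : CInf F) : CInf F :=
  ofPoly F (γ 1 0) * z + ofPoly F (γ 1 1)

/-- The determinant of `γ ∈ GL₂(A)`, a nonzero constant, as an element of `ℂ_∞`. -/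
def detC (γ : GL (Fin 2) F[X]) : CInf F := ofPoly F (γ : Matrix (Fin 2) (Fin 2) F[X]).det

theorem detC_ne_zero (γ : GL (Fin 2) F[X]) : detC γ ≠ 0 :=
  (((Matrix.isUnit_iff_isUnit_det _).1 γ.isUnit).map (ofPoly F)).ne_zero

theorem div_not_mem (γ : GL (Fin 2) F[X]) (z : Omega F) :
    num γ z.val / denom γ z.val ∉ Set.range (ofKInf F) := by
  obtain ⟨z, hz⟩ := z
  have hdet := detC_ne_zero γ
  simp only [detC, Matrix.det_fin_two, map_sub, map_mul] at hdet
  simp only [Omega.val, num, denom]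
  set ι : F[X] →+* KInf F := (algebraMap (RatFunc F) (KInf F)).comp (algebraMap F[X] (RatFunc F))
  have hι : ∀ a, ofPoly F a = ofKInf F (ι a) := fun _ => rfl
  simp only [hι] at hdet ⊢
  generalize ι (γ 0 0) = a at *
  generalize ι (γ 0 1) = b at *
  generalize ι (γ 1 0) = c at *
  generalize ι (γ 1 1) = d at *
  -- an affine relation for `z` over `K_∞` is trivial
  have key : ∀ s t : KInf F, ofKInf F s * z = ofKInf F t → s = 0 ∧ t = 0 := by
    intro s t h
    by_cases hs : s = 0
    · subst hs
      simp only [map_zero, zero_mul] at h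
      exact ⟨rfl, ((map_eq_zero _).1 h.symm)⟩
    · refine absurd ⟨t / s, ?_⟩ hz
      have hs' : ofKInf F s ≠ 0 := (_root_.map_ne_zero _).2 hs
      rw [map_div₀, div_eq_iff hs', ← h, mul_comm]
  rintro ⟨x, hx⟩
  have hcd : ofKInf F c * z + ofKInf F d ≠ 0 := by
    intro h
    obtain ⟨h1, h2⟩ := key c (-d) (by rw [map_neg]; linear_combination h)
    have h2' : d = 0 := by simpa using h2
    simp [h1, h2'] at hdet
  rw [eq_div_iff hcd] at hx
  obtain ⟨h1, h2⟩ := key (a - x * c) (x * d - b) (by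
    simp only [map_sub, map_mul]; linear_combination -hx)
  apply hdet
  have e1 : a = x * c := sub_eq_zero.1 h1
  have e2 : b = x * d := (sub_eq_zero.1 h2).symm
  rw [e1, e2]
  simp only [map_mul]
  ring

/-- The action of `GL₂(A)` on `Ω` by fractional linear transformations. -/
def moebius (γ : GL (Fin 2) F[X]) (z : Omega F) : Omega F :=
  ⟨num γ z.val / denom γ z.val, div_not_mem γ z⟩

end UpperHalfPlane

section Carlitz

variable (F : Type*) [Field F] [Fintype F]

/-- `D_i = ∏_{j < i} (T^(q^i) - T^(q^j))`. -/
def carlitzD (i : ℕ) : F[X] :=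
  ∏ j ∈ Finset.range i, (X ^ Fintype.card F ^ i - X ^ Fintype.card F ^ j)

/-- The coefficient `1 / D_i` of `z^(q^i)` in the Carlitz exponential. -/
def expCoeff (i : ℕ) : CInf F := (ofPoly F (carlitzD F i))⁻¹

/-- The Carlitz exponential `∑ z^(q^i) / D_i`, an entire function. -/
def carlitzExp (z : CInf F) : CInf F := ∑' i : ℕ, expCoeff F i * z ^ Fintype.card F ^ i

variable {F}

/-- `ϖ` is a period of the Carlitz module: the kernel of the Carlitz exponential is the rank one
lattice `ϖ A`. -/
def IsCarlitzPeriod (ϖ : CInf F) : Prop :=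
  ϖ ≠ 0 ∧ {z : CInf F | carlitzExp F z = 0} = Set.range fun a : F[X] => ϖ * ofPoly F a

variable (F)

/-- The polynomial `ρ_T(X) = T X + X^q`. -/
def carlitzT : (CInf F)[X] := C (ofPoly F X) * X + X ^ Fintype.card F

/-- The Carlitz module: for `a = ∑ c_i T^i`, `ρ_a = ∑ c_i ρ_(T^i)`, where `ρ_(T^i)` is the `i`-fold
composite of `ρ_T`. -/
def carlitzModule (a : F[X]) : (CInf F)[X] :=
  a.sum fun i c => C (ofPoly F (C c)) * (carlitzT F).comp^[i] X

/-- The Goss polynomials of the lattice with exponential `∑ α_i z^(q^i)`: `G_n = 0` for `n ≤ 0`,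
`G_1 = X`, and `G_n = X (α_0 G_(n - 1) + α_1 G_(n - q) + α_2 G_(n - q²) + ⋯)` for `n ≥ 2`. -/
def gossPolyOf (α : ℕ → CInf F) : ℕ → (CInf F)[X]
  | 0 => 0
  | 1 => X
  | n + 2 => X * ∑ i ∈ Finset.range (n + 2),
      if Fintype.card F ^ i ≤ n + 2 then
        have : 0 < Fintype.card F ^ i := pow_pos Fintype.card_pos i
        C (α i) * gossPolyOf α (n + 2 - Fintype.card F ^ i)
      else 0

/-- The Goss polynomials `G_n` of the period lattice of the Carlitz module. -/
def gossPoly (n : ℕ) : (CInf F)[X] := gossPolyOf F (expCoeff F) n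

variable {F}

/-- `t(z) = 1 / e(ϖ z)`, where `e` is the Carlitz exponential. -/
def tFun (ϖ z : CInf F) : CInf F := (carlitzExp F (ϖ * z))⁻¹

/-- The power series `t_a = t^(q^d) / (ρ_a(t⁻¹) t^(q^d))` in `t`, where `d = deg a`; it is the
expansion of `t(a z)`. -/
def tSeries (a : F[X]) : PowerSeries (CInf F) :=
  PowerSeries.X ^ Fintype.card F ^ a.natDegree *
    (((carlitzModule F a).reflect (Fintype.card F ^ a.natDegree) : (CInf F)[X]) :
      PowerSeries (CInf F))⁻¹

end Carlitz

section ModularForms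

variable {F : Type*} [Field F] [Fintype F]

/-- `f` has the `t`-expansion `∑ P_j t^j`, convergent in a neighbourhood `|z|_i ≥ r` of
infinity. -/
def HasTExpansion (ϖ : CInf F) (f : Omega F → CInf F) (P : PowerSeries (CInf F)) : Prop :=
  ∃ r : ℝ, ∀ z : Omega F, r ≤ imAbs z.val →
    HasSum (fun j : ℕ => PowerSeries.coeff j P * tFun ϖ z.val ^ j) (f z)

/-- `f ∈ M_{k,m}(GL₂(A))`: Drinfeld modular forms of weight `k` and type `m`. -/
structure IsModularForm (ϖ : CInf F) (k : ℕ) (m : ℤ) (f : Omega F → CInf F) : Prop where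
  holomorphic : IsHolomorphic f
  transform : ∀ (γ : GL (Fin 2) F[X]) (z : Omega F),
    f (moebius γ z) = denom γ z.val ^ k * detC γ ^ (-m) * f z
  holomorphic_at_infinity : ∃ P : PowerSeries (CInf F), HasTExpansion ϖ f P

/-- `f ∈ S_{k,m}(GL₂(A))`: the `t`-expansion of the modular form `f` has no constant term. -/
structure IsCuspForm (ϖ : CInf F) (k : ℕ) (m : ℤ) (f : Omega F → CInf F) : Prop
    extends IsModularForm ϖ k m f where
  zero_at_infinity : ∃ P : PowerSeries (CInf F),
    HasTExpansion ϖ f P ∧ PowerSeries.constantCoeff P = 0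

/-- The set `A_+` of monic polynomials. -/
abbrev Monics (F : Type*) [Field F] : Type _ := {a : F[X] // a.Monic}

/-- `f` has the `A`-expansion `c₀ + ∑_{a ∈ A_+} c_a G_n(t_a)`: the `t`-expansion of `f` is equal to
this sum in `ℂ_∞[[t]]`, coefficient by coefficient (each of them a finite sum). -/
def HasAExpansion (ϖ : CInf F) (f : Omega F → CInf F) (n : ℕ) (c₀ : CInf F)
    (c : Monics F → CInf F) : Prop :=
  ∃ P : PowerSeries (CInf F), HasTExpansion ϖ f P ∧ ∀ j : ℕ,
    (Function.support fun a : Monics F =>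
      PowerSeries.coeff j (c a • aeval (tSeries a.1) (gossPoly F n))).Finite ∧
    PowerSeries.coeff j P = PowerSeries.coeff j (PowerSeries.C c₀) +
      ∑ᶠ a : Monics F, PowerSeries.coeff j (c a • aeval (tSeries a.1) (gossPoly F n))

/-- The term `a^(k - n) G_n(t(a z))`. -/
def fTerm (ϖ : CInf F) (k n : ℕ) (z : Omega F) (a : Monics F) : CInf F :=
  ofPoly F a.1 ^ (k - n) * (gossPoly F n).eval (tFun ϖ (ofPoly F a.1 * z.val))

/-- `f_{k,n} = ∑_{a ∈ A_+} a^(k - n) G_n(t_a)` as a function on `Ω`. -/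
def fSeries (ϖ : CInf F) (k n : ℕ) (z : Omega F) : CInf F :=
  ∑' a : Monics F, fTerm ϖ k n z a

/-- The conditions on `(k, n)`: both are positive, `k - 2n` is a positive multiple of `q - 1`, and
`n ≤ p^(v_p(k - n))`. -/
structure Admissible (p q k n : ℕ) : Prop where
  k_pos : 0 < k
  n_pos : 0 < n
  two_mul_lt : 2 * n < k
  dvd : q - 1 ∣ k - 2 * n
  le_pow : n ≤ p ^ padicValNat p (k - n)

end ModularForms

end Drinfeld

end

open Drinfeld

/-!
Let `A_{<N}` be the finite lattice of polynomials of degree less than `N`, with exponential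
polynomial `e_N(x) = x ∏ (1 - x / b)`. The proof rests on finite identities for these lattices and
on their limits as `N → ∞`.

*Goss's identity.* Lagrange interpolation at the points of `A_{<N}` shows that the finite sums
`∑ (x - b)^(-n)` satisfy the recursion of the Goss polynomials, with the coefficients of `e_N`
instead of those of the Carlitz exponential (`boxSum_recursion`). For `N → ∞` these coefficients
converge. The relation `e_{N+1}(T x) = T e_N(x) + κ_N e_N(x)^q` identifies the limit of `e_N(x)`
with `e(ϖ x) / ϖ`, where `e` is the Carlitz exponential: it shows first that `e(c x) / c` is the
limit if `c^(q-1) = κ = lim κ_N`, so that the kernel of `e` is `c A`; then every period `ϖ` differs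
from `c` by a nonzero constant, and `ϖ^(q-1) = κ` too (`tendsto_boxKappa_period`). Consequently
`∑_{b ∈ A} (x - b)^(-n) = ϖ^n G_n(t(x))` (`latSum_eq`). Since `q - 1` divides `k - 2 n`, the term
`a^(k-n) ∑_b (a z - b)^(-n)` does not change when `a` is multiplied by one of the `q - 1` nonzero
constants, so that `f_{k,n} = -ϖ^(-n) ∑_a a^(k-n) ∑_b (a z - b)^(-n)` over all `a` (`fSeries_eq`).

*Modularity.* The double sum is not absolutely convergent in `(a, b)`, but it is the limit of the
sums over the squares `A_{<N} × A_{<N}`, uniformly on the standard affinoids: the product formula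
for `e_N` shows that `e_N(a z)` grows faster than every power of `|a|`, uniformly in `N`
(`exists_norm_pow_mul_boxSum_le`, `exists_norm_squareSum_sub_le`). Hence it is holomorphic, and its
behaviour under `z ↦ -1 / z` can be read off from the sums over squares. For them the symmetry is
exact when `N` is large (`squareSum_neg_inv`): with `P = p^(v_p(k-n))` the difference of the two
sides is a sum of terms `(b^(k-n) - (a z)^(k-n)) / (a z - b)^n`, in which the denominator divides
`(a z - b)^P = (a z)^P - b^P` and thus the numerator, because `n ≤ P`. So these terms are
polynomials in `a`, whose sum over `A_{<N}` is zero. By the Euclidean algorithm (`GL_induction`)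
inversion and the upper triangular matrices generate `GL₂(A)`.

*Expansion at infinity.* The functional equation `e(a y) = ρ_a(e(y))` says that `t_a`, evaluated at
`t(z)`, is `t(a z)` (`hasEval_tSeries`). The coefficient of `t^j` in `t_a` is bounded by `q^j` for
every `a`, and vanishes for `j < q^(deg a)`; so the double series over `a` and `j` converges for
small `t` and may be summed in either order.

*Infinitude.* For `n = 1` there are infinitely many weights `k`. The functions `f_{k,1}` are nonzero
near infinity, where the term `t(z)` dominates, and for different weights they behave differently
under inversion (`weight_eq_of_fSeries_eq`).
-/

noncomputable section

namespace Drinfeld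

open Polynomial Filter Topology

/-! ### Absolute values on `K_∞` and `ℂ_∞` -/

section Concrete
variable (F : Type*) [Field F] [Fintype F]

theorem norm_KInf_X : ‖algebraMap (RatFunc F) (KInf F) RatFunc.X‖ = Fintype.card F := by
  classical
  let i := RatFunc.inftyValued F
  have h : (Valued.v (algebraMap (RatFunc F) (KInf F) RatFunc.X) :
        WithZero (Multiplicative ℤ)) = WithZero.exp 1 :=
      (Valued.extensionValuation_apply_coe _).trans (RatFunc.inftyValuation.X F)
  have h2 := Valuation.norm_def (Valued.v : Valuation (KInf F) (WithZero (Multiplicative ℤ)))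
    (x := algebraMap (RatFunc F) (KInf F) RatFunc.X)
  refine Eq.trans h2 ?_
  change ((WithZeroMulInt.toNNReal (one_lt_card F).ne_zero)
    (MonoidWithZeroHom.ValueGroup₀.embedding _) : ℝ) = _
  rw [Valuation.embedding_restrict, h]
  rw [WithZeroMulInt.toNNReal_neg_apply _ WithZero.exp_ne_zero]
  simp [WithZero.exp]

instance : IsUltrametricDist (KInfAlgCl F) :=
  IsUltrametricDist.isUltrametricDist_of_isNonarchimedean_norm
    (isNonarchimedean_spectralNorm (K := KInf F) (L := KInfAlgCl F))

instance : IsUltrametricDist (CInf F) := by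
  refine IsUltrametricDist.isUltrametricDist_of_isNonarchimedean_norm fun x y => ?_
  induction x, y using UniformSpace.Completion.induction_on₂ with
  | hp => exact isClosed_le (by fun_prop) (by fun_prop)
  | ih a b =>
    rw [← UniformSpace.Completion.coe_add]
    simp only [UniformSpace.Completion.norm_coe]
    exact IsUltrametricDist.isNonarchimedean_norm a b

theorem norm_ofKInf (x : KInf F) : ‖ofKInf F x‖ = ‖x‖ := by
  refine (UniformSpace.Completion.norm_coe _).trans ?_
  exact spectralNorm_extends x

theorem isClosed_range_ofKInf : IsClosed (Set.range (ofKInf F)) := by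
  have : Isometry (ofKInf F) := AddMonoidHomClass.isometry_of_norm _ (norm_ofKInf F)
  exact this.isClosedEmbedding.isClosed_range

theorem norm_ofPoly_X : ‖ofPoly F X‖ = Fintype.card F := by
  simp only [ofPoly, RingHom.comp_apply, norm_ofKInf, RatFunc.algebraMap_X]
  exact norm_KInf_X F

theorem exists_pow_eq_ofPoly (a : F[X]) {m : ℕ} (hm : m ≠ 0) :
    ∃ s : CInf F, s ^ m = ofPoly F a := by
  obtain ⟨s, hs⟩ := IsAlgClosed.exists_pow_nat_eq (algebraMap (KInf F) (KInfAlgCl F)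
    ((algebraMap (RatFunc F) (KInf F)) (algebraMap F[X] (RatFunc F) a))) (Nat.pos_of_ne_zero hm)
  exact ⟨(s : CInf F), by
    have := congrArg (UniformSpace.Completion.coeRingHom (α := KInfAlgCl F)) hs
    rw [map_pow] at this
    exact this⟩

/-- A square root of `T` is not in `K_∞`. -/
theorem nonempty_Omega : Nonempty (Omega F) := by
  classical
  let i := RatFunc.inftyValued F
  obtain ⟨s, hs⟩ := exists_pow_eq_ofPoly F X two_ne_zero
  refine ⟨⟨s, ?_⟩⟩
  rintro ⟨x, rfl⟩
  rw [← map_pow] at hs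
  have h1 : x ^ 2 = algebraMap (RatFunc F) (KInf F) RatFunc.X := by
    have := (ofKInf F).injective hs
    rwa [RingHom.comp_apply, RatFunc.algebraMap_X] at this
  have h : (Valued.v (algebraMap (RatFunc F) (KInf F) RatFunc.X) :
        WithZero (Multiplicative ℤ)) = WithZero.exp 1 :=
      (Valued.extensionValuation_apply_coe _).trans (RatFunc.inftyValuation.X F)
  rw [← h1, map_pow] at h
  -- the value group of `K_∞` is `ℤ`, and `1` is odd
  generalize (Valued.v x : WithZero (Multiplicative ℤ)) = v at h
  have hv : v ≠ 0 := by
    rintro rfl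
    exact WithZero.exp_ne_zero (h.symm.trans (zero_pow two_ne_zero))
  have h3 := congrArg WithZero.log h
  rw [WithZero.log_pow, WithZero.log_exp] at h3
  simp at h3
  omega

/-- A polynomial of degree `d` has absolute value `q ^ d`. -/
theorem norm_ofPoly {a : F[X]} (ha : a ≠ 0) :
    ‖ofPoly F a‖ = (Fintype.card F : ℝ) ^ a.natDegree := by
  have hq : (1 : ℝ) < Fintype.card F := by exact_mod_cast Fintype.one_lt_card
  have hC : ∀ c : F, c ≠ 0 → ‖ofPoly F (C c)‖ = 1 := fun c hc => by
    have h : ‖ofPoly F (C c)‖ ^ (Fintype.card F - 1) = 1 := by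
      rw [← norm_pow, ← map_pow, ← C_pow, FiniteField.pow_card_sub_one_eq_one c hc]
      simp
    exact (pow_eq_one_iff_of_nonneg (norm_nonneg _)
      (Nat.sub_ne_zero_of_lt Fintype.one_lt_card)).1 h
  induction a using Polynomial.recOnHorner with
  | M0 => exact absurd rfl ha
  | MC p c hp hc ih =>
    by_cases h0 : p = 0
    · simp [h0, hC c hc]
    · have hdeg : p.natDegree ≠ 0 := fun h => h0 (by
        rw [eq_C_of_natDegree_eq_zero h, hp, C_0])
      have h1 : 1 < ‖ofPoly F p‖ := by rw [ih h0]; exact one_lt_pow₀ hq hdeg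
      rw [map_add, IsUltrametricDist.norm_add_eq_max_of_norm_ne_norm
        (by rw [hC c hc]; exact h1.ne'), hC c hc, max_eq_left h1.le, ih h0, natDegree_add_C]
  | MX p hp ih =>
    rw [map_mul, norm_mul, ih hp, norm_ofPoly_X, natDegree_mul_X hp, pow_succ]

end Concrete

/-! ### The polynomials of degree less than `N` -/

section Box

variable {F : Type*} [Field F] [Fintype F]

variable (F) in
open Classical in
/-- The finite set `A_{<N}` of polynomials of degree less than `N`. -/
def box (N : ℕ) : Finset F[X] :=
  Finset.univ.image fun c : Fin N → F => ∑ i, C (c i) * X ^ (i : ℕ)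

theorem mem_box {N : ℕ} {a : F[X]} : a ∈ box F N ↔ a.degree < N := by
  classical
  simp only [box, Finset.mem_image, Finset.mem_univ, true_and]
  constructor
  · rintro ⟨c, rfl⟩
    exact degree_sum_fin_lt c
  · intro h
    refine ⟨fun i => a.coeff i, ?_⟩
    rw [Fin.sum_univ_eq_sum_range (fun i => C (a.coeff i) * X ^ i) N]
    ext n
    simp only [finsetSum_coeff, coeff_C_mul, coeff_X_pow, mul_ite, mul_one, mul_zero,
      Finset.sum_ite_eq, Finset.mem_range]
    split_ifs with hn
    · rfl
    · exact (coeff_eq_zero_of_degree_lt (h.trans_le (by exact_mod_cast not_lt.1 hn))).symm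

theorem mem_box_iff_natDegree {N : ℕ} {a : F[X]} (ha : a ≠ 0) :
    a ∈ box F N ↔ a.natDegree < N := by
  rw [mem_box, natDegree_lt_iff_degree_lt ha]

theorem zero_mem_box (N : ℕ) : (0 : F[X]) ∈ box F N := by
  rw [mem_box, degree_zero]; exact WithBot.bot_lt_coe N

theorem box_zero : box F 0 = {0} := by
  ext a
  rw [mem_box, Finset.mem_singleton]
  simp

theorem box_mono {M N : ℕ} (h : M ≤ N) : box F M ⊆ box F N := fun a ha => by
  rw [mem_box] at ha ⊢
  exact ha.trans_le (by exact_mod_cast h)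

theorem add_mem_box {N : ℕ} {a b : F[X]} (ha : a ∈ box F N) (hb : b ∈ box F N) :
    a + b ∈ box F N := by
  rw [mem_box] at *
  exact (degree_add_le _ _).trans_lt (max_lt ha hb)

theorem neg_mem_box {N : ℕ} {a : F[X]} : -a ∈ box F N ↔ a ∈ box F N := by
  rw [mem_box, mem_box, degree_neg]

theorem prod_box_succ {M : Type*} [CommMonoid M] (N : ℕ) (g : F[X] → M) :
    ∏ b ∈ box F (N + 1), g b = ∏ c : F, ∏ b ∈ box F N, g (b + C c * X ^ N) := by
  rw [← Finset.prod_product']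
  refine Finset.prod_bij' (fun b _ => (b.coeff N, b - C (b.coeff N) * X ^ N))
    (fun x _ => x.2 + C x.1 * X ^ N) ?_ ?_ ?_ ?_ ?_
  · intro b hb
    rw [mem_box] at hb
    simp only [Finset.mem_product, Finset.mem_univ, true_and, mem_box, degree_lt_iff_coeff_zero]
    intro m hm
    rcases hm.eq_or_lt with rfl | hm
    · simp
    · have : b.coeff m = 0 := coeff_eq_zero_of_degree_lt (hb.trans_le (by exact_mod_cast hm))
      simp [this, coeff_X_pow, hm.ne']
  · rintro ⟨c, b⟩ hb
    simp only [Finset.mem_product, Finset.mem_univ, true_and, mem_box] at hb ⊢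
    refine (degree_add_le _ _).trans_lt
      (max_lt (hb.trans (by exact_mod_cast Nat.lt_succ_self N)) ?_)
    exact (degree_C_mul_X_pow_le N c).trans_lt (by exact_mod_cast Nat.lt_succ_self N)
  · intro b _; simp
  · rintro ⟨c, b⟩ hb
    simp only [Finset.mem_product, Finset.mem_univ, true_and, mem_box] at hb ⊢
    simp [coeff_eq_zero_of_degree_lt hb]
  · intro b _; simp

theorem sum_box_succ {M : Type*} [AddCommMonoid M] (N : ℕ) (g : F[X] → M) :
    ∑ b ∈ box F (N + 1), g b = ∑ c : F, ∑ b ∈ box F N, g (b + C c * X ^ N) :=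
  prod_box_succ (M := Multiplicative M) N fun b => Multiplicative.ofAdd (g b)

theorem prod_box_succ_X_mul {M : Type*} [CommMonoid M] (N : ℕ) (g : F[X] → M) :
    ∏ b ∈ box F (N + 1), g b = ∏ c : F, ∏ b ∈ box F N, g (C c + X * b) := by
  rw [← Finset.prod_product']
  refine Finset.prod_bij' (fun b _ => (b.coeff 0, b.divX))
    (fun x _ => C x.1 + X * x.2) ?_ ?_ ?_ ?_ ?_
  · intro b hb
    rw [mem_box] at hb
    simp only [Finset.mem_product, Finset.mem_univ, true_and, mem_box, degree_lt_iff_coeff_zero]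
    intro m hm
    rw [coeff_divX]
    exact coeff_eq_zero_of_degree_lt (hb.trans_le (by exact_mod_cast Nat.succ_le_succ hm))
  · rintro ⟨c, b⟩ hb
    simp only [Finset.mem_product, Finset.mem_univ, true_and, mem_box, degree_lt_iff_coeff_zero]
      at hb ⊢
    intro m hm
    obtain ⟨m, rfl⟩ : ∃ j, m = j + 1 := ⟨m - 1, by omega⟩
    simp [coeff_C_succ, hb m (by omega)]
  · intro b _
    exact (add_comm _ _).trans (X_mul_divX_add b)
  · rintro ⟨c, b⟩ hb
    simp only [coeff_add, coeff_C_zero, mul_coeff_zero, coeff_X_zero, zero_mul, add_zero,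
      Prod.mk.injEq, true_and]
    ext m
    rw [coeff_divX, coeff_add, coeff_C_succ, coeff_X_mul, zero_add]
  · intro b _
    rw [add_comm, X_mul_divX_add]

theorem card_box (N : ℕ) : (box F N).card = Fintype.card F ^ N := by
  induction N with
  | zero => simp [box_zero]
  | succ N ih =>
    rw [Finset.card_eq_sum_ones, sum_box_succ]
    simp [ih, pow_succ, mul_comm]

end Box

/-! ### The Frobenius map over `F[T]` -/

section Frobenius

variable {F : Type*} [Field F] [Fintype F] {K : Type*} [Field K]

theorem card_cast_eq_zero (ι : F[X] →+* K) : (Fintype.card F : K) = 0 := by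
  rw [← map_natCast (ι.comp C), FiniteField.cast_card_eq_zero, map_zero]

theorem add_pow_card (ι : F[X] →+* K) (x y : K) :
    (x + y) ^ Fintype.card F = x ^ Fintype.card F + y ^ Fintype.card F := by
  let _ := (ι.comp C).toAlgebra
  exact map_add (FiniteField.frobeniusAlgHom F K) x y

theorem sub_pow_card (ι : F[X] →+* K) (x y : K) :
    (x - y) ^ Fintype.card F = x ^ Fintype.card F - y ^ Fintype.card F := by
  let _ := (ι.comp C).toAlgebra
  exact map_sub (FiniteField.frobeniusAlgHom F K) x y

theorem add_pow_card_pow (ι : F[X] →+* K) (x y : K) (i : ℕ) :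
    (x + y) ^ Fintype.card F ^ i = x ^ Fintype.card F ^ i + y ^ Fintype.card F ^ i := by
  induction i with
  | zero => simp
  | succ i ih => rw [pow_succ, pow_mul, ih, add_pow_card ι, ← pow_mul, ← pow_mul]

theorem const_pow_card (ι : F[X] →+* K) (c : F) : ι (C c) ^ Fintype.card F = ι (C c) := by
  rw [← map_pow, ← C_pow, FiniteField.pow_card]

theorem sum_pow_card (ι : F[X] →+* K) {α : Type*} (s : Finset α) (f : α → K) :
    (∑ i ∈ s, f i) ^ Fintype.card F = ∑ i ∈ s, f i ^ Fintype.card F := by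
  let _ := (ι.comp C).toAlgebra
  exact map_sum (FiniteField.frobeniusAlgHom F K) f s

theorem exists_card_eq_pow (ι : F[X] →+* K) : ∃ p n : ℕ, ExpChar K p ∧ Fintype.card F = p ^ n := by
  obtain ⟨p, hp⟩ := CharP.exists F
  obtain ⟨n, hpp, hn⟩ := FiniteField.card F p
  have := Fact.mk hpp
  have : CharP K p := charP_of_injective_ringHom (ι.comp C).injective p
  exact ⟨p, n, inferInstance, hn⟩

theorem coeff_pow_card_mul (ι : F[X] →+* K) (P : K[X]) (m : ℕ) :
    (P ^ Fintype.card F).coeff (Fintype.card F * m) = P.coeff m ^ Fintype.card F := by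
  obtain ⟨p, n, _, hq⟩ := exists_card_eq_pow ι
  have h0 : 0 < p ^ n := hq ▸ Fintype.card_pos
  rw [hq, ← map_iterateFrobenius_expand, coeff_map, mul_comm, coeff_expand_mul h0,
    iterateFrobenius_def]

theorem coeff_pow_card_one (ι : F[X] →+* K) (P : K[X]) : (P ^ Fintype.card F).coeff 1 = 0 := by
  have h1 : 1 < Fintype.card F := Fintype.one_lt_card
  obtain ⟨p, n, _, hq⟩ := exists_card_eq_pow ι
  have h0 : 0 < p ^ n := hq ▸ Fintype.card_pos
  rw [hq] at h1 ⊢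
  rw [← map_iterateFrobenius_expand, coeff_map, coeff_expand h0, if_neg, map_zero]
  intro h
  exact h1.ne' (Nat.dvd_one.1 h)

/-- The homogeneous form of the identity `∏ (X - c) = X^q - X`. -/
theorem prod_sub_const_mul (ι : F[X] →+* K) (x y : K) :
    ∏ c : F, (x - ι (C c) * y) = x ^ Fintype.card F - y ^ (Fintype.card F - 1) * x := by
  have hq : 1 < Fintype.card F := Fintype.one_lt_card
  have key : ∏ c : F, (X - C c) = (X ^ Fintype.card F - X : F[X]) := by
    have := prod_multiset_X_sub_C_of_monic_of_roots_card_eq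
      (p := (X ^ Fintype.card F - X : F[X])) (monic_X_pow_sub (by
        rw [degree_X]; exact_mod_cast hq)) (by
        rw [FiniteField.roots_X_pow_card_sub_X, FiniteField.X_pow_card_sub_X_natDegree_eq F hq]
        rfl)
    rw [FiniteField.roots_X_pow_card_sub_X] at this
    exact this
  by_cases hy : y = 0
  · subst hy
    simp [zero_pow (Nat.sub_ne_zero_of_lt hq)]
  · have h2 := congrArg (eval₂ (ι.comp C) (x / y)) key
    rw [eval₂_finsetProd] at h2
    simp only [eval₂_sub, eval₂_X, eval₂_C, eval₂_pow, RingHom.comp_apply] at h2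
    have h3 : ∀ c : F, x - ι (C c) * y = y * (x / y - ι (C c)) := fun c => by
      field_simp
    simp only [h3]
    rw [Finset.prod_mul_distrib, h2, Finset.prod_const, Finset.card_univ]
    obtain ⟨m, hm⟩ : ∃ m, Fintype.card F = m + 1 := ⟨_, (Nat.sub_add_cancel hq.le).symm⟩
    rw [hm, Nat.add_sub_cancel]
    rw [div_pow]
    field_simp
    ring

end Frobenius

/-! ### Exponential polynomials of the lattices `A_{<N}` -/

section LatticePolynomial

variable {F : Type*} [Field F] [Fintype F] {K : Type*} [Field K] (ι : F[X] →+* K)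

/-- The monic polynomial `E_N` with simple roots the elements of degree less than `N` of `A`. -/
def latPoly (N : ℕ) : K[X] := Lagrange.nodal (box F N) ι

theorem eval_latPoly (N : ℕ) (x : K) : (latPoly ι N).eval x = ∏ b ∈ box F N, (x - ι b) :=
  Lagrange.eval_nodal

theorem latPoly_zero : latPoly ι 0 = X := by
  simp [latPoly, box_zero, Lagrange.nodal]

/-- The value at `0` of the derivative of `latPoly ι N`. -/
def latDeriv (N : ℕ) : K := (derivative (latPoly ι N)).eval 0

variable {ι}

theorem eval_latPoly_eq_zero_iff {N : ℕ} {x : K} :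
    (latPoly ι N).eval x = 0 ↔ ∃ b ∈ box F N, x = ι b := by
  rw [eval_latPoly, Finset.prod_eq_zero_iff]
  simp only [sub_eq_zero]

theorem eval_latPoly_X_pow_ne_zero (hι : Function.Injective ι) (N : ℕ) :
    (latPoly ι N).eval (ι (X ^ N)) ≠ 0 := by
  rw [Ne, eval_latPoly_eq_zero_iff]
  rintro ⟨b, hb, h⟩
  rw [← hι h, mem_box, degree_X_pow] at hb
  exact lt_irrefl _ hb

/-- The polynomial `E_N` is `F`-linear, and `E_{N+1} = E_N^q - E_N(T^N)^(q-1) E_N`. The two facts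
are proved together, by induction on `N`: the recursion for `E_{N+1}` uses the linearity of `E_N`,
and implies that of `E_{N+1}`. -/
theorem latPoly_linear_and_succ (hι : Function.Injective ι) (N : ℕ) :
    ((∀ x y, (latPoly ι N).eval (x + y) = (latPoly ι N).eval x + (latPoly ι N).eval y) ∧
      ∀ (c : F) x, (latPoly ι N).eval (ι (C c) * x) = ι (C c) * (latPoly ι N).eval x) ∧
    latPoly ι (N + 1) = latPoly ι N ^ Fintype.card F -
      C ((latPoly ι N).eval (ι (X ^ N)) ^ (Fintype.card F - 1)) * latPoly ι N := by
  have := Infinite.of_injective ι hι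
  have step : ∀ N, ((∀ x y, (latPoly ι N).eval (x + y) =
      (latPoly ι N).eval x + (latPoly ι N).eval y) ∧
      ∀ (c : F) x, (latPoly ι N).eval (ι (C c) * x) = ι (C c) * (latPoly ι N).eval x) →
      latPoly ι (N + 1) = latPoly ι N ^ Fintype.card F -
        C ((latPoly ι N).eval (ι (X ^ N)) ^ (Fintype.card F - 1)) * latPoly ι N := by
    rintro N ⟨hadd, hsmul⟩
    refine Polynomial.funext fun x => ?_
    rw [eval_latPoly, prod_box_succ, eval_sub, eval_pow, eval_mul, eval_C,
      ← prod_sub_const_mul ι]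
    refine Finset.prod_congr rfl fun c _ => ?_
    have h : (latPoly ι N).eval (x + ι (C (-c)) * ι (X ^ N)) =
      (latPoly ι N).eval x - ι (C c) * (latPoly ι N).eval (ι (X ^ N)) := by
      rw [hadd, hsmul, C_neg, map_neg]; ring
    rw [← h, eval_latPoly]
    refine Finset.prod_congr rfl fun b _ => ?_
    rw [map_add, map_mul, C_neg, map_neg]
    ring
  have lin : (∀ x y, (latPoly ι N).eval (x + y) = (latPoly ι N).eval x + (latPoly ι N).eval y) ∧
      ∀ (c : F) x, (latPoly ι N).eval (ι (C c) * x) = ι (C c) * (latPoly ι N).eval x := by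
    induction N with
    | zero => simp [latPoly_zero]
    | succ N ih =>
      rw [step N ih]
      obtain ⟨hadd, hsmul⟩ := ih
      constructor
      · intro x y
        simp only [eval_sub, eval_pow, eval_mul, eval_C, hadd, add_pow_card ι]
        ring
      · intro c x
        simp only [eval_sub, eval_pow, eval_mul, eval_C, hsmul, mul_pow, const_pow_card]
        ring
  exact ⟨lin, step N lin⟩

theorem latPoly_succ (hι : Function.Injective ι) (N : ℕ) :
    latPoly ι (N + 1) = latPoly ι N ^ Fintype.card F -
      C ((latPoly ι N).eval (ι (X ^ N)) ^ (Fintype.card F - 1)) * latPoly ι N :=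
  (latPoly_linear_and_succ hι N).2

theorem derivative_latPoly_succ (hι : Function.Injective ι) (N : ℕ) :
    derivative (latPoly ι (N + 1)) =
      -C ((latPoly ι N).eval (ι (X ^ N)) ^ (Fintype.card F - 1)) * derivative (latPoly ι N) := by
  rw [latPoly_succ hι, derivative_sub, derivative_pow, card_cast_eq_zero ι, C_0,
    derivative_C_mul]
  simp

theorem latDeriv_succ (hι : Function.Injective ι) (N : ℕ) :
    latDeriv ι (N + 1) =
      -((latPoly ι N).eval (ι (X ^ N)) ^ (Fintype.card F - 1)) * latDeriv ι N := by
  simp only [latDeriv, derivative_latPoly_succ hι, eval_mul, eval_neg, eval_C]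

theorem derivative_latPoly (hι : Function.Injective ι) (N : ℕ) :
    derivative (latPoly ι N) = C (latDeriv ι N) := by
  induction N with
  | zero => simp [latDeriv, latPoly_zero]
  | succ N ih =>
    rw [derivative_latPoly_succ hι, latDeriv_succ hι, ih, C_mul, C_neg]

open Classical in
theorem latDeriv_eq_prod (N : ℕ) :
    latDeriv ι N = ∏ b ∈ (box F N).erase 0, (-ι b) := by
  have := Lagrange.eval_nodal_derivative_eval_node_eq (v := ι) (zero_mem_box (F := F) N)
  rw [map_zero] at this
  rw [latDeriv, latPoly, this, Lagrange.eval_nodal]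
  simp

theorem latDeriv_ne_zero (hι : Function.Injective ι) (N : ℕ) : latDeriv ι N ≠ 0 := by
  classical
  rw [latDeriv_eq_prod]
  refine Finset.prod_ne_zero_iff.2 fun b hb => neg_ne_zero.2 ?_
  rw [Ne, map_eq_zero_iff ι hι]
  exact Finset.ne_of_mem_erase hb

variable (ι) in
/-- The exponential polynomial `e_N(x) = x ∏ (1 - x / b)` of the finite lattice `A_{<N}`, the
product being over the nonzero `b ∈ A` of degree less than `N`. -/
def boxExp (N : ℕ) : K[X] := C (latDeriv ι N)⁻¹ * latPoly ι N

theorem boxExp_zero : boxExp ι 0 = X := by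
  simp [boxExp, latDeriv, latPoly_zero]

theorem eval_boxExp (N : ℕ) (x : K) :
    (boxExp ι N).eval x = (latDeriv ι N)⁻¹ * (latPoly ι N).eval x := by
  rw [boxExp, eval_mul, eval_C]

theorem boxExp_add (hι : Function.Injective ι) (N : ℕ) (x y : K) :
    (boxExp ι N).eval (x + y) = (boxExp ι N).eval x + (boxExp ι N).eval y := by
  simp only [eval_boxExp, (latPoly_linear_and_succ hι N).1.1, mul_add]

theorem eval_boxExp_eq_zero_iff (hι : Function.Injective ι) {N : ℕ} {x : K} :
    (boxExp ι N).eval x = 0 ↔ ∃ b ∈ box F N, x = ι b := by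
  rw [eval_boxExp, ← eval_latPoly_eq_zero_iff,
    mul_eq_zero_iff_left (inv_ne_zero (latDeriv_ne_zero hι N))]

theorem boxExp_sub_box (hι : Function.Injective ι) {N : ℕ} (x : K) {b : F[X]}
    (hb : b ∈ box F N) : (boxExp ι N).eval (x - ι b) = (boxExp ι N).eval x := by
  have h := boxExp_add hι N (x - ι b) (ι b)
  rw [sub_add_cancel, (eval_boxExp_eq_zero_iff hι).2 ⟨b, hb, rfl⟩, add_zero] at h
  exact h.symm

open Classical in
theorem eval_boxExp_eq_prod (hι : Function.Injective ι) (N : ℕ) (x : K) :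
    (boxExp ι N).eval x = x * ∏ b ∈ (box F N).erase 0, (1 - x / ι b) := by
  rw [eval_boxExp, latDeriv_eq_prod, eval_latPoly, ← Finset.mul_prod_erase _ _ (zero_mem_box N),
    map_zero, sub_zero, mul_left_comm, ← Finset.prod_inv_distrib, ← Finset.prod_mul_distrib]
  congr 1
  refine Finset.prod_congr rfl fun b hb => ?_
  have : ι b ≠ 0 := by
    rw [Ne, map_eq_zero_iff ι hι]; exact Finset.ne_of_mem_erase hb
  field_simp
  ring

variable (ι) in
/-- The constant `θ_N` in `e_{N+1} = e_N - θ_N e_N^q`. -/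
def boxTheta (N : ℕ) : K := ((boxExp ι N).eval (ι (X ^ N)) ^ (Fintype.card F - 1))⁻¹

theorem boxExp_succ (hι : Function.Injective ι) (N : ℕ) :
    boxExp ι (N + 1) = boxExp ι N - C (boxTheta ι N) * boxExp ι N ^ Fintype.card F := by
  have h1 := latDeriv_ne_zero hι N
  have h2 := eval_latPoly_X_pow_ne_zero hι N
  have hq : 1 < Fintype.card F := Fintype.one_lt_card
  have := Infinite.of_injective ι hι
  refine Polynomial.funext fun x => ?_
  simp only [eval_sub, eval_mul, eval_C, eval_pow, boxTheta, eval_boxExp, latDeriv_succ hι,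
    latPoly_succ hι]
  generalize (latPoly ι N).eval (ι (X ^ N)) = D at *
  generalize latDeriv ι N = w at *
  obtain ⟨m, hm⟩ : ∃ m, Fintype.card F = m + 1 := ⟨_, (Nat.sub_add_cancel hq.le).symm⟩
  rw [hm, Nat.add_sub_cancel]
  simp only [mul_pow, inv_pow]
  field_simp
  ring

variable (ι) in
/-- The constant `κ_N` in `e_{N+1}(T x) = T e_N(x) + κ_N e_N(x)^q`. -/
def boxKappa (N : ℕ) : K :=
  -ι X * ((boxExp ι N).eval (ι X)⁻¹ ^ (Fintype.card F - 1))⁻¹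

theorem eval_boxExp_inv_X_ne_zero (hι : Function.Injective ι) (N : ℕ) :
    (boxExp ι N).eval (ι X)⁻¹ ≠ 0 := by
  rw [Ne, eval_boxExp_eq_zero_iff hι]
  rintro ⟨b, -, h⟩
  have hX : ι X ≠ 0 := by rw [Ne, map_eq_zero_iff ι hι]; exact X_ne_zero
  have h1 : ι (X * b) = ι 1 := by rw [map_mul, ← h, mul_inv_cancel₀ hX, map_one]
  exact not_isUnit_X (IsUnit.of_mul_eq_one _ (hι h1))

theorem boxExp_comp (hι : Function.Injective ι) (N : ℕ) :
    (boxExp ι (N + 1)).comp (C (ι X) * X) =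
      C (ι X) * boxExp ι N + C (boxKappa ι N) * boxExp ι N ^ Fintype.card F := by
  have := Infinite.of_injective ι hι
  have hX : ι X ≠ 0 := by rw [Ne, map_eq_zero_iff ι hι]; exact X_ne_zero
  have h1 := latDeriv_ne_zero hι N
  have h1' := latDeriv_ne_zero hι (N + 1)
  have hq : 1 < Fintype.card F := Fintype.one_lt_card
  obtain ⟨⟨hadd, hsmul⟩, -⟩ := latPoly_linear_and_succ hι N
  set B : K := ι X ^ (Fintype.card F ^ (N + 1))
  set D : K := (latPoly ι N).eval (ι X)⁻¹ with hD
  have hB : B ≠ 0 := pow_ne_zero _ hX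
  have hD0 : D ≠ 0 := by
    have := eval_boxExp_inv_X_ne_zero hι N
    rw [eval_boxExp] at this
    exact right_ne_zero_of_mul this
  -- the monic version, from the decomposition `b = c + T b'`
  have key : (latPoly ι (N + 1)).comp (C (ι X) * X) =
      C B * (latPoly ι N ^ Fintype.card F - C (D ^ (Fintype.card F - 1)) * latPoly ι N) := by
    refine Polynomial.funext fun x => ?_
    simp only [eval_comp, eval_mul, eval_C, eval_X, eval_sub, eval_pow]
    rw [eval_latPoly, prod_box_succ_X_mul, ← prod_sub_const_mul ι]
    have hB' : B = ∏ c : F, ι X ^ (box F N).card := by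
      rw [Finset.prod_const, card_box, ← pow_mul, Finset.card_univ, ← pow_succ]
    rw [hB', ← Finset.prod_mul_distrib]
    refine Finset.prod_congr rfl fun c _ => ?_
    have h : (latPoly ι N).eval (x + ι (C (-c)) * (ι X)⁻¹) =
        (latPoly ι N).eval x - ι (C c) * D := by
      rw [hadd, hsmul, C_neg, map_neg]; ring
    rw [← h, eval_latPoly, ← Finset.prod_const, ← Finset.prod_mul_distrib]
    refine Finset.prod_congr rfl fun b _ => ?_
    rw [map_add, map_mul, C_neg, map_neg]
    field_simp
    ring
  -- comparing derivatives at `0` gives the normalization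
  have hw : latDeriv ι (N + 1) * ι X = -(B * D ^ (Fintype.card F - 1) * latDeriv ι N) := by
    have h := congrArg (fun P => (derivative P).eval 0) key
    simp only [derivative_comp, derivative_mul, derivative_C, derivative_X, derivative_sub,
      derivative_pow, card_cast_eq_zero ι, derivative_latPoly hι] at h
    simp at h
    linear_combination h
  have hw' : latDeriv ι (N + 1) = -(B * D ^ (Fintype.card F - 1) * latDeriv ι N) / ι X := by
    rw [eq_div_iff hX, hw]
  rw [boxExp, mul_comp, C_comp, key, hw']
  refine Polynomial.funext fun x => ?_
  simp only [eval_sub, eval_mul, eval_C, eval_pow, eval_add, boxKappa, eval_boxExp, ← hD]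
  obtain ⟨m, hm⟩ : ∃ m, Fintype.card F = m + 1 := ⟨_, (Nat.sub_add_cancel hq.le).symm⟩
  rw [hm, Nat.add_sub_cancel]
  simp only [mul_pow, inv_pow]
  field_simp
  ring

theorem eval_boxExp_succ_X_mul (hι : Function.Injective ι) (N : ℕ) (x : K) :
    (boxExp ι (N + 1)).eval (ι X * x) =
      ι X * (boxExp ι N).eval x + boxKappa ι N * (boxExp ι N).eval x ^ Fintype.card F := by
  have := congrArg (eval x) (boxExp_comp hι N)
  simpa only [eval_comp, eval_mul, eval_C, eval_X, eval_add, eval_pow] using this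

end LatticePolynomial

/-! ### Coefficients of the exponential polynomials -/

section Coefficients

variable {F : Type*} [Field F] [Fintype F] {K : Type*} [Field K] {ι : F[X] →+* K}

variable (ι) in
/-- The coefficient of `x ^ (q ^ i)` in the exponential polynomial of `A_{<N}`. -/
def boxCoeff (N i : ℕ) : K := (boxExp ι N).coeff (Fintype.card F ^ i)

theorem boxCoeff_zero (i : ℕ) : boxCoeff ι 0 i = if i = 0 then 1 else 0 := by
  have hq : 1 < Fintype.card F := Fintype.one_lt_card
  rw [boxCoeff, boxExp_zero, coeff_X]
  rcases i with _ | i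
  · simp
  · simp [(one_lt_pow₀ hq (Nat.succ_ne_zero i)).ne]

theorem boxCoeff_succ_zero (hι : Function.Injective ι) (N : ℕ) :
    boxCoeff ι (N + 1) 0 = boxCoeff ι N 0 := by
  simp [boxCoeff, boxExp_succ hι, coeff_C_mul, coeff_pow_card_one ι]

theorem boxCoeff_succ_succ (hι : Function.Injective ι) (N i : ℕ) :
    boxCoeff ι (N + 1) (i + 1) =
      boxCoeff ι N (i + 1) - boxTheta ι N * boxCoeff ι N i ^ Fintype.card F := by
  simp only [boxCoeff, boxExp_succ hι, coeff_sub, coeff_C_mul]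
  rw [pow_succ' (Fintype.card F) i, coeff_pow_card_mul ι]

theorem boxCoeff_zero_right (hι : Function.Injective ι) (N : ℕ) : boxCoeff ι N 0 = 1 := by
  induction N with
  | zero => simp [boxCoeff_zero]
  | succ N ih => rw [boxCoeff_succ_zero hι, ih]

theorem boxCoeff_eq_zero (hι : Function.Injective ι) {N i : ℕ} (h : N < i) :
    boxCoeff ι N i = 0 := by
  have hq : 1 < Fintype.card F := Fintype.one_lt_card
  induction N generalizing i with
  | zero => rw [boxCoeff_zero, if_neg h.ne']
  | succ N ih =>
    obtain ⟨i, rfl⟩ : ∃ j, i = j + 1 := ⟨i - 1, by omega⟩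
    rw [boxCoeff_succ_succ hι, ih (by omega), ih (by omega), zero_pow (by omega)]
    simp

/-- The relation between `e_{N+1}(T x)` and `e_N(x)`, in coefficients. -/
theorem boxCoeff_succ_mul_X_pow (hι : Function.Injective ι) (N i : ℕ) :
    boxCoeff ι (N + 1) (i + 1) * ι X ^ Fintype.card F ^ (i + 1) =
      ι X * boxCoeff ι N (i + 1) + boxKappa ι N * boxCoeff ι N i ^ Fintype.card F := by
  have h := congrArg (fun P => P.coeff (Fintype.card F ^ (i + 1))) (boxExp_comp hι N)
  simp only [comp_C_mul_X_coeff, coeff_add, coeff_C_mul] at h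
  rw [boxCoeff, h, boxCoeff, boxCoeff, pow_succ' (Fintype.card F) i, coeff_pow_card_mul ι]

theorem eval_boxExp_eq_sum (hι : Function.Injective ι) {N M : ℕ} (hNM : N < M) (x : K) :
    (boxExp ι N).eval x = ∑ i ∈ Finset.range M, boxCoeff ι N i * x ^ Fintype.card F ^ i := by
  induction N generalizing M with
  | zero =>
    rw [boxExp_zero, eval_X, Finset.sum_eq_single 0]
    · simp [boxCoeff_zero]
    · intro i _ hi; simp [boxCoeff_zero, hi]
    · intro h; exact absurd (Finset.mem_range.2 hNM) h
  | succ N ih =>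
    obtain ⟨M, rfl⟩ : ∃ j, M = j + 1 := ⟨M - 1, by omega⟩
    rw [boxExp_succ hι, eval_sub, eval_mul, eval_C, eval_pow]
    nth_rewrite 1 [ih (M := M + 1) (by omega)]
    rw [ih (M := M) (by omega), sum_pow_card ι, Finset.sum_range_succ', Finset.sum_range_succ',
      Finset.mul_sum, boxCoeff_succ_zero hι]
    simp only [boxCoeff_succ_succ hι]
    rw [add_sub_right_comm, ← Finset.sum_sub_distrib]
    congr 1
    refine Finset.sum_congr rfl fun i _ => ?_
    rw [mul_pow, ← pow_mul, ← pow_succ]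
    ring

end Coefficients

/-! ### The recursion of Goss for the lattices `A_{<N}` -/

section Goss

variable {F : Type*} [Field F] [Fintype F] {K : Type*} [Field K] {ι : F[X] →+* K}

variable (ι) in
/-- The sum `∑ (x - b)^(-n)` over the `b ∈ A` of degree less than `N`; the term with `b = x`, if
there is one, is omitted, as `0⁻¹ = 0`. -/
def boxSum (N n : ℕ) (x : K) : K := ∑ b ∈ box F N, ((x - ι b) ^ n)⁻¹

/-- Lagrange interpolation: a polynomial of degree less than `q ^ N` is determined by its values on
`A_{<N}`. The nodal weights are all equal, because the derivative of `E_N` is constant. -/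
theorem sum_box_div (hι : Function.Injective ι) {N : ℕ} {x : K} (hx : ∀ b ∈ box F N, x ≠ ι b)
    (P : K[X]) (hP : P.degree < (Fintype.card F ^ N : ℕ)) :
    (boxExp ι N).eval x * ∑ b ∈ box F N, P.eval (ι b) * (x - ι b)⁻¹ = P.eval x := by
  classical
  rw [← card_box] at hP
  have h := Lagrange.eval_interpolate_not_at_node (s := box F N) (v := ι)
    (fun b => P.eval (ι b)) hx
  rw [← Lagrange.eq_interpolate hι.injOn hP] at h
  rw [h, eval_boxExp, ← latPoly, mul_comm (latDeriv ι N)⁻¹, mul_assoc, Finset.mul_sum]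
  congr 1
  refine Finset.sum_congr rfl fun b hb => ?_
  rw [Lagrange.nodalWeight_eq_eval_derivative_nodal hb, ← latPoly, derivative_latPoly hι, eval_C]
  ring

/-- Interpolation of the constant polynomial `1`. -/
theorem boxSum_one (hι : Function.Injective ι) {N : ℕ} {x : K} (hx : ∀ b ∈ box F N, x ≠ ι b) :
    boxSum ι N 1 x = ((boxExp ι N).eval x)⁻¹ := by
  have h := sum_box_div hι hx 1 (by
    rw [degree_one]; exact_mod_cast pow_pos Fintype.card_pos N)
  simp only [eval_one, one_mul] at h
  rw [boxSum, ← mul_eq_one_iff_eq_inv₀, mul_comm]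
  · simpa using h
  · intro h0; rw [h0, zero_mul] at h; exact zero_ne_one h

/-- Interpolation of the polynomial `(x - X)^(m + 1)`, which vanishes at `x`. -/
theorem sum_box_sub_pow (hι : Function.Injective ι) {N m : ℕ} {x : K}
    (hx : ∀ b ∈ box F N, x ≠ ι b) (hm : m + 1 < Fintype.card F ^ N) :
    ∑ b ∈ box F N, (x - ι b) ^ m = 0 := by
  have h := sum_box_div hι hx ((C x - X) ^ (m + 1)) (by
    refine (degree_pow_le_of_le (m + 1) (a := 1) ?_).trans_lt (by
      rw [mul_one]; exact_mod_cast hm)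
    exact (degree_sub_le _ _).trans (max_le (degree_C_le.trans (by norm_num)) degree_X_le))
  have h2 : ∀ b ∈ box F N, ((C x - X) ^ (m + 1)).eval (ι b) * (x - ι b)⁻¹ = (x - ι b) ^ m := by
    intro b hb
    have := sub_ne_zero.2 (hx b hb)
    simp only [eval_pow, eval_sub, eval_C, eval_X]
    rw [pow_succ, mul_inv_cancel_right₀ this]
  rw [Finset.sum_congr rfl h2] at h
  simp only [eval_pow, eval_sub, eval_C, eval_X, sub_self, ne_eq, Nat.succ_ne_zero,
    not_false_eq_true, zero_pow] at h
  refine (mul_eq_zero.1 h).resolve_left fun h0 => ?_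
  obtain ⟨b, hb, h⟩ := (eval_boxExp_eq_zero_iff hι).1 h0
  exact hx b hb h

/-- The recursion that defines the Goss polynomials, for the finite lattice `A_{<N}`. -/
theorem boxSum_recursion (hι : Function.Injective ι) {N n : ℕ} {x : K}
    (hx : ∀ b ∈ box F N, x ≠ ι b) (hn : 2 ≤ n) :
    boxSum ι N n x = ((boxExp ι N).eval x)⁻¹ * ∑ i ∈ Finset.range n,
      if Fintype.card F ^ i < n then boxCoeff ι N i * boxSum ι N (n - Fintype.card F ^ i) x
      else 0 := by
  have hq : 1 < Fintype.card F := Fintype.one_lt_card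
  have he : (boxExp ι N).eval x ≠ 0 := fun h0 => by
    obtain ⟨b, hb, h⟩ := (eval_boxExp_eq_zero_iff hι).1 h0
    exact hx b hb h
  rw [← mul_right_inj' he, mul_inv_cancel_left₀ he]
  set M := max (N + 1) n
  have h1 : (boxExp ι N).eval x * boxSum ι N n x = ∑ b ∈ box F N, ∑ i ∈ Finset.range M,
      boxCoeff ι N i * ((x - ι b) ^ Fintype.card F ^ i * ((x - ι b) ^ n)⁻¹) := by
    rw [boxSum, Finset.mul_sum]
    refine Finset.sum_congr rfl fun b hb => ?_
    rw [← boxExp_sub_box hι x hb, eval_boxExp_eq_sum hι (M := M) (lt_max_of_lt_left N.lt_succ_self),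
      Finset.sum_mul]
    exact Finset.sum_congr rfl fun i _ => by ring
  have h2 : ∀ i, n ≤ Fintype.card F ^ i → ∑ b ∈ box F N,
      boxCoeff ι N i * ((x - ι b) ^ Fintype.card F ^ i * ((x - ι b) ^ n)⁻¹) = 0 := by
    intro i hi
    rcases lt_or_ge N i with hN | hN
    · simp [boxCoeff_eq_zero hι hN]
    rw [← Finset.mul_sum]
    refine mul_eq_zero_of_right _ ?_
    rw [← sum_box_sub_pow hι hx (m := Fintype.card F ^ i - n) (by
      have := Nat.pow_le_pow_right hq.le hN
      omega)]
    refine Finset.sum_congr rfl fun b hb => ?_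
    rw [pow_sub₀ _ (sub_ne_zero.2 (hx b hb)) hi]
  rw [h1, Finset.sum_comm]
  symm
  refine Finset.sum_subset_zero_on_sdiff (Finset.range_subset_range.2 (le_max_right _ _)) ?_ ?_
  · intro i hi
    rw [Finset.mem_sdiff, Finset.mem_range, Finset.mem_range, not_lt] at hi
    exact h2 i (hi.2.trans (Nat.lt_pow_self hq).le)
  · intro i _
    split_ifs with h
    · rw [boxSum, Finset.mul_sum]
      refine Finset.sum_congr rfl fun b hb => ?_
      have hb0 := sub_ne_zero.2 (hx b hb)
      rw [pow_sub₀ _ hb0 h.le, mul_inv, inv_inv]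
      ring
    · exact (h2 i (not_lt.1 h)).symm

end Goss

theorem norm_sub_le_max {E : Type*} [SeminormedAddCommGroup E] [IsUltrametricDist E] (x y : E) :
    ‖x - y‖ ≤ max ‖x‖ ‖y‖ := by
  rw [sub_eq_add_neg, ← norm_neg y]
  exact IsUltrametricDist.norm_add_le_max x (-y)

/-! ### Estimates and limits for the exponential polynomials -/

section Estimates

variable {F : Type*} [Field F] [Fintype F] {K : Type*} [NormedField K]

/-- The absolute value of `K` restricts to `q ^ deg` on the nonzero elements of `A`. -/
def IsDegreeNorm (ι : F[X] →+* K) : Prop :=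
  ∀ a : F[X], a ≠ 0 → ‖ι a‖ = (Fintype.card F : ℝ) ^ a.natDegree

variable {ι : F[X] →+* K}

variable (F) in
theorem one_lt_card_real : (1 : ℝ) < Fintype.card F := by exact_mod_cast Fintype.one_lt_card

variable (F) in
theorem card_real_pos : (0 : ℝ) < Fintype.card F := zero_lt_one.trans (one_lt_card_real F)

theorem IsDegreeNorm.one_le (h : IsDegreeNorm ι) {a : F[X]} (ha : a ≠ 0) : 1 ≤ ‖ι a‖ := by
  rw [h a ha]; exact one_le_pow₀ (one_lt_card_real F).le

theorem IsDegreeNorm.injective (h : IsDegreeNorm ι) : Function.Injective ι := by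
  rw [injective_iff_map_eq_zero]
  intro a ha
  by_contra h0
  have := h.one_le h0
  rw [ha, norm_zero] at this
  linarith

theorem IsDegreeNorm.norm_const (h : IsDegreeNorm ι) {c : F} (hc : c ≠ 0) : ‖ι (C c)‖ = 1 := by
  rw [h _ (C_ne_zero.2 hc), natDegree_C, pow_zero]

theorem IsDegreeNorm.norm_X (h : IsDegreeNorm ι) : ‖ι X‖ = Fintype.card F := by
  rw [h X X_ne_zero, natDegree_X, pow_one]

theorem IsDegreeNorm.X_ne_zero (h : IsDegreeNorm ι) : ι X ≠ 0 := by
  rw [← norm_ne_zero_iff, h.norm_X]; exact (card_real_pos F).ne'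

theorem IsDegreeNorm.norm_le_of_mem_box (h : IsDegreeNorm ι) {N : ℕ} {b : F[X]}
    (hb : b ∈ box F N) : ‖ι b‖ ≤ (Fintype.card F : ℝ) ^ N := by
  by_cases h0 : b = 0
  · rw [h0, map_zero, norm_zero]; exact pow_nonneg (card_real_pos F).le _
  · rw [h b h0]
    exact pow_le_pow_right₀ (one_lt_card_real F).le ((mem_box_iff_natDegree h0).1 hb).le

theorem IsDegreeNorm.norm_X_pow_sub (h : IsDegreeNorm ι) {N : ℕ} {b : F[X]} (hb : b ∈ box F N) :
    ‖ι (X ^ N) - ι b‖ = (Fintype.card F : ℝ) ^ N := by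
  rw [mem_box] at hb
  have h1 : (X ^ N - b).degree = (N : WithBot ℕ) := by
    rw [degree_sub_eq_left_of_degree_lt (by rwa [degree_X_pow]), degree_X_pow]
  have h2 : X ^ N - b ≠ 0 := fun h0 => by simp [h0] at h1
  rw [← map_sub, h _ h2, natDegree_eq_of_degree_eq_some h1]

theorem norm_inv_X_lt_one (h : IsDegreeNorm ι) : ‖(ι X)⁻¹‖ < 1 := by
  rw [norm_inv, h.norm_X]
  exact inv_lt_one_of_one_lt₀ (one_lt_card_real F)

theorem X_pow_sub_X_ne_zero (h : IsDegreeNorm ι) (i : ℕ) :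
    ι X ^ Fintype.card F ^ (i + 1) - ι X ≠ 0 := by
  have hq : 1 < Fintype.card F := Fintype.one_lt_card
  intro h0
  have h1 := congrArg norm (sub_eq_zero.1 h0)
  rw [norm_pow, h.norm_X] at h1
  have h2 := pow_lt_pow_right₀ (one_lt_card_real F) (one_lt_pow₀ hq (Nat.succ_ne_zero i))
  rw [pow_one, h1] at h2
  exact lt_irrefl _ h2

variable [IsUltrametricDist K]

/-- A lower bound for `e_N(x)` when `0` is an element of `A_{<N}` closest to `x`; then every factor
`1 - x / b` has absolute value at least `max 1 |x / b|`. -/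
theorem le_norm_boxExp_of_reduced (h : IsDegreeNorm ι) {N J : ℕ} (hJ : J ≤ N) {x : K}
    (hx : ∀ b ∈ box F N, ‖x‖ ≤ ‖x - ι b‖) :
    ‖x‖ * (‖x‖ / (Fintype.card F : ℝ) ^ J) ^ (Fintype.card F ^ J - 1) ≤
      ‖(boxExp ι N).eval x‖ := by
  classical
  have hq := card_real_pos F
  have hfac : ∀ b ∈ (box F N).erase 0, 1 ≤ ‖1 - x / ι b‖ ∧ ‖x‖ / ‖ι b‖ ≤ ‖1 - x / ι b‖ := by
    intro b hb
    rw [Finset.mem_erase] at hb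
    have hb0 : 0 < ‖ι b‖ := zero_lt_one.trans_le (h.one_le hb.1)
    have hb1 : ι b ≠ 0 := norm_pos_iff.1 hb0
    have h1 : 1 - x / ι b = -(x - ι b) / ι b := by field_simp; ring
    have h2 : ‖ι b‖ ≤ ‖x - ι b‖ := by
      have h3 : ι b = x - (x - ι b) := by ring
      calc ‖ι b‖ = ‖x - (x - ι b)‖ := by rw [← h3]
        _ ≤ max ‖x‖ ‖x - ι b‖ := norm_sub_le_max _ _
        _ = ‖x - ι b‖ := max_eq_right (hx b hb.2)
    rw [h1, norm_div, norm_neg, le_div_iff₀ hb0, one_mul, div_le_div_iff_of_pos_right hb0]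
    exact ⟨h2, hx b hb.2⟩
  rw [eval_boxExp_eq_prod h.injective, norm_mul, norm_prod]
  refine mul_le_mul_of_nonneg_left ?_ (norm_nonneg _)
  have hsub : (box F J).erase 0 ⊆ (box F N).erase 0 := Finset.erase_subset_erase _ (box_mono hJ)
  rw [← Finset.prod_sdiff hsub]
  have hcard : ((box F J).erase 0).card = Fintype.card F ^ J - 1 := by
    rw [Finset.card_erase_of_mem (zero_mem_box J), card_box]
  have h3 : (‖x‖ / (Fintype.card F : ℝ) ^ J) ^ (Fintype.card F ^ J - 1) ≤
      ∏ b ∈ (box F J).erase 0, ‖1 - x / ι b‖ := by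
    rw [← hcard, ← Finset.prod_const]
    refine Finset.prod_le_prod (fun b _ => by positivity) fun b hb => ?_
    refine le_trans ?_ (hfac b (hsub hb)).2
    have hb' := Finset.mem_erase.1 hb
    exact div_le_div_of_nonneg_left (norm_nonneg _)
      (zero_lt_one.trans_le (h.one_le hb'.1)) (h.norm_le_of_mem_box hb'.2)
  have h4 : (1 : ℝ) ≤ ∏ b ∈ (box F N).erase 0 \ (box F J).erase 0, ‖1 - x / ι b‖ := by
    rw [← Finset.prod_const_one (s := (box F N).erase 0 \ (box F J).erase 0)]
    exact Finset.prod_le_prod (fun _ _ => zero_le_one) fun b hb =>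
      (hfac b (Finset.mem_sdiff.1 hb).1).1
  refine h3.trans ?_
  exact le_mul_of_one_le_left (Finset.prod_nonneg fun _ _ => norm_nonneg _) h4

/-- A lower bound for `e_N(x)` in terms of the distance `δ` of `x` to the lattice. Since `J` is
arbitrary, `e_N(x)` grows faster than every power of `δ`, uniformly in `N`. -/
theorem le_norm_boxExp (h : IsDegreeNorm ι) {N J : ℕ} (hJ : J ≤ N) {x : K} {δ : ℝ} (hδ : 0 ≤ δ)
    (hx : ∀ b ∈ box F N, δ ≤ ‖x - ι b‖) :
    δ * (δ / (Fintype.card F : ℝ) ^ J) ^ (Fintype.card F ^ J - 1) ≤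
      ‖(boxExp ι N).eval x‖ := by
  have hq := card_real_pos F
  obtain ⟨b₀, hb₀, hmin⟩ := Finset.exists_min_image (box F N) (fun b => ‖x - ι b‖)
    ⟨0, zero_mem_box N⟩
  rw [← boxExp_sub_box h.injective x hb₀]
  refine le_trans ?_ (le_norm_boxExp_of_reduced h hJ (x := x - ι b₀) fun b hb => ?_)
  · have := hx b₀ hb₀
    gcongr
  · have := hmin (b₀ + b) (add_mem_box hb₀ hb)
    rwa [map_add, ← sub_sub] at this

theorem le_norm_boxExp' (h : IsDegreeNorm ι) {N : ℕ} {x : K} {δ : ℝ} (hδ : 0 ≤ δ)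
    (hx : ∀ b ∈ box F N, δ ≤ ‖x - ι b‖) : δ ≤ ‖(boxExp ι N).eval x‖ := by
  simpa using le_norm_boxExp h (Nat.zero_le N) hδ hx

theorem norm_le_norm_boxExp (h : IsDegreeNorm ι) {N : ℕ} {x : K} (hx : ‖x‖ < 1) :
    ‖x‖ ≤ ‖(boxExp ι N).eval x‖ := by
  refine le_norm_boxExp' h (norm_nonneg _) fun b _ => ?_
  by_cases h0 : b = 0
  · simp [h0]
  have h1 : ‖x‖ < ‖ι b‖ := hx.trans_le (h.one_le h0)
  rw [sub_eq_add_neg,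
    IsUltrametricDist.norm_add_eq_max_of_norm_ne_norm (by rw [norm_neg]; exact h1.ne)]
  exact le_max_left _ _

theorem norm_boxTheta_le (h : IsDegreeNorm ι) (N : ℕ) :
    ‖boxTheta ι N‖ ≤ ((Fintype.card F : ℝ)⁻¹) ^ N := by
  have hq := one_lt_card_real F
  have h1 : (Fintype.card F : ℝ) ^ N ≤ ‖(boxExp ι N).eval (ι (X ^ N))‖ :=
    le_norm_boxExp' h (by positivity) fun b hb => (h.norm_X_pow_sub hb).ge
  have h2 : (1 : ℝ) ≤ (Fintype.card F : ℝ) ^ N := one_le_pow₀ hq.le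
  rw [boxTheta, norm_inv, norm_pow, inv_pow]
  refine inv_anti₀ (by positivity) (h1.trans ?_)
  exact le_self_pow₀ (h2.trans h1) (Nat.sub_ne_zero_of_lt Fintype.one_lt_card)

theorem norm_boxCoeff_le (h : IsDegreeNorm ι) (N i : ℕ) : ‖boxCoeff ι N i‖ ≤ 1 := by
  have hq := one_lt_card_real F
  induction N generalizing i with
  | zero => rw [boxCoeff_zero]; split_ifs <;> simp
  | succ N ih =>
    rcases i with _ | i
    · rw [boxCoeff_zero_right h.injective, norm_one]
    · rw [boxCoeff_succ_succ h.injective]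
      refine (norm_sub_le_max _ _).trans (max_le (ih _) ?_)
      rw [norm_mul, norm_pow]
      refine mul_le_one₀ ((norm_boxTheta_le h N).trans ?_) (by positivity)
        (pow_le_one₀ (norm_nonneg _) (ih _))
      exact pow_le_one₀ (by positivity) (inv_le_one_of_one_le₀ hq.le)

/-- A point outside `A` has a positive distance to `A`. -/
theorem exists_le_norm_sub (h : IsDegreeNorm ι) {x : K} (hx : x ∉ Set.range ι) :
    ∃ δ : ℝ, 0 < δ ∧ ∀ a, δ ≤ ‖x - ι a‖ := by
  by_cases h1 : ∃ a, ‖x - ι a‖ < 1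
  · obtain ⟨a, ha⟩ := h1
    refine ⟨‖x - ι a‖, norm_pos_iff.2 (sub_ne_zero.2 fun h0 => hx ⟨a, h0.symm⟩), fun b => ?_⟩
    by_cases hab : b = a
    · rw [hab]
    · by_contra! hb
      have h2 : ‖ι (b - a)‖ < 1 := by
        have h3 : ι (b - a) = (x - ι a) - (x - ι b) := by rw [map_sub]; ring
        rw [h3]
        exact (norm_sub_le_max _ _).trans_lt (max_lt ha (hb.trans ha))
      exact absurd (h.one_le (sub_ne_zero.2 hab)) (not_le.2 h2)
  · push Not at h1
    exact ⟨1, one_pos, h1⟩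

variable [CompleteSpace K]

/-- The coefficients converge, as their increments are bounded by `|θ_N| ≤ q^(-N)`. -/
theorem exists_tendsto_boxCoeff (h : IsDegreeNorm ι) (i : ℕ) :
    ∃ A : K, Tendsto (fun N => boxCoeff ι N i) atTop (𝓝 A) := by
  have hq := one_lt_card_real F
  refine cauchySeq_tendsto_of_complete
    (cauchySeq_of_le_geometric (Fintype.card F : ℝ)⁻¹ 1 (inv_lt_one_of_one_lt₀ hq) fun N => ?_)
  rw [one_mul, dist_eq_norm']
  rcases i with _ | i
  · rw [boxCoeff_succ_zero h.injective, sub_self, norm_zero]; positivity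
  · rw [boxCoeff_succ_succ h.injective, sub_sub_cancel_left, norm_neg, norm_mul, norm_pow]
    refine (mul_le_of_le_one_right (norm_nonneg _) ?_).trans (norm_boxTheta_le h N)
    exact pow_le_one₀ (norm_nonneg _) (norm_boxCoeff_le h N i)

/-- The limit, as `N → ∞`, of the coefficient of `x ^ (q ^ i)` in `e_N`. -/
def limCoeff (h : IsDegreeNorm ι) (i : ℕ) : K := (exists_tendsto_boxCoeff h i).choose

theorem tendsto_boxCoeff (h : IsDegreeNorm ι) (i : ℕ) :
    Tendsto (fun N => boxCoeff ι N i) atTop (𝓝 (limCoeff h i)) :=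
  (exists_tendsto_boxCoeff h i).choose_spec

theorem limCoeff_zero (h : IsDegreeNorm ι) : limCoeff h 0 = 1 := by
  refine tendsto_nhds_unique (tendsto_boxCoeff h 0) ?_
  simp only [boxCoeff_zero_right h.injective]
  exact tendsto_const_nhds

theorem tendsto_boxExp_of_norm_lt_one (h : IsDegreeNorm ι) {x : K} (hx : ‖x‖ < 1) :
    Tendsto (fun N => (boxExp ι N).eval x) atTop
      (𝓝 (∑' i, limCoeff h i * x ^ Fintype.card F ^ i)) := by
  have hq : 1 < Fintype.card F := Fintype.one_lt_card
  have h1 : ∀ N, (boxExp ι N).eval x = ∑' i, boxCoeff ι N i * x ^ Fintype.card F ^ i := by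
    intro N
    rw [eval_boxExp_eq_sum h.injective (Nat.lt_succ_self N), tsum_eq_sum]
    intro i hi
    rw [boxCoeff_eq_zero h.injective (by simpa using hi), zero_mul]
  simp only [h1]
  refine tendsto_tsum_of_dominated_convergence (bound := fun i => ‖x‖ ^ i)
    (summable_geometric_of_lt_one (norm_nonneg _) hx)
    (fun i => (tendsto_boxCoeff h i).mul_const _) (Eventually.of_forall fun N i => ?_)
  rw [norm_mul, norm_pow]
  refine (mul_le_of_le_one_left (by positivity) (norm_boxCoeff_le h N i)).trans ?_
  exact pow_le_pow_of_le_one (norm_nonneg _) hx.le (Nat.lt_pow_self hq).le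

/-- The constant `κ`, with `κ = ϖ ^ (q - 1)` for every period `ϖ` of the Carlitz module, in the
relation `e(T x) = T e(x) + κ e(x)^q` satisfied by `e = lim e_N`. -/
theorem exists_tendsto_boxKappa (h : IsDegreeNorm ι)
    (hroot : ∃ s : K, s ^ (Fintype.card F - 1) = -ι X) :
    ∃ c : K, c ≠ 0 ∧ Tendsto (boxKappa ι) atTop (𝓝 (c ^ (Fintype.card F - 1))) := by
  obtain ⟨s, hs⟩ := hroot
  have h1 := tendsto_boxExp_of_norm_lt_one h (norm_inv_X_lt_one h)
  set y := ∑' i, limCoeff h i * (ι X)⁻¹ ^ Fintype.card F ^ i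
  have hy : y ≠ 0 := by
    have h2 : ‖(ι X)⁻¹‖ ≤ ‖y‖ := ge_of_tendsto h1.norm
      (Eventually.of_forall fun N => norm_le_norm_boxExp h (norm_inv_X_lt_one h))
    have h3 : 0 < ‖(ι X)⁻¹‖ := norm_pos_iff.2 (inv_ne_zero h.X_ne_zero)
    exact norm_pos_iff.1 (h3.trans_le h2)
  refine ⟨s / y, div_ne_zero (fun h0 => ?_) hy, ?_⟩
  · rw [h0, zero_pow (Nat.sub_ne_zero_of_lt Fintype.one_lt_card)] at hs
    exact h.X_ne_zero (neg_eq_zero.1 hs.symm)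
  · rw [div_pow, hs, div_eq_mul_inv]
    exact ((h1.pow _).inv₀ (pow_ne_zero _ hy)).const_mul _

end Estimates

/-! ### The Carlitz exponential -/

section CarlitzExponential

variable {F : Type*} [Field F] [Fintype F]

theorem map_carlitzD_succ {K : Type*} [Field K] (ι : F[X] →+* K) (i : ℕ) :
    ι (carlitzD F (i + 1)) =
      (ι X ^ Fintype.card F ^ (i + 1) - ι X) * ι (carlitzD F i) ^ Fintype.card F := by
  simp only [carlitzD, map_prod, map_sub, map_pow]
  rw [Finset.prod_range_succ', mul_comm, pow_zero, pow_one, ← Finset.prod_pow]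
  congr 1
  refine Finset.prod_congr rfl fun j _ => ?_
  rw [sub_pow_card ι, ← pow_mul, ← pow_mul, ← pow_succ, ← pow_succ]

variable {K : Type*} [NormedField K] {ι : F[X] →+* K}

variable (ι) in
/-- The Carlitz exponential over an extension of `A`. -/
def expOf (z : K) : K := ∑' i : ℕ, (ι (carlitzD F i))⁻¹ * z ^ Fintype.card F ^ i

theorem norm_carlitzD (h : IsDegreeNorm ι) (i : ℕ) :
    ‖ι (carlitzD F i)‖ = ((Fintype.card F : ℝ) ^ i) ^ Fintype.card F ^ i := by
  induction i with
  | zero => simp [carlitzD]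
  | succ i ih =>
    have h1 : ‖ι X ^ Fintype.card F ^ (i + 1) - ι X‖ =
        (Fintype.card F : ℝ) ^ Fintype.card F ^ (i + 1) := by
      have h2 := h.norm_X_pow_sub (N := Fintype.card F ^ (i + 1)) (b := X) (by
        rw [mem_box, degree_X]
        exact_mod_cast one_lt_pow₀ Fintype.one_lt_card (Nat.succ_ne_zero i))
      rwa [map_pow] at h2
    rw [map_carlitzD_succ, norm_mul, norm_pow, ih, h1, ← pow_mul _ _ (Fintype.card F), ← pow_succ,
      ← mul_pow, ← pow_succ']

theorem carlitzD_ne_zero (h : IsDegreeNorm ι) (i : ℕ) : ι (carlitzD F i) ≠ 0 := by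
  rw [← norm_ne_zero_iff, norm_carlitzD h]
  exact pow_ne_zero _ (pow_ne_zero _ (card_real_pos F).ne')

theorem expOf_const_mul (c : F) (x : K) : expOf ι (ι (C c) * x) = ι (C c) * expOf ι x := by
  have h1 : ∀ i, ι (C c) ^ Fintype.card F ^ i = ι (C c) := fun i => by
    rw [← map_pow, ← C_pow, FiniteField.pow_card_pow]
  rw [expOf, expOf, ← tsum_mul_left]
  congr 1
  funext i
  rw [mul_pow, h1]
  ring

theorem expOf_zero : expOf ι 0 = 0 := by
  rw [expOf]
  have hq : Fintype.card F ≠ 0 := Fintype.card_ne_zero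
  simp [zero_pow (pow_ne_zero _ hq)]

variable [CompleteSpace K]

theorem summable_expOf (h : IsDegreeNorm ι) (z : K) :
    Summable fun i : ℕ => (ι (carlitzD F i))⁻¹ * z ^ Fintype.card F ^ i := by
  have hq := one_lt_card_real F
  have h1 : ∀ᶠ i : ℕ in atTop, 2 * ‖z‖ ≤ (Fintype.card F : ℝ) ^ i :=
    (tendsto_pow_atTop_atTop_of_one_lt hq).eventually_ge_atTop _
  refine Summable.of_norm_bounded_eventually_nat (g := fun i => (1 / 2 : ℝ) ^ i)
    summable_geometric_two ?_
  filter_upwards [h1] with i hi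
  have hqi : (0 : ℝ) < (Fintype.card F : ℝ) ^ i := by positivity
  rw [norm_mul, norm_inv, norm_carlitzD h, norm_pow, ← inv_pow, ← mul_pow]
  refine (pow_le_pow_left₀ (by positivity) (?_ : _ ≤ (1 / 2 : ℝ)) _).trans
    (pow_le_pow_of_le_one (by norm_num) (by norm_num) (Nat.lt_pow_self Fintype.one_lt_card).le)
  rw [inv_mul_le_iff₀ hqi]
  linarith

theorem expOf_add (h : IsDegreeNorm ι) (x y : K) : expOf ι (x + y) = expOf ι x + expOf ι y := by
  rw [expOf, expOf, expOf, ← (summable_expOf h x).tsum_add (summable_expOf h y)]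
  simp only [add_pow_card_pow ι, mul_add]

/-- The functional equation `e(T z) = T e(z) + e(z)^q`. -/
theorem expOf_X_mul (h : IsDegreeNorm ι) (z : K) :
    expOf ι (ι X * z) = ι X * expOf ι z + expOf ι z ^ Fintype.card F := by
  have hs := summable_expOf h z
  let _ := (ι.comp C).toAlgebra
  have h1 : HasSum (fun i => ((ι (carlitzD F i))⁻¹ * z ^ Fintype.card F ^ i) ^ Fintype.card F)
      (expOf ι z ^ Fintype.card F) :=
    hs.hasSum.map (FiniteField.frobeniusAlgHom F K) (continuous_pow _)
  have h2 := summable_expOf h (ι X * z)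
  have h0 : expOf ι z = ∑' i : ℕ, (ι (carlitzD F i))⁻¹ * z ^ Fintype.card F ^ i := rfl
  rw [expOf, h2.tsum_eq_zero_add, ← h1.tsum_eq, h0, hs.tsum_eq_zero_add, mul_add, ← tsum_mul_left,
    add_assoc,
    ← (((summable_nat_add_iff 1).2 hs).mul_left _).tsum_add h1.summable]
  congr 1
  · simp [carlitzD]
  · congr 1
    funext i
    have h3 := carlitzD_ne_zero h i
    have h4 := X_pow_sub_X_ne_zero h i
    rw [map_carlitzD_succ, mul_pow, mul_pow, inv_pow, ← pow_mul, ← pow_succ]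
    field_simp
    ring

end CarlitzExponential

/-! ### Identification of the limit of the exponential polynomials -/

section Period

variable {F : Type*} [Field F] [Fintype F] {K : Type*} [NormedField K] [IsUltrametricDist K]
  [CompleteSpace K] {ι : F[X] →+* K}

/-- If `κ = c ^ (q - 1)`, the limit of the `e_N` has the coefficients of `c⁻¹ e(c x)`, where `e` is
the Carlitz exponential: the relation between `e_{N+1}(T x)` and `e_N(x)` becomes the recursion
for `1 / D_i`. -/
theorem limCoeff_eq (h : IsDegreeNorm ι) {c : K}
    (hc : Tendsto (boxKappa ι) atTop (𝓝 (c ^ (Fintype.card F - 1)))) (i : ℕ) :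
    limCoeff h i = c ^ (Fintype.card F ^ i - 1) * (ι (carlitzD F i))⁻¹ := by
  have hq : 1 < Fintype.card F := Fintype.one_lt_card
  induction i with
  | zero => simp [limCoeff_zero, carlitzD]
  | succ i ih =>
    have h1 : limCoeff h (i + 1) * ι X ^ Fintype.card F ^ (i + 1) =
        ι X * limCoeff h (i + 1) + c ^ (Fintype.card F - 1) * limCoeff h i ^ Fintype.card F := by
      refine tendsto_nhds_unique
        (((tendsto_boxCoeff h (i + 1)).comp (tendsto_add_atTop_nat 1)).mul_const _) ?_
      refine Tendsto.congr (fun N => (boxCoeff_succ_mul_X_pow h.injective N i).symm) ?_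
      exact ((tendsto_boxCoeff h _).const_mul _).add (hc.mul ((tendsto_boxCoeff h _).pow _))
    have h3 := carlitzD_ne_zero h i
    have h4 := X_pow_sub_X_ne_zero h i
    have h5 : c ^ (Fintype.card F ^ (i + 1) - 1) =
        c ^ (Fintype.card F - 1) * (c ^ (Fintype.card F ^ i - 1)) ^ Fintype.card F := by
      rw [← pow_mul, ← pow_add]
      congr 1
      have : 0 < Fintype.card F ^ i := by positivity
      obtain ⟨m, hm⟩ : ∃ m, Fintype.card F ^ i = m + 1 := ⟨_, (Nat.sub_add_cancel this).symm⟩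
      rw [pow_succ, hm, Nat.add_sub_cancel, add_mul, one_mul]
      omega
    rw [map_carlitzD_succ, h5]
    rw [ih, mul_pow] at h1
    rw [← div_eq_mul_inv, eq_div_iff (mul_ne_zero h4 (pow_ne_zero _ h3))]
    rw [inv_pow] at h1
    have h6 : (ι (carlitzD F i) ^ Fintype.card F)⁻¹ * ι (carlitzD F i) ^ Fintype.card F = 1 :=
      inv_mul_cancel₀ (pow_ne_zero _ h3)
    linear_combination ι (carlitzD F i) ^ Fintype.card F * h1 +
      c ^ (Fintype.card F - 1) * (c ^ (Fintype.card F ^ i - 1)) ^ Fintype.card F * h6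

/-- The `e_N(x)` converge to `c⁻¹ e(c x)`, where `e` is the Carlitz exponential and
`κ = c ^ (q - 1)`. For `|x| < 1` the convergence is that of the coefficients; the functional
equations of `e_N` and `e` extend it to all `x`. -/
theorem tendsto_boxExp_expOf (h : IsDegreeNorm ι) {c : K} (hc0 : c ≠ 0)
    (hc : Tendsto (boxKappa ι) atTop (𝓝 (c ^ (Fintype.card F - 1)))) (x : K) :
    Tendsto (fun N => (boxExp ι N).eval x) atTop (𝓝 (c⁻¹ * expOf ι (c * x))) := by
  have hq : 1 < Fintype.card F := Fintype.one_lt_card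
  have small : ∀ x : K, ‖x‖ < 1 →
      Tendsto (fun N => (boxExp ι N).eval x) atTop (𝓝 (c⁻¹ * expOf ι (c * x))) := by
    intro x hx
    have h1 := tendsto_boxExp_of_norm_lt_one h hx
    rw [expOf, ← tsum_mul_left]
    convert h1 using 3
    funext i
    rw [limCoeff_eq h hc, mul_pow]
    have : 0 < Fintype.card F ^ i := by positivity
    obtain ⟨m, hm⟩ : ∃ m, Fintype.card F ^ i = m + 1 := ⟨_, (Nat.sub_add_cancel this).symm⟩
    rw [hm, Nat.add_sub_cancel]
    field_simp
    ring
  have step : ∀ x : K, Tendsto (fun N => (boxExp ι N).eval x) atTop (𝓝 (c⁻¹ * expOf ι (c * x))) →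
      Tendsto (fun N => (boxExp ι N).eval (ι X * x)) atTop
        (𝓝 (c⁻¹ * expOf ι (c * (ι X * x)))) := by
    intro x hx
    rw [← tendsto_add_atTop_iff_nat 1]
    simp only [eval_boxExp_succ_X_mul h.injective]
    have h2 : c⁻¹ * expOf ι (c * (ι X * x)) = ι X * (c⁻¹ * expOf ι (c * x)) +
        c ^ (Fintype.card F - 1) * (c⁻¹ * expOf ι (c * x)) ^ Fintype.card F := by
      rw [mul_left_comm, expOf_X_mul h]
      obtain ⟨m, hm⟩ : ∃ m, Fintype.card F = m + 1 := ⟨_, (Nat.sub_add_cancel hq.le).symm⟩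
      rw [hm, Nat.add_sub_cancel, mul_pow, inv_pow]
      field_simp
      ring
    rw [h2]
    exact (hx.const_mul _).add (hc.mul (hx.pow _))
  have pow : ∀ (m : ℕ) (x : K), ‖x‖ < 1 → Tendsto (fun N => (boxExp ι N).eval (ι X ^ m * x)) atTop
      (𝓝 (c⁻¹ * expOf ι (c * (ι X ^ m * x)))) := by
    intro m x hx
    induction m with
    | zero => simpa using small x hx
    | succ m ih => simpa only [pow_succ', mul_assoc] using step _ ih
  obtain ⟨m, hm⟩ := pow_unbounded_of_one_lt ‖x‖ (one_lt_card_real F)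
  have hX := h.X_ne_zero
  have := pow m ((ι X ^ m)⁻¹ * x) (by
    rw [norm_mul, norm_inv, norm_pow, h.norm_X, inv_mul_lt_iff₀ (pow_pos (card_real_pos F) m),
      mul_one]
    exact hm)
  rwa [mul_inv_cancel_left₀ (pow_ne_zero _ hX)] at this

/-- If `κ = c ^ (q - 1)`, the kernel of the Carlitz exponential is `c A`. With
`exists_tendsto_boxKappa`, this shows that periods exist. -/
theorem expOf_eq_zero_iff (h : IsDegreeNorm ι) {c : K} (hc0 : c ≠ 0)
    (hc : Tendsto (boxKappa ι) atTop (𝓝 (c ^ (Fintype.card F - 1)))) (x : K) :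
    expOf ι (c * x) = 0 ↔ x ∈ Set.range ι := by
  have h1 := tendsto_boxExp_expOf h hc0 hc x
  constructor
  · intro h0
    by_contra hx
    obtain ⟨δ, hδ, h2⟩ := exists_le_norm_sub h hx
    rw [h0, mul_zero] at h1
    have h3 : δ ≤ ‖(0 : K)‖ := ge_of_tendsto h1.norm
      (Eventually.of_forall fun N => le_norm_boxExp' h hδ.le fun b _ => h2 b)
    rw [norm_zero] at h3
    linarith
  · rintro ⟨a, rfl⟩
    have h2 : Tendsto (fun N => (boxExp ι N).eval (ι a)) atTop (𝓝 0) := by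
      refine tendsto_const_nhds.congr' ?_
      filter_upwards [eventually_gt_atTop a.natDegree] with N hN
      refine ((eval_boxExp_eq_zero_iff h.injective).2 ⟨a, ?_, rfl⟩).symm
      rw [mem_box]
      exact (degree_le_natDegree).trans_lt (by exact_mod_cast hN)
    have h3 := tendsto_nhds_unique h1 h2
    exact (mul_eq_zero.1 h3).resolve_left (inv_ne_zero hc0)

/-- For a period `ϖ` of the Carlitz module, `κ = ϖ ^ (q - 1)`: a period is determined by its
lattice `ϖ A` up to a unit of `A`. -/
theorem tendsto_boxKappa_period (h : IsDegreeNorm ι)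
    (hroot : ∃ s : K, s ^ (Fintype.card F - 1) = -ι X) {ϖ : K}
    (hϖ : {z : K | expOf ι z = 0} = Set.range fun a : F[X] => ϖ * ι a) :
    Tendsto (boxKappa ι) atTop (𝓝 (ϖ ^ (Fintype.card F - 1))) := by
  obtain ⟨c, hc0, hc⟩ := exists_tendsto_boxKappa h hroot
  have h1 : c ∈ {z : K | expOf ι z = 0} := by
    have := (expOf_eq_zero_iff h hc0 hc 1).2 ⟨1, map_one ι⟩
    rwa [mul_one] at this
  rw [hϖ] at h1
  obtain ⟨u, hu : ϖ * ι u = c⟩ := h1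
  have h2 : expOf ι (c * (ϖ / c)) = 0 := by
    rw [mul_div_cancel₀ _ hc0]
    have : ϖ ∈ Set.range fun a : F[X] => ϖ * ι a := ⟨1, by simp⟩
    rwa [← hϖ] at this
  obtain ⟨v, hv⟩ := (expOf_eq_zero_iff h hc0 hc _).1 h2
  have hv' : ϖ = c * ι v := by rw [hv, mul_div_cancel₀ _ hc0]
  have huv : v * u = 1 := by
    apply h.injective
    rw [map_mul, map_one]
    refine mul_left_cancel₀ hc0 ?_
    rw [mul_one, ← mul_assoc, ← hv', hu]
  obtain ⟨r, hr, hrv⟩ := Polynomial.isUnit_iff.1 (IsUnit.of_mul_eq_one _ huv)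
  rw [hv', ← hrv, mul_pow, ← map_pow, ← C_pow, FiniteField.pow_card_sub_one_eq_one r hr.ne_zero]
  simpa using hc

end Period

/-! ### Uniform convergence of the double sums -/

section BoxSums

variable {F : Type*} [Field F] [Fintype F]

/-- The power sums of `A_{<N}` of exponent less than `N` vanish. -/
theorem sum_box_pow {K : Type*} [Field K] (ι : F[X] →+* K) {N i : ℕ} (hi : i < N) :
    ∑ a ∈ box F N, ι a ^ i = 0 := by
  induction N generalizing i with
  | zero => omega
  | succ N ih =>
    rw [sum_box_succ]
    simp only [map_add, map_mul, add_pow]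
    -- by induction only the top term of the binomial expansion survives; it does not involve `c`
    have h1 : ∀ c : F, ∑ b ∈ box F N, ∑ j ∈ Finset.range (i + 1),
        ι b ^ j * (ι (C c) * ι (X ^ N)) ^ (i - j) * (i.choose j : K) =
        ∑ b ∈ box F N, ι b ^ i := by
      intro c
      rw [Finset.sum_comm, Finset.sum_range_succ, Finset.sum_eq_zero, zero_add]
      · simp
      · intro j hj
        rw [Finset.mem_range] at hj
        simp only [mul_assoc]
        rw [← Finset.sum_mul, ih (by omega), zero_mul]
    simp only [h1]
    rw [Finset.sum_const, Finset.card_univ, nsmul_eq_mul, card_cast_eq_zero ι, zero_mul]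

theorem sum_box_eval {K : Type*} [Field K] (ι : F[X] →+* K) {N : ℕ} {P : K[X]}
    (hP : P.natDegree < N) : ∑ a ∈ box F N, P.eval (ι a) = 0 := by
  simp only [eval_eq_sum_range]
  rw [Finset.sum_comm]
  refine Finset.sum_eq_zero fun i hi => ?_
  rw [Finset.mem_range] at hi
  rw [← Finset.mul_sum, sum_box_pow ι (by omega), mul_zero]

theorem tendsto_box_atTop : Tendsto (box F) atTop atTop := by
  refine tendsto_atTop_finset_of_monotone (fun _ _ h => box_mono h) fun a => ⟨a.natDegree + 1, ?_⟩
  rw [mem_box]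
  exact degree_le_natDegree.trans_lt (by exact_mod_cast Nat.lt_succ_self _)

variable {K : Type*} [NormedField K] {ι : F[X] →+* K}

variable (ι) in
/-- The Eisenstein-type sum `∑ (x - b)^(-n)` over all `b ∈ A`. -/
def latSum (n : ℕ) (x : K) : K := ∑' b : F[X], ((x - ι b) ^ n)⁻¹

theorem le_norm_of_not_mem_box (h : IsDegreeNorm ι) {N : ℕ} {b : F[X]} (hb : b ∉ box F N) :
    (Fintype.card F : ℝ) ^ N ≤ ‖ι b‖ := by
  have h0 : b ≠ 0 := fun h0 => hb (h0 ▸ zero_mem_box N)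
  rw [mem_box_iff_natDegree h0, not_lt] at hb
  rw [h b h0]
  exact pow_le_pow_right₀ (one_lt_card_real F).le hb

variable [IsUltrametricDist K]

theorem norm_sub_pow_inv_le (h : IsDegreeNorm ι) {N n : ℕ} (hn : n ≠ 0) {x : K}
    (hx : ‖x‖ < (Fintype.card F : ℝ) ^ N) {b : F[X]} (hb : b ∉ box F N) :
    ‖((x - ι b) ^ n)⁻¹‖ ≤ ((Fintype.card F : ℝ) ^ N)⁻¹ := by
  have h1 := le_norm_of_not_mem_box h hb
  have h2 : ‖x - ι b‖ = ‖ι b‖ := by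
    rw [sub_eq_add_neg, IsUltrametricDist.norm_add_eq_max_of_norm_ne_norm
      (by rw [norm_neg]; exact (hx.trans_le h1).ne), norm_neg]
    exact max_eq_right (hx.trans_le h1).le
  have h3 : (1 : ℝ) ≤ (Fintype.card F : ℝ) ^ N := one_le_pow₀ (one_lt_card_real F).le
  rw [norm_inv, norm_pow, h2]
  exact inv_anti₀ (by linarith) (h1.trans (le_self_pow₀ (h3.trans h1) hn))

/-- The recursion for the sums `∑ (x - b)^(-n)`, whose coefficients are bounded by `1`, reduces
their estimate to the one of `1 / e_N(x)`. -/
theorem norm_boxSum_le (h : IsDegreeNorm ι) {N n : ℕ} (hn : n ≠ 0) {x : K}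
    (hx : ∀ b ∈ box F N, x ≠ ι b) (he : ‖((boxExp ι N).eval x)⁻¹‖ ≤ 1) :
    ‖boxSum ι N n x‖ ≤ ‖((boxExp ι N).eval x)⁻¹‖ := by
  induction n using Nat.strong_induction_on with
  | _ n ih =>
    rcases (by omega : n = 1 ∨ 2 ≤ n) with rfl | h2
    · rw [boxSum_one h.injective hx]
    · rw [boxSum_recursion h.injective hx h2, norm_mul]
      refine mul_le_of_le_one_right (norm_nonneg _) ?_
      refine IsUltrametricDist.norm_sum_le_of_forall_le_of_nonneg zero_le_one fun i _ => ?_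
      split_ifs with hi
      · rw [norm_mul]
        have hpos : 0 < Fintype.card F ^ i := by positivity
        exact mul_le_one₀ (norm_boxCoeff_le h N i) (norm_nonneg _)
          ((ih _ (by omega) (by omega)).trans he)
      · simp

/-- The distance of `a z` to `A` is at least `δ |a|`, for all nonzero `a`. -/
def IsSeparated (ι : F[X] →+* K) (δ : ℝ) (z : K) : Prop :=
  ∀ a b : F[X], a ≠ 0 → δ * ‖ι a‖ ≤ ‖ι a * z - ι b‖

/-- The sums `∑ (a z - b)^(-n)` over `A_{<N}` decay, as `|a| → ∞`, faster than every power
of `|a|`, uniformly in `N` and in `z`. -/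
theorem exists_norm_pow_mul_boxSum_le (h : IsDegreeNorm ι) {n : ℕ} (hn : n ≠ 0) (s : ℕ) {δ ε : ℝ}
    (hδ : 0 < δ) (hε : 0 < ε) :
    ∃ D : ℕ, ∀ N, D ≤ N → ∀ z, IsSeparated ι δ z → ∀ a ∉ box F D,
      ‖ι a ^ s * boxSum ι N n (ι a * z)‖ ≤ ε := by
  have hq := one_lt_card_real F
  have hq0 := card_real_pos F
  set J := s + 1
  have hJ : s ≤ Fintype.card F ^ J - 1 := by
    have : J < Fintype.card F ^ J := Nat.lt_pow_self Fintype.one_lt_card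
    omega
  have hev : ∀ᶠ D : ℕ in atTop, (J ≤ D ∧ (Fintype.card F : ℝ) ^ J / δ ≤ (Fintype.card F : ℝ) ^ D) ∧
      1 / δ ≤ (Fintype.card F : ℝ) ^ D ∧
      1 / (ε * δ * (δ / (Fintype.card F : ℝ) ^ J) ^ s) ≤ (Fintype.card F : ℝ) ^ D := by
    have ht := tendsto_pow_atTop_atTop_of_one_lt hq
    exact ((eventually_ge_atTop J).and (ht.eventually_ge_atTop _)).and
      ((ht.eventually_ge_atTop _).and (ht.eventually_ge_atTop _))
  obtain ⟨D, ⟨hD1, hD2⟩, hD3, hD4⟩ := hev.exists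
  refine ⟨D, fun N hN z hz a ha => ?_⟩
  have h0 : a ≠ 0 := fun h0 => ha (h0 ▸ zero_mem_box D)
  have hR := le_norm_of_not_mem_box h ha
  set R := ‖ι a‖ with hRdef
  have hR0 : 0 < R := lt_of_lt_of_le (by positivity) hR
  have h1 : (Fintype.card F : ℝ) ^ J ≤ δ * R := by
    rw [mul_comm]; exact (div_le_iff₀ hδ).1 (hD2.trans hR)
  have h2 : 1 ≤ δ * R := by
    rw [mul_comm]; exact (div_le_iff₀ hδ).1 (hD3.trans hR)
  have hpos : 0 < δ * R * (δ * R / (Fintype.card F : ℝ) ^ J) ^ s := by positivity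
  have h3 : δ * R * (δ * R / (Fintype.card F : ℝ) ^ J) ^ s ≤
      ‖(boxExp ι N).eval (ι a * z)‖ := by
    refine le_trans ?_ (le_norm_boxExp h (hD1.trans hN) (by positivity : 0 ≤ δ * R)
      fun b _ => hz a b h0)
    refine mul_le_mul_of_nonneg_left (pow_le_pow_right₀ ?_ hJ) (by positivity)
    rwa [one_le_div (by positivity)]
  have h4 : 1 ≤ ‖(boxExp ι N).eval (ι a * z)‖ :=
    h2.trans (le_norm_boxExp' h (by positivity) fun b _ => hz a b h0)
  have hne : ∀ b ∈ box F N, ι a * z ≠ ι b := by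
    intro b _ hb
    have := hz a b h0
    rw [hb, sub_self, norm_zero] at this
    linarith
  have h5 := norm_boxSum_le h hn hne (by rw [norm_inv]; exact inv_le_one_of_one_le₀ h4)
  rw [norm_mul, norm_pow, ← hRdef]
  rw [norm_inv] at h5
  have h6 : 1 / (ε * δ * (δ / (Fintype.card F : ℝ) ^ J) ^ s) ≤ R := hD4.trans hR
  rw [div_le_iff₀ (by positivity)] at h6
  calc R ^ s * ‖boxSum ι N n (ι a * z)‖
      ≤ R ^ s * (δ * R * (δ * R / (Fintype.card F : ℝ) ^ J) ^ s)⁻¹ := by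
        refine mul_le_mul_of_nonneg_left (h5.trans (inv_anti₀ hpos h3)) (by positivity)
    _ ≤ ε := by
        rw [← div_eq_mul_inv, div_le_iff₀ hpos]
        have : δ * R / (Fintype.card F : ℝ) ^ J = R * (δ / (Fintype.card F : ℝ) ^ J) := by ring
        rw [this, mul_pow]
        have hRs : 0 < R ^ s := by positivity
        nlinarith [mul_le_mul_of_nonneg_left h6 hRs.le]

variable [CompleteSpace K]

theorem summable_latSum (h : IsDegreeNorm ι) {n : ℕ} (hn : n ≠ 0) (x : K) :
    Summable fun b : F[X] => ((x - ι b) ^ n)⁻¹ := by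
  have hq := one_lt_card_real F
  refine NonarchimedeanAddGroup.summable_of_tendsto_cofinite_zero ?_
  rw [Metric.tendsto_nhds]
  intro ε hε
  have ht := tendsto_pow_atTop_atTop_of_one_lt hq
  obtain ⟨N, hN1, hN2⟩ := ((ht.eventually_gt_atTop ‖x‖).and (ht.eventually_gt_atTop ε⁻¹)).exists
  rw [eventually_cofinite]
  refine (box F N).finite_toSet.subset fun b hb => ?_
  by_contra hb'
  refine hb ?_
  rw [dist_zero_right]
  exact (norm_sub_pow_inv_le h hn hN1 hb').trans_lt (inv_lt_of_inv_lt₀ hε hN2)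

theorem tendsto_boxSum (h : IsDegreeNorm ι) {n : ℕ} (hn : n ≠ 0) (x : K) :
    Tendsto (fun N => boxSum ι N n x) atTop (𝓝 (latSum ι n x)) :=
  (summable_latSum h hn x).hasSum.comp tendsto_box_atTop

theorem norm_latSum_sub_boxSum_le (h : IsDegreeNorm ι) {N n : ℕ} (hn : n ≠ 0) {x : K}
    (hx : ‖x‖ < (Fintype.card F : ℝ) ^ N) :
    ‖boxSum ι N n x - latSum ι n x‖ ≤ ((Fintype.card F : ℝ) ^ N)⁻¹ := by
  have h1 := (summable_latSum h hn x).sum_add_tsum_compl (s := box F N)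
  rw [boxSum, latSum, ← h1, sub_add_cancel_left, norm_neg]
  have hq := card_real_pos F
  exact IsUltrametricDist.norm_tsum_le_of_forall_le_of_nonneg (by positivity) fun b =>
    norm_sub_pow_inv_le h hn hx b.2

theorem norm_pow_mul_latSum_le (h : IsDegreeNorm ι) {n s : ℕ} (hn : n ≠ 0) {x y : K} {ε : ℝ} {D : ℕ}
    (hD : ∀ N, D ≤ N → ‖y ^ s * boxSum ι N n x‖ ≤ ε) : ‖y ^ s * latSum ι n x‖ ≤ ε :=
  le_of_tendsto ((tendsto_boxSum h hn x).const_mul (y ^ s)).norm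
    ((eventually_ge_atTop D).mono hD)

/-- Uniform convergence of the terms `a^s ∑_b (a z - b)^(-n)`: on bounded sets of points `z` that
are separated from `K_∞`, their truncations to `b ∈ A_{<N}` converge uniformly in both `z`
and `a`. -/
theorem exists_uniform_bound (h : IsDegreeNorm ι) {n s : ℕ} (hn : n ≠ 0) {δ ε : ℝ}
    (hδ : 0 < δ) (hε : 0 < ε) (B : ℝ) :
    ∃ N₁ : ℕ, ∀ N, N₁ ≤ N → ∀ z, IsSeparated ι δ z → ‖z‖ ≤ B → ∀ a : F[X],
      ‖ι a ^ s * boxSum ι N n (ι a * z) - ι a ^ s * latSum ι n (ι a * z)‖ ≤ ε ∧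
      (a ∉ box F N → ‖ι a ^ s * latSum ι n (ι a * z)‖ ≤ ε) := by
  have hq := one_lt_card_real F
  have hq0 := card_real_pos F
  obtain ⟨D, hD⟩ := exists_norm_pow_mul_boxSum_le h hn s hδ hε
  have ht := tendsto_pow_atTop_atTop_of_one_lt hq
  have hev : ∀ᶠ N : ℕ in atTop, ((Fintype.card F : ℝ) ^ D * B < (Fintype.card F : ℝ) ^ N ∧
      ((Fintype.card F : ℝ) ^ D) ^ s / ε ≤ (Fintype.card F : ℝ) ^ N) ∧ D ≤ N :=
    ((ht.eventually_gt_atTop _).and (ht.eventually_ge_atTop _)).and (eventually_ge_atTop D)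
  obtain ⟨N₁, hN₁⟩ := eventually_atTop.1 hev
  refine ⟨N₁, fun N hN z hz hzB a => ?_⟩
  obtain ⟨⟨h1, h2⟩, h3⟩ := hN₁ N hN
  have hlarge : a ∉ box F D → ‖ι a ^ s * latSum ι n (ι a * z)‖ ≤ ε := fun ha =>
    norm_pow_mul_latSum_le h hn fun M hM => hD M hM z hz a ha
  refine ⟨?_, fun ha => hlarge fun ha' => ha (box_mono h3 ha')⟩
  by_cases ha : a ∈ box F D
  · have ha' := h.norm_le_of_mem_box ha
    have h4 : ‖ι a * z‖ < (Fintype.card F : ℝ) ^ N := by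
      rw [norm_mul]
      exact (mul_le_mul ha' hzB (norm_nonneg _) (by positivity)).trans_lt h1
    rw [← mul_sub, norm_mul, norm_pow]
    calc ‖ι a‖ ^ s * ‖boxSum ι N n (ι a * z) - latSum ι n (ι a * z)‖
        ≤ ((Fintype.card F : ℝ) ^ D) ^ s * ((Fintype.card F : ℝ) ^ N)⁻¹ :=
          mul_le_mul (pow_le_pow_left₀ (norm_nonneg _) ha' s) (norm_latSum_sub_boxSum_le h hn h4)
            (norm_nonneg _) (by positivity)
      _ ≤ ε := by
          rw [← div_eq_mul_inv, div_le_iff₀ (by positivity)]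
          rwa [div_le_iff₀ hε, mul_comm] at h2
  · exact (norm_sub_le_max _ _).trans (max_le (hD N h3 z hz a ha) (hlarge ha))

/-- The terms `a^s ∑_b (a z - b)^(-n)` tend to zero, which is enough over a nonarchimedean field. -/
theorem summable_pow_mul_latSum (h : IsDegreeNorm ι) {n s : ℕ} (hn : n ≠ 0) {δ : ℝ}
    (hδ : 0 < δ) {z : K} (hz : IsSeparated ι δ z) :
    Summable fun a : F[X] => ι a ^ s * latSum ι n (ι a * z) := by
  refine NonarchimedeanAddGroup.summable_of_tendsto_cofinite_zero ?_
  rw [Metric.tendsto_nhds]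
  intro ε hε
  obtain ⟨N, hN⟩ := exists_uniform_bound (s := s) h hn hδ (half_pos hε) ‖z‖
  rw [eventually_cofinite]
  refine (box F N).finite_toSet.subset fun a ha => ?_
  by_contra ha'
  refine ha ?_
  rw [dist_zero_right]
  exact ((hN N le_rfl z hz le_rfl a).2 ha').trans_lt (half_lt_self hε)

variable (ι) in
/-- The finite sum `∑ a^s (a z - b)^(-n)` over the `a, b ∈ A` of degree less than `N`. -/
def squareSum (N s n : ℕ) (z : K) : K := ∑ a ∈ box F N, ι a ^ s * boxSum ι N n (ι a * z)

variable (ι) in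
/-- The double sum `∑_a a^s ∑_b (a z - b)^(-n)` over `A`. -/
def doubleSum (s n : ℕ) (z : K) : K := ∑' a : F[X], ι a ^ s * latSum ι n (ι a * z)

/-- The sums over squares converge to the iterated double sum, uniformly on bounded sets of points
separated from `K_∞`. -/
theorem exists_norm_squareSum_sub_le (h : IsDegreeNorm ι) {n s : ℕ} (hn : n ≠ 0)
    {δ ε : ℝ} (hδ : 0 < δ) (hε : 0 < ε) (B : ℝ) :
    ∃ N₁ : ℕ, ∀ N, N₁ ≤ N → ∀ z, IsSeparated ι δ z → ‖z‖ ≤ B →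
      ‖squareSum ι N s n z - doubleSum ι s n z‖ ≤ ε := by
  obtain ⟨N₁, hN₁⟩ := exists_uniform_bound (s := s) h hn hδ hε B
  refine ⟨N₁, fun N hN z hz hzB => ?_⟩
  have h1 := (summable_pow_mul_latSum (s := s) h hn hδ hz).sum_add_tsum_compl (s := box F N)
  rw [squareSum, doubleSum, ← h1, ← sub_sub, ← Finset.sum_sub_distrib]
  refine (norm_sub_le_max _ _).trans (max_le ?_ ?_)
  · exact IsUltrametricDist.norm_sum_le_of_forall_le_of_nonneg hε.le fun a _ =>
      (hN₁ N hN z hz hzB a).1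
  · exact IsUltrametricDist.norm_tsum_le_of_forall_le_of_nonneg hε.le fun a =>
      (hN₁ N hN z hz hzB a).2 a.2

theorem tendsto_squareSum (h : IsDegreeNorm ι) {n s : ℕ} (hn : n ≠ 0) {δ : ℝ}
    (hδ : 0 < δ) {z : K} (hz : IsSeparated ι δ z) :
    Tendsto (fun N => squareSum ι N s n z) atTop (𝓝 (doubleSum ι s n z)) := by
  rw [Metric.tendsto_atTop]
  intro ε hε
  obtain ⟨N₁, hN₁⟩ := exists_norm_squareSum_sub_le (s := s) h hn hδ (half_pos hε) ‖z‖
  refine ⟨N₁, fun N hN => ?_⟩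
  rw [dist_eq_norm]
  exact (hN₁ N hN z hz le_rfl).trans_lt (half_lt_self hε)

end BoxSums

/-! ### The symmetry of the sums over squares under inversion -/

section Inversion

variable {F : Type*} [Field F] [Fintype F] {K : Type*} [Field K] {ι : F[X] →+* K}

/-- The exact symmetry of the sums over squares under `z ↦ -1 / z`. The two sides differ by
`∑ (b^s - (a z)^s) / (a z - b)^n`, where `s = P m` and `P` is a power of the characteristic. As
`b^P - (a z)^P = -(a z - b)^P` and `n ≤ P`, the summands are polynomials in `a`, and the sum of
a polynomial of degree less than `N` over `A_{<N}` vanishes. -/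
theorem squareSum_neg_inv {p v m n N : ℕ} [ExpChar K p] (hn : n ≠ 0) (hnP : n ≤ p ^ v)
    (hm : n < p ^ v * m) (hN : p ^ v * m < N) {z : K} (hz : ∀ a b : F[X], ι a * z = ι b → a = 0) :
    ∑ a ∈ box F N, ι a ^ (p ^ v * m) * boxSum ι N n (ι a * (-z⁻¹)) =
      z ^ (p ^ v * m + n) * ∑ a ∈ box F N, ι a ^ (p ^ v * m) * boxSum ι N n (ι a * z) := by
  have hz0 : z ≠ 0 := fun h0 => one_ne_zero (hz 1 0 (by simp [h0]))
  have hP : p ^ v ≠ 0 := by omega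
  have hm0 : m ≠ 0 := by rintro rfl; omega
  have h1 : ∀ a : F[X], boxSum ι N n (ι a * (-z⁻¹)) =
      z ^ n * ∑ b ∈ box F N, ((ι b * z - ι a) ^ n)⁻¹ := by
    intro a
    rw [boxSum, Finset.mul_sum]
    refine Finset.sum_bij' (fun b _ => -b) (fun b _ => -b) (fun b hb => neg_mem_box.2 hb)
      (fun b hb => neg_mem_box.2 hb) (fun b _ => neg_neg b) (fun b _ => neg_neg b) fun b _ => ?_
    have h2 : ι (-b) * z - ι a = z * (ι a * (-z⁻¹) - ι b) := by
      rw [map_neg]; field_simp; ring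
    rw [h2, mul_pow, mul_inv, mul_inv_cancel_left₀ (pow_ne_zero n hz0)]
  simp only [h1]
  simp only [boxSum]
  -- the difference of the two sides, for a fixed `b`
  have key : ∀ b : F[X], ∑ a ∈ box F N,
      (ι b ^ (p ^ v * m) - (ι a * z) ^ (p ^ v * m)) * ((ι a * z - ι b) ^ n)⁻¹ = 0 := by
    intro b
    set Q : K[X] := -((C z * X - C (ι b)) ^ (p ^ v - n) * ∑ i ∈ Finset.range m,
      (C (ι b) ^ p ^ v) ^ i * ((C z * X) ^ p ^ v) ^ (m - 1 - i)) with hQ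
    have hdeg : Q.natDegree < N := by
      have d1 : (C z * X : K[X]).natDegree ≤ 1 :=
        (natDegree_C_mul_le _ _).trans natDegree_X_le
      have d2 : ((C z * X - C (ι b)) ^ (p ^ v - n)).natDegree ≤ p ^ v - n := by
        refine natDegree_pow_le.trans ((Nat.mul_le_mul_left _ ?_).trans (mul_one _).le)
        exact (natDegree_sub_le _ _).trans (max_le d1 (by simp))
      have d3 : (∑ i ∈ Finset.range m, (C (ι b) ^ p ^ v) ^ i *
          ((C z * X) ^ p ^ v) ^ (m - 1 - i)).natDegree ≤ p ^ v * (m - 1) := by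
        refine natDegree_sum_le_of_forall_le _ _ fun i _ => ?_
        rw [← C_pow, ← C_pow, ← pow_mul]
        refine (natDegree_C_mul_le _ _).trans (natDegree_pow_le.trans ?_)
        calc (m - 1 - i) * ((C z * X : K[X]) ^ p ^ v).natDegree
            ≤ (m - 1) * (p ^ v * 1) := Nat.mul_le_mul (Nat.sub_le _ _)
              (natDegree_pow_le.trans (Nat.mul_le_mul_left _ d1))
          _ = p ^ v * (m - 1) := by ring
      rw [hQ, natDegree_neg]
      refine natDegree_mul_le.trans_lt ((add_le_add d2 d3).trans_lt (lt_of_le_of_lt ?_ hN))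
      obtain ⟨j, rfl⟩ := Nat.exists_eq_succ_of_ne_zero hm0
      rw [Nat.succ_eq_add_one, Nat.add_sub_cancel, mul_add, mul_one]
      omega
    rw [← sum_box_eval ι hdeg]
    refine Finset.sum_congr rfl fun a _ => ?_
    simp only [hQ, eval_neg, eval_mul, eval_pow, eval_sub, eval_C, eval_X, eval_finsetSum]
    rw [mul_comm z (ι a)]
    by_cases hab : ι a * z = ι b
    -- the term with `a = b = 0`, where `0⁻¹ = 0`, has the value `Q(0) = 0`
    · have ha := hz a b hab
      have hb : ι b = 0 := by rw [← hab, ha, map_zero, zero_mul]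
      have hsum : n = p ^ v → ∑ i ∈ Finset.range m,
          ((0 : K) ^ p ^ v) ^ i * (0 ^ p ^ v) ^ (m - 1 - i) = 0 := fun hnv => by
        refine Finset.sum_eq_zero fun i hi => ?_
        rw [Finset.mem_range] at hi
        have hm2 : m ≠ 1 := by rintro rfl; omega
        rw [← pow_add, zero_pow hP, zero_pow (by omega)]
      rw [hab, hb, sub_self, zero_mul, sub_self]
      rcases hnP.eq_or_lt with hnv | hnv
      · rw [hsum hnv]; simp
      · rw [zero_pow (by omega)]; simp
    · have hy : ι a * z - ι b ≠ 0 := sub_ne_zero.2 hab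
      rw [pow_mul, pow_mul, ← geom_sum₂_mul, pow_sub₀ _ hy hnP, sub_pow_expChar_pow (p := p)]
      ring
  have key2 := Finset.sum_eq_zero fun b (_ : b ∈ box F N) => key b
  rw [Finset.sum_comm] at key2
  simp only [sub_mul, Finset.sum_sub_distrib] at key2
  rw [sub_eq_zero] at key2
  calc _ = z ^ n * ∑ a ∈ box F N, ∑ b ∈ box F N,
        ι b ^ (p ^ v * m) * ((ι a * z - ι b) ^ n)⁻¹ := by
        rw [Finset.sum_comm, Finset.mul_sum]
        refine Finset.sum_congr rfl fun a _ => ?_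
        rw [mul_left_comm, Finset.mul_sum]
    _ = _ := by
        rw [key2, pow_add, mul_comm (z ^ (p ^ v * m)), mul_assoc]
        congr 1
        rw [Finset.mul_sum]
        refine Finset.sum_congr rfl fun a _ => ?_
        rw [Finset.mul_sum, Finset.mul_sum]
        refine Finset.sum_congr rfl fun b _ => ?_
        rw [mul_pow]
        ring

end Inversion

/-! ### The double sum over `A` -/

section DoubleSum

variable {F : Type*} [Field F] {K : Type*} [NormedField K] {ι : F[X] →+* K}

theorem latSum_add (n : ℕ) (x : K) (c : F[X]) : latSum ι n (x + ι c) = latSum ι n x := by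
  rw [latSum, latSum, ← (Equiv.addRight c).tsum_eq]
  simp [map_add]

theorem doubleSum_add (s n : ℕ) (z : K) (c : F[X]) :
    doubleSum ι s n (z + ι c) = doubleSum ι s n z := by
  simp only [doubleSum, mul_add, ← map_mul, latSum_add]

/-- Multiplication by a nonzero constant as a permutation of `F[X]`. -/
def constMulEquiv {c : F} (hc : c ≠ 0) : F[X] ≃ F[X] where
  toFun a := C c * a
  invFun a := C c⁻¹ * a
  left_inv a := by beta_reduce; rw [← mul_assoc, ← C_mul, inv_mul_cancel₀ hc, C_1, one_mul]
  right_inv a := by beta_reduce; rw [← mul_assoc, ← C_mul, mul_inv_cancel₀ hc, C_1, one_mul]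

theorem const_ne_zero (ι : F[X] →+* K) {c : F} (hc : c ≠ 0) : ι (C c) ≠ 0 := fun h =>
  hc ((map_eq_zero (ι.comp C)).1 h)

theorem latSum_const_mul {c : F} (hc : c ≠ 0) (n : ℕ) (x : K) :
    latSum ι n (ι (C c) * x) = (ι (C c) ^ n)⁻¹ * latSum ι n x := by
  rw [latSum, latSum, ← (constMulEquiv hc).tsum_eq, ← tsum_mul_left]
  congr 1
  funext b
  change ((ι (C c) * x - ι (C c * b)) ^ n)⁻¹ = _
  rw [map_mul, ← mul_sub, mul_pow, mul_inv]

theorem doubleSum_const_mul {c : F} (hc : c ≠ 0) (s n : ℕ) (z : K) :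
    doubleSum ι s n (ι (C c) * z) = (ι (C c) ^ s)⁻¹ * doubleSum ι s n z := by
  have hc' : ι (C c) ≠ 0 := const_ne_zero ι hc
  rw [doubleSum, doubleSum, ← (constMulEquiv hc).tsum_eq (fun a => ι a ^ s * latSum ι n (ι a * z)),
    ← tsum_mul_left]
  congr 1
  funext a
  change _ = (ι (C c) ^ s)⁻¹ * (ι (C c * a) ^ s * latSum ι n (ι (C c * a) * z))
  rw [map_mul, mul_pow, mul_assoc, inv_mul_cancel_left₀ (pow_ne_zero s hc'), mul_left_comm,
    ← mul_assoc]

variable [Fintype F]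

/-- The sum over all nonzero `a` is `q - 1 = -1` times the sum over the monic `a`. -/
theorem hasSum_of_monics {g : F[X] → K} (h0 : g 0 = 0)
    (hg : ∀ (c : F) (a : F[X]), c ≠ 0 → g (C c * a) = g a) {S : K}
    (hS : HasSum (fun a : Monics F => g a.1) S) (hqK : (Fintype.card F : K) = 0) :
    HasSum g (-S) := by
  classical
  have h1 : ∀ c : F, c ≠ 0 →
      HasSum (fun a : F[X] => if a.leadingCoeff = c then g a else 0) S := by
    intro c hc
    have hinj : Function.Injective fun a : Monics F => C c * a.1 := fun a b hab =>
      Subtype.ext ((constMulEquiv hc).injective hab)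
    refine (hinj.hasSum_iff ?_).1 ?_
    · intro a ha
      rw [if_neg]
      rintro rfl
      refine ha ⟨⟨C a.leadingCoeff⁻¹ * a, ?_⟩, ?_⟩
      · rw [Monic, leadingCoeff_mul, leadingCoeff_C, inv_mul_cancel₀ hc]
      · exact (constMulEquiv hc).right_inv a
    · convert hS using 1
      funext a
      simp only [Function.comp_apply]
      rw [if_pos, hg c _ hc]
      rw [leadingCoeff_mul, leadingCoeff_C, a.2.leadingCoeff, mul_one]
  have h2 := hasSum_sum fun c (hc : c ∈ Finset.univ.erase (0 : F)) =>
    h1 c (Finset.ne_of_mem_erase hc)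
  convert h2 using 1
  · funext a
    rw [Finset.sum_ite_eq]
    split_ifs with ha
    · rfl
    · have : a = 0 := by simpa using ha
      rw [this, h0]
  · rw [Finset.sum_const, Finset.card_erase_of_mem (Finset.mem_univ _), Finset.card_univ,
      nsmul_eq_mul, Nat.cast_sub Fintype.card_pos, hqK]
    simp

theorem eq_zero_of_isSeparated {z : K} (hz : ∃ δ, 0 < δ ∧ IsSeparated ι δ z) (hι : IsDegreeNorm ι)
    {a b : F[X]} (h : ι a * z = ι b) : a = 0 := by
  obtain ⟨δ, hδ, hz⟩ := hz
  by_contra ha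
  have := hz a b ha
  rw [h, sub_self, norm_zero] at this
  have h1 := hι.one_le ha
  nlinarith

/-- The symmetry of the double sum under `z ↦ -1 / z`, as the limit of the one of the sums over
squares. -/
theorem doubleSum_neg_inv [IsUltrametricDist K] [CompleteSpace K] (hι : IsDegreeNorm ι)
    {p v m n : ℕ} [ExpChar K p] (hn : n ≠ 0) (hnP : n ≤ p ^ v) (hm : n < p ^ v * m) {z : K}
    (hz : ∃ δ, 0 < δ ∧ IsSeparated ι δ z) (hz' : ∃ δ, 0 < δ ∧ IsSeparated ι δ (-z⁻¹)) :
    doubleSum ι (p ^ v * m) n (-z⁻¹) = z ^ (p ^ v * m + n) * doubleSum ι (p ^ v * m) n z := by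
  obtain ⟨δ', hδ', hs'⟩ := hz'
  have h1 := tendsto_squareSum hι hn (s := p ^ v * m) hδ' hs'
  have h2 : ∀ a b : F[X], ι a * z = ι b → a = 0 := fun a b => eq_zero_of_isSeparated hz hι
  obtain ⟨δ, hδ, hs⟩ := hz
  refine tendsto_nhds_unique h1 (Tendsto.congr' ?_
    ((tendsto_squareSum hι hn (s := p ^ v * m) hδ hs).const_mul (z ^ (p ^ v * m + n))))
  filter_upwards [eventually_gt_atTop (p ^ v * m)] with N hN
  exact (squareSum_neg_inv hn hnP hm hN h2).symm

/-- `g` agrees on `S` with a rational function without poles on `S`. -/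
def IsRationalOn (S : Set K) (g : K → K) : Prop :=
  ∃ P Q : K[X], ∀ z ∈ S, Q.eval z ≠ 0 ∧ g z = P.eval z / Q.eval z

theorem IsRationalOn.const_mul {S : Set K} {g : K → K} (hg : IsRationalOn S g) (c : K) :
    IsRationalOn S fun z => c * g z := by
  obtain ⟨P, Q, h⟩ := hg
  refine ⟨C c * P, Q, fun z hz => ⟨(h z hz).1, ?_⟩⟩
  beta_reduce
  rw [(h z hz).2, eval_mul, eval_C, mul_div_assoc]

theorem IsRationalOn.sum {S : Set K} {α : Type*} (s : Finset α) {g : α → K → K}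
    (hg : ∀ i ∈ s, IsRationalOn S (g i)) : IsRationalOn S fun z => ∑ i ∈ s, g i z := by
  classical
  induction s using Finset.induction_on with
  | empty => exact ⟨0, 1, fun z _ => by simp⟩
  | insert i s hi ih =>
    obtain ⟨P, Q, h⟩ := hg i (Finset.mem_insert_self i s)
    obtain ⟨P', Q', h'⟩ := ih fun j hj => hg j (Finset.mem_insert_of_mem hj)
    refine ⟨P * Q' + Q * P', Q * Q', fun z hz => ?_⟩
    obtain ⟨h1, h2⟩ := h z hz
    obtain ⟨h3, h4⟩ := h' z hz
    simp only [eval_mul, eval_add]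
    refine ⟨mul_ne_zero h1 h3, ?_⟩
    beta_reduce at h4 ⊢
    rw [Finset.sum_insert hi, h2, h4, div_add_div _ _ h1 h3]

theorem isRationalOn_squareSum (hι : IsDegreeNorm ι) {δ : ℝ} (hδ : 0 < δ) {s : ℕ} (hs : s ≠ 0)
    (N n : ℕ) : IsRationalOn {z | IsSeparated ι δ z} (squareSum ι N s n) := by
  refine IsRationalOn.sum (box F N) (g := fun a z => ι a ^ s * boxSum ι N n (ι a * z))
    fun a _ => ?_
  by_cases ha : a = 0
  · exact ⟨0, 1, fun z _ => by simp [ha, hs]⟩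
  refine IsRationalOn.const_mul (g := fun z => boxSum ι N n (ι a * z)) ?_ _
  refine IsRationalOn.sum (box F N) (g := fun b z => ((ι a * z - ι b) ^ n)⁻¹) fun b _ => ?_
  refine ⟨1, (C (ι a) * X - C (ι b)) ^ n, fun z hz => ?_⟩
  simp only [eval_pow, eval_sub, eval_mul, eval_C, eval_X, eval_one, one_div, and_true]
  exact pow_ne_zero n (sub_ne_zero.2 fun h0 => ha (eq_zero_of_isSeparated ⟨δ, hδ, hz⟩ hι h0))

end DoubleSum

/-! ### The Goss polynomials -/

section Goss

variable {F : Type*} [Field F] [Fintype F]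

theorem isDegreeNorm_ofPoly : IsDegreeNorm (ofPoly F) := fun _ ha => norm_ofPoly F ha

theorem gossPoly_zero : gossPoly F 0 = 0 := by rw [gossPoly, gossPolyOf]

theorem gossPoly_one : gossPoly F 1 = X := by rw [gossPoly, gossPolyOf]

theorem gossPoly_recursion {n : ℕ} (hn : 2 ≤ n) :
    gossPoly F n = X * ∑ i ∈ Finset.range n,
      if Fintype.card F ^ i < n then C (expCoeff F i) * gossPoly F (n - Fintype.card F ^ i)
      else 0 := by
  obtain ⟨n, rfl⟩ : ∃ j, n = j + 2 := ⟨n - 2, by omega⟩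
  rw [gossPoly, gossPolyOf]
  congr 1
  refine Finset.sum_congr rfl fun i _ => ?_
  rcases lt_trichotomy (Fintype.card F ^ i) (n + 2) with h | h | h
  · rw [if_pos h.le, if_pos h]; rfl
  · rw [if_pos h.le, if_neg h.not_lt, h, Nat.sub_self]
    change C _ * gossPoly F 0 = 0
    rw [gossPoly_zero, mul_zero]
  · rw [if_neg h.not_ge, if_neg h.not_gt]

variable {ϖ : CInf F}

theorem tendsto_boxKappa_carlitzPeriod (hϖ : IsCarlitzPeriod ϖ) :
    Tendsto (boxKappa (ofPoly F)) atTop (𝓝 (ϖ ^ (Fintype.card F - 1))) := by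
  refine tendsto_boxKappa_period isDegreeNorm_ofPoly ?_ hϖ.2
  rw [← map_neg]
  exact exists_pow_eq_ofPoly F (-X) (Nat.sub_ne_zero_of_lt Fintype.one_lt_card)

theorem carlitzExp_ne_zero (hϖ : IsCarlitzPeriod ϖ) {x : CInf F}
    (hx : x ∉ Set.range (ofPoly F)) : carlitzExp F (ϖ * x) ≠ 0 := by
  intro h0
  have h1 : ϖ * x ∈ {z : CInf F | carlitzExp F z = 0} := h0
  rw [hϖ.2] at h1
  obtain ⟨a, ha⟩ := h1
  exact hx ⟨a, mul_left_cancel₀ hϖ.1 ha⟩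

theorem tendsto_inv_boxExp (hϖ : IsCarlitzPeriod ϖ) {x : CInf F}
    (hx : x ∉ Set.range (ofPoly F)) :
    Tendsto (fun N => ((boxExp (ofPoly F) N).eval x)⁻¹) atTop (𝓝 (ϖ * tFun ϖ x)) := by
  have h1 := tendsto_boxExp_expOf isDegreeNorm_ofPoly hϖ.1 (tendsto_boxKappa_carlitzPeriod hϖ) x
  have h2 := h1.inv₀ (mul_ne_zero (inv_ne_zero hϖ.1) (carlitzExp_ne_zero hϖ hx))
  rw [mul_inv, inv_inv] at h2
  exact h2

/-- Goss's identity `∑_{b ∈ A} (ϖ (x - b))^(-n) = G_n(t(x))`, from the recursion for finite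
lattices by a passage to the limit. -/
theorem latSum_eq (hϖ : IsCarlitzPeriod ϖ) {n : ℕ} (hn : n ≠ 0) {x : CInf F}
    (hx : x ∉ Set.range (ofPoly F)) :
    latSum (ofPoly F) n x = ϖ ^ n * (gossPoly F n).eval (tFun ϖ x) := by
  have hx' : ∀ N, ∀ b ∈ box F N, x ≠ ofPoly F b := fun N b _ h => hx ⟨b, h.symm⟩
  have hinj := (isDegreeNorm_ofPoly (F := F)).injective
  refine tendsto_nhds_unique (tendsto_boxSum isDegreeNorm_ofPoly hn x) ?_
  induction n using Nat.strong_induction_on with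
  | _ n ih =>
    rcases (by omega : n = 1 ∨ 2 ≤ n) with rfl | h2
    · rw [gossPoly_one, eval_X, pow_one]
      exact (tendsto_inv_boxExp hϖ hx).congr fun N => (boxSum_one hinj (hx' N)).symm
    · refine Tendsto.congr (fun N => (boxSum_recursion hinj (hx' N) h2).symm) ?_
      have key : ϖ ^ n * (gossPoly F n).eval (tFun ϖ x) = ϖ * tFun ϖ x * ∑ i ∈ Finset.range n,
          if Fintype.card F ^ i < n then (ϖ ^ (Fintype.card F ^ i - 1) * expCoeff F i) *
            (ϖ ^ (n - Fintype.card F ^ i) *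
              (gossPoly F (n - Fintype.card F ^ i)).eval (tFun ϖ x)) else 0 := by
        rw [gossPoly_recursion h2, eval_mul, eval_X, eval_finsetSum, Finset.mul_sum,
          Finset.mul_sum, Finset.mul_sum]
        refine Finset.sum_congr rfl fun i _ => ?_
        split_ifs with hi
        · have hpos : 0 < Fintype.card F ^ i := by positivity
          obtain ⟨j, hj⟩ : ∃ j, Fintype.card F ^ i = j + 1 :=
            ⟨_, (Nat.sub_add_cancel hpos).symm⟩
          have hn' : ϖ ^ n = ϖ * ϖ ^ j * ϖ ^ (n - (j + 1)) := by
            rw [← pow_succ', ← pow_add]; congr 1; omega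
          rw [eval_mul, eval_C, hj, hn', Nat.add_sub_cancel]
          ring
        · simp
      rw [key]
      refine (tendsto_inv_boxExp hϖ hx).mul (tendsto_finsetSum _ fun i _ => ?_)
      split_ifs with hi
      · refine Tendsto.mul ?_ ?_
        · have h3 := tendsto_boxCoeff (isDegreeNorm_ofPoly (F := F)) i
          rwa [limCoeff_eq _ (tendsto_boxKappa_carlitzPeriod hϖ)] at h3
        · have hpos : 0 < Fintype.card F ^ i := by positivity
          exact ih _ (by omega) (by omega)
      · exact tendsto_const_nhds

end Goss

/-! ### Generation of `GL₂(A)` -/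

section EuclideanAlgorithm

variable {F : Type*} [Field F]

/-- The matrix of `z ↦ e - 1 / z`. -/
def transInv (e : F[X]) : GL (Fin 2) F[X] where
  val := !![e, -1; 1, 0]
  inv := !![0, 1; -1, e]
  val_inv := by ext i j; fin_cases i <;> fin_cases j <;> simp [Matrix.mul_apply]
  inv_val := by ext i j; fin_cases i <;> fin_cases j <;> simp [Matrix.mul_apply]

/-- The Euclidean algorithm: a property of matrices in `GL₂(A)` that is stable under left
multiplication by the matrices `transInv e` holds everywhere if it holds for upper triangular
matrices. -/
theorem GL_induction {T : GL (Fin 2) F[X] → Prop} (hupper : ∀ γ, γ 1 0 = 0 → T γ)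
    (hstep : ∀ e γ, T γ → T (transInv e * γ)) (γ : GL (Fin 2) F[X]) : T γ := by
  have key : ∀ (d : ℕ) (γ : GL (Fin 2) F[X]), (γ 1 0).degree < d → T γ := by
    intro d
    induction d with
    | zero =>
      intro γ hγ
      exact hupper γ (degree_eq_bot.1 (by simpa using hγ))
    | succ d ih =>
      intro γ hγ
      by_cases h0 : γ 1 0 = 0
      · exact hupper γ h0
      have h1 : γ = transInv (γ 0 0 / γ 1 0) * ((transInv (γ 0 0 / γ 1 0))⁻¹ * γ) := by
        rw [mul_inv_cancel_left]
      rw [h1]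
      refine hstep _ _ (ih _ ?_)
      have h2 : ((transInv (γ 0 0 / γ 1 0))⁻¹ * γ) 1 0 = -(γ 0 0 % γ 1 0) := by
        have h3 : ((transInv (γ 0 0 / γ 1 0))⁻¹ : GL (Fin 2) F[X]).val =
          !![0, 1; -1, γ 0 0 / γ 1 0] := rfl
        rw [Matrix.GeneralLinearGroup.coe_mul, h3, Matrix.mul_apply, Fin.sum_univ_two]
        have h4 := EuclideanDomain.div_add_mod (γ 0 0) (γ 1 0)
        simp
        linear_combination h4
      rw [h2, degree_neg]
      have h5 : (γ 0 0 % γ 1 0).degree < (γ 1 0).degree := EuclideanDomain.mod_lt _ h0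
      have h6 : (γ 1 0).degree ≤ (d : WithBot ℕ) := by
        rw [degree_eq_natDegree h0] at hγ ⊢
        exact_mod_cast Nat.lt_succ_iff.1 (by exact_mod_cast hγ)
      exact h5.trans_le h6
  refine key ((γ 1 0).natDegree + 1) γ (degree_le_natDegree.trans_lt ?_)
  exact_mod_cast Nat.lt_succ_self _

end EuclideanAlgorithm

/-! ### The action on the upper half plane -/

section UpperHalfPlane

variable {F : Type*} [Field F] [Fintype F]

theorem isSeparated_of_le_imAbs {δ : ℝ} {z : CInf F} (h : δ ≤ imAbs z) :
    IsSeparated (ofPoly F) δ z := by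
  intro a b ha
  have h0 : ofPoly F a ≠ 0 := by
    rw [Ne, map_eq_zero_iff _ (isDegreeNorm_ofPoly (F := F)).injective]; exact ha
  have h1 : imAbs z ≤ dist z (ofPoly F b / ofPoly F a) := by
    refine Metric.infDist_le_dist_of_mem ⟨(algebraMap (RatFunc F) (KInf F) (algebraMap F[X] _ b)) /
      (algebraMap (RatFunc F) (KInf F) (algebraMap F[X] _ a)), ?_⟩
    rw [map_div₀]
    rfl
  have h2 : ofPoly F a * z - ofPoly F b = (z - ofPoly F b / ofPoly F a) * ofPoly F a := by
    field_simp
  rw [h2, norm_mul, ← dist_eq_norm]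
  exact mul_le_mul_of_nonneg_right (h.trans h1) (norm_nonneg _)

theorem imAbs_pos (z : Omega F) : 0 < imAbs z.val :=
  ((isClosed_range_ofKInf F).notMem_iff_infDist_pos (Set.range_nonempty _)).1 z.2

theorem Omega.exists_isSeparated (z : Omega F) :
    ∃ δ, 0 < δ ∧ IsSeparated (ofPoly F) δ z.val :=
  ⟨_, imAbs_pos z, isSeparated_of_le_imAbs le_rfl⟩

theorem ofPoly_mul_not_mem {a : F[X]} (ha : a ≠ 0) (z : Omega F) :
    ofPoly F a * z.val ∉ Set.range (ofPoly F) := by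
  rintro ⟨b, hb⟩
  exact ha (eq_zero_of_isSeparated z.exists_isSeparated isDegreeNorm_ofPoly hb.symm)

theorem denom_ne_zero (γ : GL (Fin 2) F[X]) (z : Omega F) : denom γ z.val ≠ 0 := by
  intro h0
  have := div_not_mem γ z
  rw [h0, div_zero] at this
  exact this ⟨0, map_zero _⟩

theorem num_mul (γ δ : GL (Fin 2) F[X]) (z : Omega F) :
    num (γ * δ) z.val = num γ (moebius δ z).val * denom δ z.val := by
  have h := denom_ne_zero δ z
  have h1 : (moebius δ z).val = num δ z.val / denom δ z.val := rfl
  rw [h1]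
  simp only [num, denom] at h ⊢
  simp only [Matrix.GeneralLinearGroup.coe_mul, Matrix.mul_apply, Fin.sum_univ_two, map_add,
    map_mul]
  field_simp
  ring

theorem denom_mul (γ δ : GL (Fin 2) F[X]) (z : Omega F) :
    denom (γ * δ) z.val = denom γ (moebius δ z).val * denom δ z.val := by
  have h := denom_ne_zero δ z
  have h1 : (moebius δ z).val = num δ z.val / denom δ z.val := rfl
  rw [h1]
  simp only [num, denom] at h ⊢
  simp only [Matrix.GeneralLinearGroup.coe_mul, Matrix.mul_apply, Fin.sum_univ_two, map_add,
    map_mul]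
  field_simp
  ring

theorem moebius_mul (γ δ : GL (Fin 2) F[X]) (z : Omega F) :
    moebius (γ * δ) z = moebius γ (moebius δ z) := by
  apply Subtype.ext
  change num (γ * δ) z.val / denom (γ * δ) z.val =
    num γ (moebius δ z).val / denom γ (moebius δ z).val
  rw [num_mul, denom_mul, mul_div_mul_right _ _ (denom_ne_zero δ z)]

theorem detC_mul (γ δ : GL (Fin 2) F[X]) : detC (γ * δ) = detC γ * detC δ := by
  rw [detC, detC, detC, Matrix.GeneralLinearGroup.coe_mul, Matrix.det_mul, map_mul]

end UpperHalfPlane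

/-! ### Modularity -/

section Modularity

variable {F : Type*} [Field F] [Fintype F] {ϖ : CInf F} {p k n : ℕ}

theorem fTerm_eq (hϖ : IsCarlitzPeriod ϖ) (hn : n ≠ 0) (z : Omega F) (a : Monics F) :
    fTerm ϖ k n z a = (ϖ ^ n)⁻¹ *
      (ofPoly F a.1 ^ (k - n) * latSum (ofPoly F) n (ofPoly F a.1 * z.val)) := by
  rw [latSum_eq hϖ hn (ofPoly_mul_not_mem a.2.ne_zero z), fTerm, mul_left_comm (ofPoly F a.1 ^ _),
    inv_mul_cancel_left₀ (pow_ne_zero n hϖ.1)]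

theorem summable_fTerm (hϖ : IsCarlitzPeriod ϖ) (hn : n ≠ 0) (z : Omega F) :
    Summable (fTerm ϖ k n z) := by
  obtain ⟨δ, hδ, hz⟩ := z.exists_isSeparated
  have h1 := summable_pow_mul_latSum (s := k - n) isDegreeNorm_ofPoly hn hδ hz
  have h2 := (h1.comp_injective (Subtype.val_injective (p := Monic))).mul_left (ϖ ^ n)⁻¹
  exact h2.congr fun a => (fTerm_eq hϖ hn z a).symm

theorem const_pow_eq_one {c : F} (hc : c ≠ 0) {j : ℕ} (hj : Fintype.card F - 1 ∣ j) :
    c ^ j = 1 := by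
  obtain ⟨i, rfl⟩ := hj
  rw [pow_mul, FiniteField.pow_card_sub_one_eq_one c hc, one_pow]

theorem const_zpow_eq_one {c : F} (hc : c ≠ 0) {j : ℤ} (hj : (Fintype.card F : ℤ) - 1 ∣ j) :
    c ^ j = 1 := by
  obtain ⟨i, rfl⟩ := hj
  have h : (Fintype.card F : ℤ) - 1 = ((Fintype.card F - 1 : ℕ) : ℤ) := by
    rw [Nat.cast_sub Fintype.card_pos, Nat.cast_one]
  rw [h, zpow_mul, zpow_natCast, FiniteField.pow_card_sub_one_eq_one c hc, one_zpow]

/-- By the identity of Goss, `f_{k,n}` is a constant multiple of the double sum over all of `A`. -/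
theorem fSeries_eq (hϖ : IsCarlitzPeriod ϖ) (hn : n ≠ 0) (hk : 2 * n < k)
    (hdvd : Fintype.card F - 1 ∣ k - 2 * n) (z : Omega F) :
    fSeries ϖ k n z = -(ϖ ^ n)⁻¹ * doubleSum (ofPoly F) (k - n) n z.val := by
  obtain ⟨δ, hδ, hz⟩ := z.exists_isSeparated
  have h1 := summable_pow_mul_latSum (s := k - n) isDegreeNorm_ofPoly hn hδ hz
  have h2 : HasSum (fun a : Monics F => ofPoly F a.1 ^ (k - n) *
      latSum (ofPoly F) n (ofPoly F a.1 * z.val)) (ϖ ^ n * fSeries ϖ k n z) := by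
    have h3 := (summable_fTerm (k := k) hϖ hn z).hasSum.mul_left (ϖ ^ n)
    have h4 : ∀ a : Monics F, ϖ ^ n * fTerm ϖ k n z a = ofPoly F a.1 ^ (k - n) *
        latSum (ofPoly F) n (ofPoly F a.1 * z.val) := fun a => by
      rw [fTerm_eq hϖ hn, mul_inv_cancel_left₀ (pow_ne_zero n hϖ.1)]
    simp only [h4] at h3
    exact h3
  have h4 := hasSum_of_monics (g := fun a => ofPoly F a ^ (k - n) *
      latSum (ofPoly F) n (ofPoly F a * z.val)) ?_ ?_ h2 (card_cast_eq_zero (ofPoly F))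
  · rw [doubleSum, h4.tsum_eq]
    have := pow_ne_zero n hϖ.1
    field_simp
  · rw [map_zero, zero_pow (by omega), zero_mul]
  · intro c a hc
    have hc' := const_ne_zero (ofPoly F) hc
    have h5 : ofPoly F (C c) ^ (k - n) = ofPoly F (C c) ^ n := by
      have : k - n = n + (k - 2 * n) := by omega
      rw [this, pow_add, ← map_pow _ _ (k - 2 * n), ← C_pow, const_pow_eq_one hc hdvd]
      simp
    rw [map_mul, mul_pow, mul_assoc, mul_assoc, latSum_const_mul hc, h5]
    have := pow_ne_zero n hc'
    field_simp

/-- The data of `z ↦ e - 1 / z`; the image point is given in the form `-1 / z + e`. -/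
theorem moebius_transInv (e : F[X]) (z : Omega F) :
    num (transInv e) z.val / denom (transInv e) z.val = -z.val⁻¹ + ofPoly F e ∧
      denom (transInv e) z.val = z.val ∧ detC (transInv e) = 1 := by
  have h1 : denom (transInv e) z.val = z.val := by
    simp [denom, transInv]
  have hz : z.val ≠ 0 := h1 ▸ denom_ne_zero (transInv e) z
  refine ⟨?_, h1, ?_⟩
  · rw [h1]
    have : num (transInv e) z.val = ofPoly F e * z.val - 1 := by
      simp [num, transInv, sub_eq_add_neg]
    rw [this]
    field_simp
    ring
  · simp [detC, transInv, Matrix.det_fin_two]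

/-- The double sum transforms like a modular form of weight `k` and type `n`. By the Euclidean
algorithm it suffices to treat upper triangular matrices and the maps `z ↦ e - 1 / z`. -/
theorem doubleSum_transform [Fact p.Prime] [CharP F p]
    (hA : Admissible p (Fintype.card F) k n) {m : ℤ}
    (hm : m ≡ n [ZMOD ((Fintype.card F : ℤ) - 1)]) (γ : GL (Fin 2) F[X]) (z : Omega F) :
    doubleSum (ofPoly F) (k - n) n (moebius γ z).val =
      denom γ z.val ^ k * detC γ ^ (-m) * doubleSum (ofPoly F) (k - n) n z.val := by
  obtain ⟨-, hn, hk, hdvd, hle⟩ := hA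
  have : CharP (CInf F) p := charP_of_injective_ringHom ((ofPoly F).comp C).injective p
  revert z
  induction γ using GL_induction with
  | hupper γ h0 =>
    intro z
    -- the diagonal entries `α`, `β` are nonzero constants, and `z` is mapped to `(α / β) z + b`
    have hdet : IsUnit (γ 0 0 * γ 1 1) := by
      have := (Matrix.isUnit_iff_isUnit_det _).1 γ.isUnit
      rwa [Matrix.det_fin_two, h0, mul_zero, sub_zero] at this
    obtain ⟨α, hα, h00⟩ := Polynomial.isUnit_iff.1 (isUnit_of_mul_isUnit_left hdet)
    obtain ⟨β, hβ, h11⟩ := Polynomial.isUnit_iff.1 (isUnit_of_mul_isUnit_right hdet)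
    have hα' := const_ne_zero (ofPoly F) hα.ne_zero
    have hβ' := const_ne_zero (ofPoly F) hβ.ne_zero
    have h1 : (moebius γ z).val = ofPoly F (C (α / β)) * z.val + ofPoly F (C β⁻¹ * γ 0 1) := by
      have hCβ : ofPoly F (C β⁻¹) = (ofPoly F (C β))⁻¹ :=
        map_inv₀ ((ofPoly F).comp C) β
      change num γ z.val / denom γ z.val = _
      rw [num, denom, h0, ← h00, ← h11, div_eq_mul_inv α, C_mul, map_mul, map_mul, hCβ, map_zero,
        zero_mul, zero_add]
      field_simp
    have h2 : denom γ z.val = ofPoly F (C β) := by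
      rw [denom, h0, ← h11, map_zero, zero_mul, zero_add]
    have h3 : detC γ = ofPoly F (C (α * β)) := by
      rw [detC, Matrix.det_fin_two, h0, mul_zero, sub_zero, ← h00, ← h11, C_mul]
    rw [h1, doubleSum_add, doubleSum_const_mul (div_ne_zero hα.ne_zero hβ.ne_zero), h2, h3]
    congr 1
    -- this holds in `F` because `q - 1` divides both `k - 2 n` and `n - m`
    have h4 : ((α / β) ^ (k - n))⁻¹ = β ^ k * (α * β) ^ (-m) := by
      have hqk : (Fintype.card F : ℤ) - 1 ∣ (k : ℤ) - 2 * n := by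
        have := Int.natCast_dvd_natCast.2 hdvd
        rwa [Nat.cast_sub Fintype.card_pos, Nat.cast_sub hk.le, Nat.cast_mul] at this
      have ha : α ^ ((k - n : ℕ) + (-m) : ℤ) = 1 := by
        refine const_zpow_eq_one hα.ne_zero ?_
        have h6 : ((k - n : ℕ) + (-m) : ℤ) = (k - 2 * n) + (n - m) := by
          rw [Nat.cast_sub (by omega)]; ring
        rw [h6]
        exact dvd_add hqk hm.dvd
      have hb : β ^ ((n : ℤ) + (-m)) = 1 := const_zpow_eq_one hβ.ne_zero hm.dvd
      rw [zpow_add₀ hα.ne_zero, zpow_natCast] at ha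
      rw [zpow_add₀ hβ.ne_zero, zpow_natCast] at hb
      have hβk : β ^ k = β ^ (k - n) * β ^ n := by rw [← pow_add]; congr 1; omega
      rw [mul_zpow, hβk, div_pow, inv_div, div_eq_iff (pow_ne_zero _ hα.ne_zero)]
      linear_combination -β ^ (k - n) * β ^ n * β ^ (-m) * ha - β ^ (k - n) * hb
    have h5 := congrArg ((ofPoly F).comp C) h4
    rw [map_inv₀, map_mul, map_pow, map_pow, map_zpow₀] at h5
    exact h5
  | hstep e γ ih =>
    intro z
    obtain ⟨h1, h2, h3⟩ := moebius_transInv e (moebius γ z)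
    rw [moebius_mul, detC_mul, denom_mul, h2, h3, one_mul, mul_pow]
    have h4 : (moebius (transInv e) (moebius γ z)).val = -(moebius γ z).val⁻¹ + ofPoly F e := h1
    set w := moebius γ z
    have h5 : (-w.val⁻¹ : CInf F) = (moebius (transInv 0) w).val := by
      have := (moebius_transInv 0 w).1
      rw [map_zero, add_zero] at this
      exact this.symm
    have hkn : k - n ≠ 0 := by omega
    -- the inversion is applied with the power `p ^ v_p(k - n)` of `p`, which is at least `n`
    obtain ⟨j, hj⟩ := pow_padicValNat_dvd (p := p) (n := k - n)
    rw [h4, doubleSum_add, hj, doubleSum_neg_inv isDegreeNorm_ofPoly hn.ne' hle (by omega)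
      w.exists_isSeparated (h5 ▸ (moebius (transInv 0) w).exists_isSeparated), ← hj, ih,
      Nat.sub_add_cancel (by omega)]
    ring

theorem isHolomorphic_fSeries (hϖ : IsCarlitzPeriod ϖ) (hn : n ≠ 0) (hk : 2 * n < k)
    (hdvd : Fintype.card F - 1 ∣ k - 2 * n) : IsHolomorphic (fSeries ϖ k n) := by
  intro N ε hε
  have hq := card_real_pos F
  have hδ : (0 : ℝ) < ((Fintype.card F : ℝ) ^ N)⁻¹ := by positivity
  have hϖn : 0 < ‖ϖ ^ n‖ := norm_pos_iff.2 (pow_ne_zero n hϖ.1)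
  obtain ⟨M, hM⟩ := exists_norm_squareSum_sub_le (s := k - n) (isDegreeNorm_ofPoly (F := F)) hn hδ
    (half_pos (mul_pos hε hϖn)) ((Fintype.card F : ℝ) ^ N)
  obtain ⟨P, Q, hPQ⟩ := (isRationalOn_squareSum (isDegreeNorm_ofPoly (F := F)) hδ
    (s := k - n) (by omega) M n).const_mul (-(ϖ ^ n)⁻¹)
  refine ⟨P, Q, fun z hz => ?_⟩
  have hsep := isSeparated_of_le_imAbs hz.2
  obtain ⟨h1, h2⟩ := hPQ z.val hsep
  refine ⟨h1, ?_⟩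
  rw [← h2, fSeries_eq hϖ hn hk hdvd, ← mul_sub, norm_mul, norm_neg, norm_inv, norm_sub_rev,
    inv_mul_lt_iff₀ hϖn]
  refine (hM M le_rfl z.val hsep hz.1).trans_lt ?_
  rw [mul_comm]
  exact half_lt_self (mul_pos hϖn hε)

theorem fSeries_transform [Fact p.Prime] [CharP F p] (hϖ : IsCarlitzPeriod ϖ)
    (hA : Admissible p (Fintype.card F) k n) {m : ℤ}
    (hm : m ≡ n [ZMOD ((Fintype.card F : ℤ) - 1)]) (γ : GL (Fin 2) F[X]) (z : Omega F) :
    fSeries ϖ k n (moebius γ z) = denom γ z.val ^ k * detC γ ^ (-m) * fSeries ϖ k n z := by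
  rw [fSeries_eq hϖ hA.n_pos.ne' hA.two_mul_lt hA.dvd, doubleSum_transform hA hm,
    fSeries_eq hϖ hA.n_pos.ne' hA.two_mul_lt hA.dvd]
  ring

end Modularity

/-! ### Evaluation of power series -/

section PowerSeriesEvaluation

variable {K : Type*} [NormedField K]

/-- The power series `P` converges absolutely at `t`, with value `x`. -/
def HasEval (P : PowerSeries K) (t x : K) : Prop :=
  (Summable fun j : ℕ => ‖PowerSeries.coeff j P * t ^ j‖) ∧
    HasSum (fun j : ℕ => PowerSeries.coeff j P * t ^ j) x

theorem HasEval.add {P Q : PowerSeries K} {t x y : K} (hP : HasEval P t x) (hQ : HasEval Q t y) :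
    HasEval (P + Q) t (x + y) := by
  simp only [HasEval, map_add, add_mul]
  exact ⟨(hP.1.add hQ.1).of_nonneg_of_le (fun _ => norm_nonneg _) fun _ => norm_add_le _ _,
    hP.2.add hQ.2⟩

theorem hasEval_of_finite {P : PowerSeries K} {t x : K} (s : Finset ℕ)
    (hs : ∀ j ∉ s, PowerSeries.coeff j P = 0) (hx : ∑ j ∈ s, PowerSeries.coeff j P * t ^ j = x) :
    HasEval P t x := by
  refine ⟨summable_of_ne_finset_zero (s := s) fun j hj => by simp [hs j hj], ?_⟩
  rw [← hx]
  exact hasSum_sum_of_ne_finset_zero fun j hj => by simp [hs j hj]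

theorem hasEval_coe (P : K[X]) (t : K) : HasEval (P : PowerSeries K) t (P.eval t) := by
  refine hasEval_of_finite (Finset.range (P.natDegree + 1)) (fun j hj => ?_) ?_
  · rw [Polynomial.coeff_coe]
    exact coeff_eq_zero_of_natDegree_lt (by simpa using hj)
  · simp only [Polynomial.coeff_coe, eval_eq_sum_range]

theorem HasEval.const_smul {P : PowerSeries K} {t x : K} (hP : HasEval P t x) (c : K) :
    HasEval (c • P) t (c * x) := by
  simp only [HasEval, PowerSeries.coeff_smul, smul_eq_mul, mul_assoc, norm_mul c]
  exact ⟨hP.1.mul_left _, hP.2.mul_left c⟩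

theorem HasEval.unique {P : PowerSeries K} {t x y : K} (hx : HasEval P t x) (hy : HasEval P t y) :
    x = y := hx.2.unique hy.2

/-- The `j`-th coefficient of `P` is bounded by `R ^ j`. -/
def CoeffBound (R : ℝ) (P : PowerSeries K) : Prop := ∀ j, ‖PowerSeries.coeff j P‖ ≤ R ^ j

theorem CoeffBound.norm_le {R : ℝ} {P : PowerSeries K} (hP : CoeffBound R P) (t : K) (j : ℕ) :
    ‖PowerSeries.coeff j P * t ^ j‖ ≤ (R * ‖t‖) ^ j := by
  rw [norm_mul, norm_pow, mul_pow]
  exact mul_le_mul_of_nonneg_right (hP j) (by positivity)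

theorem coeffBound_one {R : ℝ} (hR : 0 ≤ R) : CoeffBound R (1 : PowerSeries K) := by
  intro j
  rw [PowerSeries.coeff_one]
  split_ifs with h
  · simp [h]
  · rw [norm_zero]; positivity

variable [CompleteSpace K]

theorem HasEval.mul {P Q : PowerSeries K} {t x y : K} (hP : HasEval P t x) (hQ : HasEval Q t y) :
    HasEval (P * Q) t (x * y) := by
  obtain ⟨f, hf⟩ : ∃ f : ℕ → K, ∀ j, f j = PowerSeries.coeff j P * t ^ j := ⟨_, fun _ => rfl⟩
  obtain ⟨g, hg⟩ : ∃ g : ℕ → K, ∀ j, g j = PowerSeries.coeff j Q * t ^ j := ⟨_, fun _ => rfl⟩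
  have h : ∀ j, PowerSeries.coeff j (P * Q) * t ^ j =
      ∑ kl ∈ Finset.HasAntidiagonal.antidiagonal j, f kl.1 * g kl.2 := by
    intro j
    rw [PowerSeries.coeff_mul, Finset.sum_mul]
    refine Finset.sum_congr rfl fun kl hkl => ?_
    rw [hf, hg, ← Finset.HasAntidiagonal.mem_antidiagonal.1 hkl, pow_add]
    ring
  simp only [HasEval, ← hf] at hP
  simp only [HasEval, ← hg] at hQ
  have h1 := summable_norm_sum_mul_antidiagonal_of_summable_norm hP.1 hQ.1
  have h2 := tsum_mul_tsum_eq_tsum_sum_antidiagonal_of_summable_norm hP.1 hQ.1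
  rw [hP.2.tsum_eq, hQ.2.tsum_eq] at h2
  simp only [HasEval, h]
  exact ⟨h1, h2 ▸ h1.of_norm.hasSum⟩

theorem HasEval.pow {P : PowerSeries K} {t x : K} (hP : HasEval P t x) (n : ℕ) :
    HasEval (P ^ n) t (x ^ n) := by
  induction n with
  | zero => simpa using hasEval_coe (1 : K[X]) t
  | succ n ih => rw [pow_succ, pow_succ]; exact ih.mul hP

theorem HasEval.aeval {P : PowerSeries K} {t x : K} (hP : HasEval P t x) (G : K[X]) :
    HasEval (aeval P G) t (G.eval x) := by
  induction G using Polynomial.induction_on' with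
  | add G H hG hH => rw [map_add, eval_add]; exact hG.add hH
  | monomial n c =>
    rw [aeval_monomial, eval_monomial, ← Algebra.smul_def]
    exact (hP.pow n).const_smul c

theorem CoeffBound.exists_hasEval {R : ℝ} (hR : 0 ≤ R) {P : PowerSeries K} (hP : CoeffBound R P)
    {t : K} (ht : R * ‖t‖ < 1) : ∃ x, HasEval P t x := by
  have h : Summable fun j : ℕ => ‖PowerSeries.coeff j P * t ^ j‖ :=
    (summable_geometric_of_lt_one (by positivity) ht).of_nonneg_of_le (fun _ => norm_nonneg _)
      (hP.norm_le t)
  exact ⟨_, h, h.of_norm.hasSum⟩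

end PowerSeriesEvaluation

/-! ### Geometric bounds for coefficients -/

section CoefficientBounds

variable {K : Type*} [NormedField K] [IsUltrametricDist K]

theorem CoeffBound.mul {R : ℝ} (hR : 0 ≤ R) {P Q : PowerSeries K} (hP : CoeffBound R P)
    (hQ : CoeffBound R Q) : CoeffBound R (P * Q) := by
  intro j
  rw [PowerSeries.coeff_mul]
  refine IsUltrametricDist.norm_sum_le_of_forall_le_of_nonneg (by positivity) fun kl hkl => ?_
  rw [norm_mul, ← Finset.HasAntidiagonal.mem_antidiagonal.1 hkl, pow_add]
  exact mul_le_mul (hP _) (hQ _) (norm_nonneg _) (by positivity)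

theorem CoeffBound.pow {R : ℝ} (hR : 0 ≤ R) {P : PowerSeries K} (hP : CoeffBound R P) (n : ℕ) :
    CoeffBound R (P ^ n) := by
  induction n with
  | zero => rw [pow_zero]; exact coeffBound_one hR
  | succ n ih => rw [pow_succ]; exact ih.mul hR hP

theorem CoeffBound.inv {R : ℝ} (hR : 0 ≤ R) {P : PowerSeries K} (hP : CoeffBound R P)
    (h1 : PowerSeries.constantCoeff P = 1) : CoeffBound R P⁻¹ := by
  intro j
  induction j using Nat.strong_induction_on with
  | _ j ih =>
    rw [PowerSeries.coeff_inv, h1]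
    split_ifs with hj
    · simp [hj]
    · rw [inv_one, norm_mul, norm_neg, norm_one, one_mul]
      refine IsUltrametricDist.norm_sum_le_of_forall_le_of_nonneg (by positivity) fun kl hkl => ?_
      split_ifs with hlt
      · rw [norm_mul, ← Finset.HasAntidiagonal.mem_antidiagonal.1 hkl, pow_add]
        exact mul_le_mul (hP _) (ih _ hlt) (norm_nonneg _) (by positivity)
      · rw [norm_zero]; positivity

/-- A bound for the coefficients of `G(P)` that depends only on `G` and on the bound for `P`. -/
theorem CoeffBound.norm_coeff_aeval_le {R : ℝ} (hR : 0 ≤ R) {P : PowerSeries K}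
    (hP : CoeffBound R P) (G : K[X]) (j : ℕ) :
    ‖PowerSeries.coeff j (Polynomial.aeval P G)‖ ≤
      (∑ i ∈ Finset.range (G.natDegree + 1), ‖G.coeff i‖) * R ^ j := by
  rw [aeval_eq_sum_range, map_sum]
  refine (norm_sum_le _ _).trans ?_
  rw [Finset.sum_mul]
  refine Finset.sum_le_sum fun i _ => ?_
  rw [PowerSeries.coeff_smul, smul_eq_mul, norm_mul]
  exact mul_le_mul_of_nonneg_left (hP.pow hR i j) (norm_nonneg _)

end CoefficientBounds

/-! ### Gauss norms of polynomials -/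

section GaussNorm

variable {K : Type*} [NormedField K]

/-- The degree of `P` is at most `N`, and its Gauss norm of radius `R` at most `R ^ N`; that is, the
coefficients of the reflected polynomial `X ^ N * P (1 / X)` satisfy `CoeffBound R`. -/
def GaussBound (R : ℝ) (N : ℕ) (P : K[X]) : Prop :=
  P.natDegree ≤ N ∧ ∀ m, ‖P.coeff m‖ * R ^ m ≤ R ^ N

theorem GaussBound.mono {R : ℝ} (hR : 1 ≤ R) {N M : ℕ} (h : N ≤ M) {P : K[X]}
    (hP : GaussBound R N P) : GaussBound R M P :=
  ⟨hP.1.trans h, fun m => (hP.2 m).trans (pow_le_pow_right₀ hR h)⟩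

theorem gaussBound_zero {R : ℝ} (hR : 1 ≤ R) (N : ℕ) : GaussBound R N (0 : K[X]) := by
  refine ⟨by simp, fun m => ?_⟩
  rw [coeff_zero, norm_zero, zero_mul]; positivity

theorem gaussBound_C {R : ℝ} (hR : 1 ≤ R) {N : ℕ} {c : K} (hc : ‖c‖ ≤ R ^ N) :
    GaussBound R N (C c) := by
  refine ⟨by simp, fun m => ?_⟩
  rw [coeff_C]
  split_ifs with h
  · simpa [h] using hc
  · rw [norm_zero, zero_mul]; positivity

theorem gaussBound_X {R : ℝ} (hR : 1 ≤ R) : GaussBound R 1 (X : K[X]) := by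
  refine ⟨natDegree_X_le, fun m => ?_⟩
  rw [coeff_X]
  split_ifs with h
  · simp [← h]
  · rw [norm_zero, zero_mul]; positivity

theorem GaussBound.coeffBound_reflect {R : ℝ} (hR : 1 ≤ R) {N : ℕ} {P : K[X]}
    (hP : GaussBound R N P) : CoeffBound R ((P.reflect N : K[X]) : PowerSeries K) := by
  intro j
  rw [Polynomial.coeff_coe, coeff_reflect]
  rcases le_or_gt j N with hj | hj
  · rw [revAt_le hj]
    have h1 := hP.2 (N - j)
    have h2 : R ^ N = R ^ j * R ^ (N - j) := by rw [← pow_add]; congr 1; omega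
    rw [h2] at h1
    exact le_of_mul_le_mul_right h1 (by positivity)
  · rw [revAt_eq_self_of_lt hj, coeff_eq_zero_of_natDegree_lt (hP.1.trans_lt hj), norm_zero]
    positivity

variable [IsUltrametricDist K]

theorem GaussBound.add {R : ℝ} (hR : 1 ≤ R) {N : ℕ} {P Q : K[X]} (hP : GaussBound R N P)
    (hQ : GaussBound R N Q) : GaussBound R N (P + Q) := by
  refine ⟨(natDegree_add_le _ _).trans (max_le hP.1 hQ.1), fun m => ?_⟩
  have hRm : 0 < R ^ m := by positivity
  rw [coeff_add, ← le_div_iff₀ hRm]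
  refine (IsUltrametricDist.norm_add_le_max _ _).trans (max_le ?_ ?_)
  · rw [le_div_iff₀ hRm]; exact hP.2 m
  · rw [le_div_iff₀ hRm]; exact hQ.2 m

theorem GaussBound.mul {R : ℝ} (hR : 1 ≤ R) {N M : ℕ} {P Q : K[X]} (hP : GaussBound R N P)
    (hQ : GaussBound R M Q) : GaussBound R (N + M) (P * Q) := by
  refine ⟨natDegree_mul_le.trans (add_le_add hP.1 hQ.1), fun m => ?_⟩
  have hRm : 0 < R ^ m := by positivity
  rw [coeff_mul, ← le_div_iff₀ hRm]
  refine IsUltrametricDist.norm_sum_le_of_forall_le_of_nonneg (by positivity) fun kl hkl => ?_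
  rw [le_div_iff₀ hRm, norm_mul, ← Finset.HasAntidiagonal.mem_antidiagonal.1 hkl, pow_add, pow_add,
    mul_mul_mul_comm]
  exact mul_le_mul (hP.2 _) (hQ.2 _) (by positivity) (by positivity)

theorem GaussBound.pow {R : ℝ} (hR : 1 ≤ R) {N : ℕ} {P : K[X]} (hP : GaussBound R N P) (n : ℕ) :
    GaussBound R (N * n) (P ^ n) := by
  induction n with
  | zero => simpa using gaussBound_C hR (c := (1 : K)) (N := 0) (by simp)
  | succ n ih => rw [pow_succ, mul_add, mul_one]; exact ih.mul hR hP

theorem GaussBound.sum {R : ℝ} (hR : 1 ≤ R) {N : ℕ} {α : Type*} (s : Finset α) {f : α → K[X]}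
    (hf : ∀ i ∈ s, GaussBound R N (f i)) : GaussBound R N (∑ i ∈ s, f i) :=
  Finset.sum_induction f (GaussBound R N) (fun _ _ => GaussBound.add hR) (gaussBound_zero hR N) hf

end GaussNorm

/-! ### The Carlitz module and the series `t_a` -/

section CarlitzModule

variable {F : Type*} [Field F] [Fintype F]

theorem carlitzT_comp (P : (CInf F)[X]) :
    (carlitzT F).comp P = C (ofPoly F X) * P + P ^ Fintype.card F := by
  simp [carlitzT]

/-- The iterates of `ρ_T` are monic and, at radius `q`, of Gauss norm dominated by their leading
term, because `|T| q ≤ q^q`. -/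
theorem gaussBound_carlitz_iterate (i : ℕ) :
    GaussBound (Fintype.card F : ℝ) (Fintype.card F ^ i) ((carlitzT F).comp^[i] X) ∧
      ((carlitzT F).comp^[i] X).coeff (Fintype.card F ^ i) = 1 := by
  have hq := (one_lt_card_real F).le
  have hq' : 1 < Fintype.card F := Fintype.one_lt_card
  induction i with
  | zero => exact ⟨by simpa using gaussBound_X hq, by simp⟩
  | succ i ih =>
    obtain ⟨h1, h2⟩ := ih
    have hlt : Fintype.card F ^ i < Fintype.card F ^ (i + 1) := Nat.pow_lt_pow_succ hq'
    rw [Function.iterate_succ_apply', carlitzT_comp]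
    constructor
    · refine GaussBound.add hq ?_ ?_
      · have hT : GaussBound (Fintype.card F : ℝ) 1 (C (ofPoly F X)) :=
          gaussBound_C hq (by rw [norm_ofPoly_X, pow_one])
        exact (hT.mul hq h1).mono hq (by omega)
      · rw [pow_succ]
        exact h1.pow hq _
    · rw [coeff_add, coeff_C_mul, coeff_eq_zero_of_natDegree_lt (h1.1.trans_lt hlt), mul_zero,
        zero_add, pow_succ', coeff_pow_card_mul (ofPoly F), h2, one_pow]

theorem gaussBound_carlitzModule (a : F[X]) :
    GaussBound (Fintype.card F : ℝ) (Fintype.card F ^ a.natDegree) (carlitzModule F a) := by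
  have hq := (one_lt_card_real F).le
  rw [carlitzModule, Polynomial.sum_def]
  refine GaussBound.sum hq _ fun i hi => ?_
  have h1 : GaussBound (Fintype.card F : ℝ) 0 (C (ofPoly F (C (a.coeff i)))) :=
    gaussBound_C hq (by
      rw [isDegreeNorm_ofPoly.norm_const (mem_support_iff.1 hi), pow_zero])
  have h2 := h1.mul hq (gaussBound_carlitz_iterate i).1
  rw [zero_add] at h2
  exact h2.mono hq (Nat.pow_le_pow_right Fintype.card_pos (le_natDegree_of_mem_supp i hi))

theorem coeff_carlitzModule {a : F[X]} (ha : a.Monic) :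
    (carlitzModule F a).coeff (Fintype.card F ^ a.natDegree) = 1 := by
  have hq' : 1 < Fintype.card F := Fintype.one_lt_card
  rw [carlitzModule, Polynomial.sum_def, finsetSum_coeff, Finset.sum_eq_single a.natDegree]
  · rw [coeff_C_mul, (gaussBound_carlitz_iterate a.natDegree).2, ha.coeff_natDegree]
    simp
  · intro i hi hne
    have hlt : i < a.natDegree := lt_of_le_of_ne (le_natDegree_of_mem_supp i hi) hne
    rw [coeff_C_mul, coeff_eq_zero_of_natDegree_lt (p := (carlitzT F).comp^[i] X), mul_zero]
    exact (gaussBound_carlitz_iterate i).1.1.trans_lt (Nat.pow_lt_pow_right hq' hlt)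
  · intro h
    rw [mem_support_iff, ha.coeff_natDegree, not_not] at h
    exact absurd h one_ne_zero

theorem eval_carlitz_iterate (i : ℕ) (y : CInf F) :
    ((carlitzT F).comp^[i] X).eval (carlitzExp F y) = carlitzExp F (ofPoly F X ^ i * y) := by
  induction i with
  | zero => simp
  | succ i ih =>
    rw [Function.iterate_succ_apply', carlitzT_comp, eval_add, eval_mul, eval_pow, eval_C, ih,
      pow_succ', mul_assoc]
    exact (expOf_X_mul isDegreeNorm_ofPoly _).symm

/-- The functional equation `e(a y) = ρ_a(e(y))`. -/
theorem eval_carlitzModule (a : F[X]) (y : CInf F) :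
    (carlitzModule F a).eval (carlitzExp F y) = carlitzExp F (ofPoly F a * y) := by
  rw [carlitzModule, Polynomial.sum_def, eval_finsetSum]
  simp only [eval_mul, eval_C, eval_carlitz_iterate]
  conv_rhs => rw [a.as_sum_support_C_mul_X_pow, map_sum, Finset.sum_mul]
  let φ : CInf F →+ CInf F :=
    { toFun := carlitzExp F, map_zero' := expOf_zero, map_add' := expOf_add isDegreeNorm_ofPoly }
  have h := map_sum φ (fun i => ofPoly F (C (a.coeff i) * X ^ i) * y) a.support
  refine Eq.trans (Finset.sum_congr rfl fun i _ => ?_) h.symm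
  rw [map_mul (ofPoly F), map_pow, mul_assoc]
  exact (expOf_const_mul _ _).symm

/-- The bound is independent of `a`; it comes from the Gauss norm of `ρ_a` of radius `q = |T|`. -/
theorem coeffBound_tSeries {a : F[X]} (ha : a.Monic) :
    CoeffBound (Fintype.card F : ℝ) (tSeries a) ∧
    PowerSeries.X ^ Fintype.card F ^ a.natDegree ∣ tSeries a := by
  have hq := (one_lt_card_real F).le
  refine ⟨?_, Dvd.intro _ rfl⟩
  have hX : CoeffBound (Fintype.card F : ℝ) (PowerSeries.X : PowerSeries (CInf F)) := by
    intro j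
    rw [PowerSeries.coeff_X]
    split_ifs with h
    · simpa [h] using hq
    · rw [norm_zero]; positivity
  refine (hX.pow (by positivity) _).mul (by positivity)
    (((gaussBound_carlitzModule a).coeffBound_reflect hq).inv (by positivity) ?_)
  rw [← PowerSeries.coeff_zero_eq_constantCoeff_apply, Polynomial.coeff_coe, coeff_reflect,
    revAt_le (Nat.zero_le _), Nat.sub_zero, coeff_carlitzModule ha]

/-- `t_a`, evaluated at `t(z)`, is `t(a z)`. -/
theorem hasEval_tSeries {ϖ z : CInf F} (hz : carlitzExp F (ϖ * z) ≠ 0) {a : F[X]} (ha : a.Monic)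
    (ht : (Fintype.card F : ℝ) * ‖tFun ϖ z‖ < 1) :
    HasEval (tSeries a) (tFun ϖ z) (tFun ϖ (ofPoly F a * z)) := by
  have hq := (one_lt_card_real F).le
  set N := Fintype.card F ^ a.natDegree with hN
  set U : (CInf F)[X] := (carlitzModule F a).reflect N with hU
  have ht0 : tFun ϖ z ≠ 0 := inv_ne_zero hz
  have hU1 : PowerSeries.constantCoeff (U : PowerSeries (CInf F)) = 1 := by
    rw [← PowerSeries.coeff_zero_eq_constantCoeff_apply, Polynomial.coeff_coe, coeff_reflect,
      revAt_le (Nat.zero_le _), Nat.sub_zero, coeff_carlitzModule ha]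
  obtain ⟨y, hy⟩ := (((gaussBound_carlitzModule a).coeffBound_reflect hq).inv (by positivity)
    hU1).exists_hasEval (by positivity) ht
  -- the value of the inverse series is the inverse of the value of `U`
  have h1 : U.eval (tFun ϖ z) * y = 1 := by
    have h2 := (hasEval_coe U (tFun ϖ z)).mul hy
    rw [PowerSeries.mul_inv_cancel _ (by rw [hU1]; exact one_ne_zero)] at h2
    refine h2.unique ?_
    simpa using hasEval_coe (1 : (CInf F)[X]) (tFun ϖ z)
  have h3 : HasEval (tSeries a) (tFun ϖ z) (tFun ϖ z ^ N * y) := by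
    refine HasEval.mul ?_ hy
    simpa using hasEval_coe ((X : (CInf F)[X]) ^ N) (tFun ϖ z)
  have h4 : U.eval (tFun ϖ z) = carlitzExp F (ϖ * (ofPoly F a * z)) * tFun ϖ z ^ N := by
    let _ := invertibleOfNonzero hz
    have h := eval₂_reflect_mul_pow (RingHom.id (CInf F)) (carlitzExp F (ϖ * z)) N
      (carlitzModule F a) (gaussBound_carlitzModule a).1
    rw [invOf_eq_inv, eval₂_id, eval₂_id, eval_carlitzModule] at h
    rw [mul_left_comm, ← h, tFun, inv_pow, mul_inv_cancel_right₀ (pow_ne_zero N hz)]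
  have h5 : tFun ϖ z ^ N * y = tFun ϖ (ofPoly F a * z) := by
    refine eq_inv_of_mul_eq_one_left ?_
    rw [← h1, h4]
    ring
  exact h5 ▸ h3

end CarlitzModule

/-! ### The `t`-expansion -/

section TExpansion

variable {F : Type*} [Field F] [Fintype F] {ϖ : CInf F} {k n : ℕ}

/-- `|t(z)|` is at most `1 / (|ϖ| |z|_i)`. -/
theorem norm_tFun_le (hϖ : IsCarlitzPeriod ϖ) (z : Omega F) :
    ‖tFun ϖ z.val‖ ≤ (‖ϖ‖ * imAbs z.val)⁻¹ := by
  have h1 := tendsto_boxExp_expOf isDegreeNorm_ofPoly hϖ.1 (tendsto_boxKappa_carlitzPeriod hϖ) z.val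
  have hϖ0 : 0 < ‖ϖ‖ := norm_pos_iff.2 hϖ.1
  have h2 : imAbs z.val ≤ ‖ϖ⁻¹ * carlitzExp F (ϖ * z.val)‖ := by
    refine ge_of_tendsto h1.norm (Eventually.of_forall fun N => ?_)
    refine le_norm_boxExp' isDegreeNorm_ofPoly (imAbs_pos z).le fun b _ => ?_
    have := isSeparated_of_le_imAbs (z := z.val) le_rfl 1 b one_ne_zero
    simpa using this
  rw [tFun, norm_inv]
  refine inv_anti₀ (mul_pos hϖ0 (imAbs_pos z)) ?_
  rw [norm_mul, norm_inv, inv_mul_eq_div, le_div_iff₀ hϖ0] at h2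
  rwa [mul_comm]

theorem exists_norm_tFun_le (hϖ : IsCarlitzPeriod ϖ) {η : ℝ} (hη : 0 < η) :
    ∃ r : ℝ, ∀ z : Omega F, r ≤ imAbs z.val → ‖tFun ϖ z.val‖ ≤ η := by
  have hϖ0 : 0 < ‖ϖ‖ := norm_pos_iff.2 hϖ.1
  refine ⟨η⁻¹ / ‖ϖ‖, fun z hz => (norm_tFun_le hϖ z).trans ?_⟩
  rw [div_le_iff₀ hϖ0, mul_comm] at hz
  exact inv_le_of_inv_le₀ hη hz

theorem carlitzExp_mul_ne_zero (hϖ : IsCarlitzPeriod ϖ) (z : Omega F) :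
    carlitzExp F (ϖ * z.val) ≠ 0 := by
  have := ofPoly_mul_not_mem one_ne_zero z
  rw [map_one, one_mul] at this
  exact carlitzExp_ne_zero hϖ this

theorem X_dvd_gossPoly (n : ℕ) : X ∣ gossPoly F n := by
  rcases (by omega : n = 0 ∨ n = 1 ∨ 2 ≤ n) with rfl | rfl | h
  · rw [gossPoly_zero]; exact dvd_zero _
  · rw [gossPoly_one]
  · rw [gossPoly_recursion h]; exact dvd_mul_right _ _

/-- The coefficient of `t ^ j` in `c G_n(t_a)` vanishes for `j < q ^ deg a`. -/
theorem coeff_smul_goss_eq_zero (c : CInf F) {a : F[X]} (ha : a.Monic) {j : ℕ}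
    (hj : j < Fintype.card F ^ a.natDegree) :
    PowerSeries.coeff j (c • aeval (tSeries a) (gossPoly F n)) = 0 := by
  have h1 : PowerSeries.X ^ Fintype.card F ^ a.natDegree ∣ aeval (tSeries a) (gossPoly F n) := by
    refine (coeffBound_tSeries ha).2.trans ?_
    have := map_dvd (aeval (tSeries a)) (X_dvd_gossPoly (F := F) n)
    rwa [aeval_X] at this
  rw [PowerSeries.coeff_smul, PowerSeries.X_pow_dvd_iff.1 h1 j hj, smul_zero]

theorem support_coeff_finite (c : Monics F → CInf F) (j : ℕ) :
    (Function.support fun a : Monics F =>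
      PowerSeries.coeff j (c a • aeval (tSeries a.1) (gossPoly F n))).Finite := by
  refine ((box F (j + 1)).finite_toSet.preimage Subtype.val_injective.injOn).subset fun a ha => ?_
  by_contra h
  refine ha (coeff_smul_goss_eq_zero _ a.2 ?_)
  rw [Set.mem_preimage, Finset.mem_coe, mem_box_iff_natDegree a.2.ne_zero] at h
  exact (by omega : j < a.1.natDegree).trans (Nat.lt_pow_self Fintype.one_lt_card)

variable (F) in
/-- The `t`-expansion `∑_a a^(k - n) G_n(t_a)` of `f_{k,n}`, as a sum of power series: each
coefficient is a finite sum by `support_coeff_finite`. -/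
def fExpansion (k n : ℕ) : PowerSeries (CInf F) := PowerSeries.mk fun j =>
  ∑ᶠ a : Monics F, PowerSeries.coeff j
    (ofPoly F a.1 ^ (k - n) • aeval (tSeries a.1) (gossPoly F n))

/-- The terms of the double series `∑_{a, j}` tend to zero: in the `j`-th one only the `a` with
`q ^ deg a ≤ j` contribute, so that `|a|^s` is at most `j ^ s`. -/
theorem summable_expansion (s n : ℕ) {t : CInf F} (ht : (Fintype.card F : ℝ) * ‖t‖ < 1) :
    Summable fun x : Monics F × ℕ => PowerSeries.coeff x.2
      (ofPoly F x.1.1 ^ s • aeval (tSeries x.1.1) (gossPoly F n)) * t ^ x.2 := by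
  have hq := card_real_pos F
  set M := ∑ i ∈ Finset.range ((gossPoly F n).natDegree + 1), ‖(gossPoly F n).coeff i‖ with hM
  have hM0 : 0 ≤ M := Finset.sum_nonneg fun _ _ => norm_nonneg _
  set y := (Fintype.card F : ℝ) * ‖t‖ with hy
  have hy0 : 0 ≤ y := by positivity
  have bound : ∀ x : Monics F × ℕ, Fintype.card F ^ x.1.1.natDegree ≤ x.2 →
      ‖PowerSeries.coeff x.2 (ofPoly F x.1.1 ^ s • aeval (tSeries x.1.1) (gossPoly F n)) *
        t ^ x.2‖ ≤ M * ((x.2 : ℝ) ^ s * y ^ x.2) := by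
    rintro ⟨a, j⟩ hj
    have h1 := (coeffBound_tSeries a.2).1.norm_coeff_aeval_le hq.le (gossPoly F n) j
    have h2 : ‖ofPoly F a.1‖ ≤ j := by
      rw [norm_ofPoly F a.2.ne_zero]; exact_mod_cast hj
    rw [PowerSeries.coeff_smul, smul_eq_mul, norm_mul, norm_mul, norm_pow, norm_pow, hy, mul_pow]
    calc ‖ofPoly F a.1‖ ^ s * ‖PowerSeries.coeff j (aeval (tSeries a.1) (gossPoly F n))‖ * ‖t‖ ^ j
        ≤ (j : ℝ) ^ s * (M * (Fintype.card F : ℝ) ^ j) * ‖t‖ ^ j := by gcongr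
      _ = M * ((j : ℝ) ^ s * ((Fintype.card F : ℝ) ^ j * ‖t‖ ^ j)) := by ring
  refine NonarchimedeanAddGroup.summable_of_tendsto_cofinite_zero ?_
  rw [Metric.tendsto_nhds]
  intro ε hε
  have h0 : Tendsto (fun j : ℕ => M * ((j : ℝ) ^ s * y ^ j)) atTop (𝓝 0) := by
    have := (tendsto_pow_const_mul_const_pow_of_lt_one s hy0 ht).const_mul M
    rwa [mul_zero] at this
  obtain ⟨J, hJ⟩ := eventually_atTop.1 (h0.eventually_lt_const hε)
  rw [eventually_cofinite]
  refine (((box F J).finite_toSet.preimage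
    (Subtype.val_injective (p := Monic)).injOn).prod (Set.finite_lt_nat J)).subset ?_
  rintro ⟨a, j⟩ hx
  rw [Set.mem_ofPred_eq, dist_zero_right, not_lt] at hx
  have h1 : Fintype.card F ^ a.1.natDegree ≤ j := by
    by_contra! h
    rw [coeff_smul_goss_eq_zero _ a.2 h, zero_mul, norm_zero] at hx
    linarith
  have h2 : j < J := by
    by_contra! h
    exact absurd ((hx.trans (bound (a, j) h1)).trans_lt (hJ j h)) (lt_irrefl _)
  refine ⟨?_, h2⟩
  rw [Set.mem_preimage, Finset.mem_coe, mem_box_iff_natDegree a.2.ne_zero]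
  exact ((Nat.lt_pow_self Fintype.one_lt_card).trans_le h1).trans h2

/-- The double series over the monic `a` and the exponents `j`, summed over `j` first, is the series
that defines `f_{k,n}`; summed over `a` first, it is the `t`-expansion. -/
theorem hasTExpansion_fSeries (hϖ : IsCarlitzPeriod ϖ) (k n : ℕ) :
    HasTExpansion ϖ (fSeries ϖ k n) (fExpansion F k n) := by
  have hq := card_real_pos F
  obtain ⟨r, hr⟩ := exists_norm_tFun_le hϖ (η := (2 * (Fintype.card F : ℝ))⁻¹) (by positivity)
  refine ⟨r, fun z hz => ?_⟩
  have ht : (Fintype.card F : ℝ) * ‖tFun ϖ z.val‖ < 1 := by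
    have h1 := mul_le_mul_of_nonneg_left (hr z hz) hq.le
    rw [mul_inv, mul_left_comm, mul_inv_cancel₀ hq.ne'] at h1
    linarith
  have hsum := (summable_expansion (k - n) n ht).hasSum
  have hrow : ∀ a : Monics F, HasSum (fun j => PowerSeries.coeff j
      (ofPoly F a.1 ^ (k - n) • aeval (tSeries a.1) (gossPoly F n)) * tFun ϖ z.val ^ j)
      (fTerm ϖ k n z a) := fun a =>
    (((hasEval_tSeries (carlitzExp_mul_ne_zero hϖ z) a.2 ht).aeval (gossPoly F n)).const_smul
      (ofPoly F a.1 ^ (k - n))).2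
  have hcol : ∀ j : ℕ, HasSum (fun a : Monics F => PowerSeries.coeff j
      (ofPoly F a.1 ^ (k - n) • aeval (tSeries a.1) (gossPoly F n)) * tFun ϖ z.val ^ j)
      (PowerSeries.coeff j (fExpansion F k n) * tFun ϖ z.val ^ j) := fun j => by
    have hfin := support_coeff_finite (n := n) (fun a : Monics F => ofPoly F a.1 ^ (k - n)) j
    have h := (summable_of_hasFiniteSupport (L := .unconditional _) hfin).hasSum
    rw [tsum_eq_finsum (L := .unconditional _) hfin] at h
    rw [fExpansion, PowerSeries.coeff_mk]
    exact h.mul_right _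
  -- the sum of the double series over rows and over columns
  have h1 := hsum.prod_fiberwise hrow
  have h2 := ((Equiv.prodComm ℕ (Monics F)).hasSum_iff.2 hsum).prod_fiberwise hcol
  rw [← h1.tsum_eq] at h2
  exact h2

theorem constantCoeff_fExpansion (k n : ℕ) :
    PowerSeries.constantCoeff (fExpansion F k n) = 0 := by
  rw [← PowerSeries.coeff_zero_eq_constantCoeff_apply, fExpansion, PowerSeries.coeff_mk]
  refine finsum_eq_zero_of_forall_eq_zero fun a => coeff_smul_goss_eq_zero _ a.2 ?_
  exact pow_pos Fintype.card_pos _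

theorem hasAExpansion_fSeries (hϖ : IsCarlitzPeriod ϖ) (k n : ℕ) :
    HasAExpansion ϖ (fSeries ϖ k n) n 0 (fun a => ofPoly F a.1 ^ (k - n)) := by
  refine ⟨fExpansion F k n, hasTExpansion_fSeries hϖ k n, fun j => ⟨support_coeff_finite _ j, ?_⟩⟩
  rw [map_zero, map_zero, zero_add, fExpansion, PowerSeries.coeff_mk]

theorem isCuspForm_fSeries {p : ℕ} [Fact p.Prime] [CharP F p] (hϖ : IsCarlitzPeriod ϖ)
    (hA : Admissible p (Fintype.card F) k n) {m : ℤ}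
    (hm : m ≡ n [ZMOD ((Fintype.card F : ℤ) - 1)]) : IsCuspForm ϖ k m (fSeries ϖ k n) where
  holomorphic := isHolomorphic_fSeries hϖ hA.n_pos.ne' hA.two_mul_lt hA.dvd
  transform := fSeries_transform hϖ hA hm
  holomorphic_at_infinity := ⟨_, hasTExpansion_fSeries hϖ k n⟩
  zero_at_infinity := ⟨_, hasTExpansion_fSeries hϖ k n, constantCoeff_fExpansion k n⟩

end TExpansion

/-! ### Different weights -/

section Infinitude

variable {F : Type*} [Field F] [Fintype F] {ϖ : CInf F}

/-- The series `t_a` starts in degree `q ^ deg a`, so `t(a z)` decays doubly exponentially in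
`deg a`. -/
theorem norm_tFun_mul_le {z : CInf F} (hz : carlitzExp F (ϖ * z) ≠ 0)
    {a : F[X]} (ha : a.Monic) (ht : (Fintype.card F : ℝ) * ‖tFun ϖ z‖ < 1) :
    ‖tFun ϖ (ofPoly F a * z)‖ ≤
      ((Fintype.card F : ℝ) * ‖tFun ϖ z‖) ^ Fintype.card F ^ a.natDegree := by
  have hq := card_real_pos F
  obtain ⟨hb, hd⟩ := coeffBound_tSeries ha
  rw [← (hasEval_tSeries hz ha ht).2.tsum_eq]
  refine IsUltrametricDist.norm_tsum_le_of_forall_le_of_nonneg (by positivity) fun j => ?_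
  rcases lt_or_ge j (Fintype.card F ^ a.natDegree) with hj | hj
  · rw [PowerSeries.X_pow_dvd_iff.1 hd j hj, zero_mul, norm_zero]; positivity
  · exact (hb.norm_le _ j).trans (pow_le_pow_of_le_one (by positivity) ht.le hj)

/-- Near infinity `f_{k,1}` is dominated by the term `t(z)` with `a = 1`. -/
theorem exists_fSeries_ne_zero (hϖ : IsCarlitzPeriod ϖ) (k : ℕ) :
    ∃ r : ℝ, ∀ z : Omega F, r ≤ imAbs z.val → fSeries ϖ k 1 z ≠ 0 := by
  have hq := one_lt_card_real F
  have hq0 := card_real_pos F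
  set B : ℝ := (Fintype.card F : ℝ) ^ (k - 1) with hB
  have hB1 : 1 ≤ B := one_le_pow₀ hq.le
  obtain ⟨r, hr⟩ := exists_norm_tFun_le hϖ
    (η := (2 * B * (Fintype.card F : ℝ) * Fintype.card F)⁻¹) (by positivity)
  refine ⟨r, fun z hz h0 => ?_⟩
  have hexp := carlitzExp_mul_ne_zero hϖ z
  set τ := ‖tFun ϖ z.val‖ with hτ
  have hτ0 : 0 < τ := norm_pos_iff.2 (inv_ne_zero hexp)
  have h1 : B * (Fintype.card F * τ) * Fintype.card F ≤ 1 / 2 := by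
    have h2 := hr z hz
    rw [← one_div, le_div_iff₀ (by positivity)] at h2
    linarith
  have hy : B * ((Fintype.card F : ℝ) * τ) ≤ 1 / 2 := by
    have h3 : 0 ≤ B * ((Fintype.card F : ℝ) * τ) := by positivity
    nlinarith
  have ht : (Fintype.card F : ℝ) * τ < 1 := by
    have h3 : 0 ≤ (Fintype.card F : ℝ) * τ := by positivity
    nlinarith
  have hsum := summable_fTerm (k := k) hϖ one_ne_zero z
  have hone : fTerm ϖ k 1 z ⟨1, monic_one⟩ = tFun ϖ z.val := by
    simp [fTerm, gossPoly_one]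
  have hbound : ∀ a : Monics F, a ≠ ⟨1, monic_one⟩ → ‖fTerm ϖ k 1 z a‖ ≤ τ / 2 := by
    intro a ha
    have hd : a.1.natDegree ≠ 0 := fun h => ha (Subtype.ext
      (eq_one_of_monic_natDegree_zero a.2 h))
    have h3 := norm_tFun_mul_le hexp a.2 ht
    rw [fTerm, gossPoly_one, eval_X, norm_mul, norm_pow, norm_ofPoly F a.2.ne_zero, ← pow_mul,
      mul_comm a.1.natDegree, pow_mul, ← hB]
    have h4 : ((Fintype.card F : ℝ) * τ) ^ Fintype.card F ^ a.1.natDegree ≤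
        ((Fintype.card F : ℝ) * τ) ^ (a.1.natDegree + 1) :=
      pow_le_pow_of_le_one (by positivity) ht.le (Nat.lt_pow_self Fintype.one_lt_card)
    calc B ^ a.1.natDegree * ‖tFun ϖ (ofPoly F a.1 * z.val)‖
        ≤ B ^ a.1.natDegree * ((Fintype.card F : ℝ) * τ) ^ (a.1.natDegree + 1) :=
          mul_le_mul_of_nonneg_left (h3.trans h4) (by positivity)
      _ = (B * ((Fintype.card F : ℝ) * τ)) ^ a.1.natDegree * ((Fintype.card F : ℝ) * τ) := by
          rw [mul_pow B, pow_succ]; ring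
      _ ≤ (B * ((Fintype.card F : ℝ) * τ)) * ((Fintype.card F : ℝ) * τ) := by
          refine mul_le_mul_of_nonneg_right ?_ (by positivity)
          exact pow_le_of_le_one (by positivity) (hy.trans (by norm_num)) hd
      _ = (B * (Fintype.card F * τ) * Fintype.card F) * τ := by ring
      _ ≤ 1 / 2 * τ := mul_le_mul_of_nonneg_right h1 hτ0.le
      _ = τ / 2 := by ring
  classical
  have h5 := hsum.sum_add_tsum_compl (s := {⟨1, monic_one⟩})
  rw [Finset.sum_singleton, hone, ← fSeries, h0] at h5
  have h6 := congrArg norm (eq_neg_of_add_eq_zero_left h5)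
  rw [norm_neg, ← hτ] at h6
  have h7 : τ ≤ τ / 2 := h6.le.trans <|
    IsUltrametricDist.norm_tsum_le_of_forall_le_of_nonneg (by positivity) fun a =>
      hbound a.1 (by simpa using a.2)
  linarith

/-- The points `T^j z` have unbounded imaginary part. -/
theorem exists_le_imAbs (r : ℝ) : ∃ z : Omega F, r ≤ imAbs z.val := by
  obtain ⟨z₀⟩ := nonempty_Omega F
  have h0 := imAbs_pos z₀
  obtain ⟨j, hj⟩ := pow_unbounded_of_one_lt (r / imAbs z₀.val) (one_lt_card_real F)
  rw [div_lt_iff₀ h0] at hj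
  set x : KInf F := algebraMap (RatFunc F) (KInf F) (algebraMap F[X] _ (X ^ j)) with hx
  have hxP : ofKInf F x = ofPoly F (X ^ j) := rfl
  have hxn : ‖ofKInf F x‖ = (Fintype.card F : ℝ) ^ j := by
    rw [hxP, map_pow, norm_pow, norm_ofPoly_X]
  have hx0 : ofKInf F x ≠ 0 := by
    rw [← norm_pos_iff, hxn]; exact pow_pos (card_real_pos F) j
  refine ⟨⟨ofKInf F x * z₀.val, ?_⟩, ?_⟩
  · rintro ⟨y, hy⟩
    refine z₀.2 ⟨y / x, ?_⟩
    rw [map_div₀, hy, mul_div_cancel_left₀ _ hx0]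
    rfl
  · refine hj.le.trans ((Metric.le_infDist (Set.range_nonempty _)).2 ?_)
    rintro _ ⟨y, rfl⟩
    have h1 : imAbs z₀.val ≤ dist z₀.val (ofKInf F (y / x)) :=
      Metric.infDist_le_dist_of_mem ⟨_, rfl⟩
    change _ ≤ dist (ofKInf F x * z₀.val) _
    have h2 : ofKInf F x * z₀.val - ofKInf F y =
        ofKInf F x * (z₀.val - ofKInf F (y / x)) := by
      rw [map_div₀]; field_simp
    rw [dist_eq_norm, h2, norm_mul, hxn, ← dist_eq_norm]
    exact mul_le_mul_of_nonneg_left h1 (pow_pos (card_real_pos F) j).le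

/-- The functions `f_{k,1}` of different weights are different, because `-1 / z` acts on them by
different powers of `z`. -/
theorem weight_eq_of_fSeries_eq {p : ℕ} [Fact p.Prime] [CharP F p] (hϖ : IsCarlitzPeriod ϖ)
    {k k' : ℕ} (hk : Admissible p (Fintype.card F) k 1) (hk' : Admissible p (Fintype.card F) k' 1)
    (h : fSeries ϖ k 1 = fSeries ϖ k' 1) : k = k' := by
  obtain ⟨r, hr⟩ := exists_fSeries_ne_zero hϖ k
  obtain ⟨z, hz⟩ := exists_le_imAbs (F := F) (max r 2)
  have hne := hr z ((le_max_left _ _).trans hz)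
  have h1 : 1 < ‖z.val‖ := by
    have h2 : imAbs z.val ≤ dist z.val 0 := Metric.infDist_le_dist_of_mem ⟨0, map_zero _⟩
    rw [dist_zero_right] at h2
    linarith [(le_max_right r 2).trans hz]
  obtain ⟨-, hden, hdet⟩ := moebius_transInv 0 z
  have e1 := fSeries_transform hϖ hk (m := 1) (by simp) (transInv 0) z
  have e2 := fSeries_transform hϖ hk' (m := 1) (by simp) (transInv 0) z
  rw [← h, e1, hden, hdet, one_zpow, mul_one, mul_one] at e2
  have e3 := congrArg norm (mul_right_cancel₀ hne e2)
  rw [norm_pow, norm_pow] at e3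
  exact pow_right_injective₀ (by linarith) h1.ne' e3

end Infinitude

end Drinfeld

end

theorem theorem1 {F : Type*} [Field F] [Fintype F] (p : ℕ) [Fact p.Prime] [CharP F p]
    (ϖ : CInf F) (hϖ : IsCarlitzPeriod ϖ) :
    (∀ k n : ℕ, Admissible p (Fintype.card F) k n →
      (∀ z : Omega F, Summable (fTerm ϖ k n z)) ∧
      (∀ m : ℤ, m ≡ n [ZMOD ((Fintype.card F : ℤ) - 1)] →
        IsCuspForm ϖ k m (fSeries ϖ k n)) ∧
      HasAExpansion ϖ (fSeries ϖ k n) n 0 (fun a => ofPoly F a.1 ^ (k - n))) ∧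
    {f : Omega F → CInf F | ∃ k n : ℕ, Admissible p (Fintype.card F) k n ∧
      f = fSeries ϖ k n}.Infinite := by
  refine ⟨fun k n hA => ⟨summable_fTerm hϖ hA.n_pos.ne', fun m hm => isCuspForm_fSeries hϖ hA hm,
    hasAExpansion_fSeries hϖ k n⟩, ?_⟩
  have hq : 1 < Fintype.card F := Fintype.one_lt_card
  have hA : ∀ j : ℕ, Admissible p (Fintype.card F) (2 + (j + 1) * (Fintype.card F - 1)) 1 := by
    intro j
    have hpos : 0 < (j + 1) * (Fintype.card F - 1) := Nat.mul_pos j.succ_pos (by omega)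
    refine ⟨by omega, one_pos, by omega, ?_, Nat.one_le_pow _ _ (Fact.out : p.Prime).pos⟩
    rw [mul_one, Nat.add_sub_cancel_left]
    exact dvd_mul_left _ _
  refine Set.infinite_of_injective_forall_mem
    (f := fun j : ℕ => fSeries ϖ (2 + (j + 1) * (Fintype.card F - 1)) 1) (fun i j hij => ?_)
    fun j => ⟨_, 1, hA j, rfl⟩
  have h1 := weight_eq_of_fSeries_eq hϖ (hA i) (hA j) hij
  have h2 := Nat.eq_of_mul_eq_mul_right (by omega : 0 < Fintype.card F - 1)
    (Nat.add_left_cancel h1)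
  omega
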